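/- **Setting.** Let $(X,Y)\in\mathbb R^p\times\mathbb R$ have distribution $Q$ with $\mathbb E_Q[Y]=0$, with $\|X\|_\infty\le M_X<\infty$ and $|Y|\le M_Y<\infty$ almost surely, and with $\mathrm{Var}_Q(X_l)>0$ for all $l\in[p]$. Let $\mu$ be a nonzero finite measure whose support is contained in $[m_\mu,M_\mu]$ for some $0<m_\mu\le M_\mu<\infty$, let $h(z)=\int_0^\infty e^{-tz}\,\mu(dt)$, and let $\mathcal H$ be the reproducing kernel Hilbert space of functions on $\mathbb R^p$ with kernel $k(x,x')=h(\|x-x'\|_1)$ (that is, $q=1$). For $\lambda>0$ and a probability measure $P$ on $\mathbb R^p\times\mathbb R$ put $$F_\lambda(\beta;P)=\min_{f\in\mathcal H}\ \tfrac12\,\mathbb E_P\big[(Y-f(\beta\odot X))^2\big]+\tfrac{\lambda}{2}\|f\|_{\mathcal H}^2 .$$ Let $Q_n$ be the empirical distribution of $n$ i.i.d. draws from $Q$. Fix $M>0$, let $\mathcal B=\{\beta\in\mathbb R^p:\beta\ge0,\ \|\beta\|_\infty\le M\}$, and let $\mathsf N_{\mathcal B}(\beta)$ be the normal cone of $\mathcal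 B$ at $\beta$. A trajectory of the projected gradient flow of $F_\lambda(\cdot;Q_n)$ is an absolutely continuous function $\widetilde\beta:[0,\infty)\to\mathbb R^p$ with $\dot{\widetilde\beta}(t)\in-\nabla F_\lambda(\widetilde\beta(t);Q_n)-\mathsf N_{\mathcal B}(\widetilde\beta(t))$ for almost every $t\ge0$, where the gradient is taken within $\mathcal B$ (one-sided at its boundary). Let the signal set $S$ be the minimal subset of $[p]$ such that $\mathbb E_Q[Y\mid X]=\mathbb E_Q[Y\mid X_S]$ and $X_S$ is independent of $X_{S^c}$ under $Q$. Assume that the set of main effect signals $\{l\in S:\mathrm{Var}_Q(\mathbb E_Q[Y\mid X_l])\neq0\}$ is not empty. **Theorem.** There are constants $\lambda_0,c,C,\tau>0$, independent of $n$ and of $\lambda_n$, such that for all $n$ and all $0<\lambda_n\le\lambda_0$ with $n\lambda_n^8\ge C$, the following holds with probability at least $1-\exp(-c\,n\,\lambda_n^8)$: the projected gradient flow of $F_{\lambda_n}(\cdot;Q_n)$ has a trajectory started at $\widetilde\beta(0)=0$, and every such trajectory satisfies $$\emptyset\neq\mathrm{supp}(\widetilde\beta(t))\subseteq S\qquad\text{for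 all }t\ge\tau .$$ -/

import Mathlib

open MeasureTheory ProbabilityTheory
open scoped RealInnerProductSpace Matrix

noncomputable section

namespace KernelSelection

/-! ### The `ℓ₁`-type kernel and its reproducing kernel Hilbert space -/

/-- The profile `h(z) = ∫₀^∞ exp(-t z) μ(dt)` of the kernel. -/
def profile (μ : Measure ℝ) (z : ℝ) : ℝ :=
  ∫ t in Set.Ioi (0 : ℝ), Real.exp (-(t * z)) ∂μ

/-- The kernel `k(x, x') = h(‖x - x'‖₁)` on `ℝ^p`. -/
def kernelFn {p : ℕ} (μ : Measure ℝ) (x y : Fin p → ℝ) : ℝ :=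
  profile μ (∑ j, |x j - y j|)

/-- The kernel in the form used by Mathlib: `k(x, x')` is viewed as the operator
"multiplication by `k(x, x')`" on `ℝ`. -/
def kernelMatrix (p : ℕ) (μ : Measure ℝ) : Matrix (Fin p → ℝ) (Fin p → ℝ) (ℝ →L[ℝ] ℝ) :=
  Matrix.of fun x y => kernelFn μ x y • ContinuousLinearMap.id ℝ ℝ

/-- The kernel `min a b` on positive numbers is positive semidefinite. -/
theorem sum_min_nonneg {ι : Type*} (s : Finset ι) (a c : ι → ℝ) (ha : ∀ i, 0 < a i) :
    0 ≤ ∑ i ∈ s, ∑ j ∈ s, c i * c j * min (a i) (a j) := by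
  let g : ι → ℝ → ℝ := fun i => (Set.Ioc 0 (a i)).indicator 1
  have hprod : ∀ i j, (fun u => g i u * g j u) = (Set.Ioc 0 (min (a i) (a j))).indicator 1 := by
    intro i j
    funext u
    simp only [g, Set.indicator_apply, Set.mem_Ioc, le_min_iff, Pi.one_apply]
    by_cases h0 : 0 < u <;> by_cases h1 : u ≤ a i <;> by_cases h2 : u ≤ a j <;> simp [h0, h1, h2]
  have hint : ∀ i j, Integrable (fun u => g i u * g j u) (volume : Measure ℝ) := by
    intro i j
    rw [hprod]
    exact (integrable_indicator_iff measurableSet_Ioc).2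
      (integrableOn_const (by simp) (by simp))
  have hval : ∀ i j, ∫ u, g i u * g j u = min (a i) (a j) := by
    intro i j
    rw [hprod, integral_indicator_one measurableSet_Ioc]
    have h0 : 0 ≤ min (a i) (a j) := le_min (ha i).le (ha j).le
    rw [Measure.real, Real.volume_Ioc, sub_zero, ENNReal.toReal_ofReal h0]
  have key : ∑ i ∈ s, ∑ j ∈ s, c i * c j * min (a i) (a j)
      = ∫ u, (∑ i ∈ s, c i * g i u) ^ 2 := by
    have : ∀ u, (∑ i ∈ s, c i * g i u) ^ 2
        = ∑ i ∈ s, ∑ j ∈ s, c i * c j * (g i u * g j u) := by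
      intro u
      rw [sq, Finset.sum_mul_sum]
      refine Finset.sum_congr rfl fun i _ => Finset.sum_congr rfl fun j _ => by ring
    simp_rw [this]
    rw [integral_finsetSum _ fun i _ => integrable_finsetSum _ fun j _ => (hint i j).const_mul _]
    refine Finset.sum_congr rfl fun i _ => ?_
    rw [integral_finsetSum _ fun j _ => (hint i j).const_mul _]
    refine Finset.sum_congr rfl fun j _ => ?_
    rw [integral_const_mul, hval]
  rw [key]
  exact integral_nonneg fun u => sq_nonneg _

/-- The one-dimensional Laplace kernel is positive semidefinite. -/
theorem posSemidef_laplace {ι : Type*} (a : ι → ℝ) (t : ℝ) (ht : 0 ≤ t) :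
    (Matrix.of fun i j => Real.exp (-(t * |a i - a j|)) : Matrix ι ι ℝ).PosSemidef := by
  refine ⟨?_, fun c => ?_⟩
  · ext i j
    simp [abs_sub_comm]
  · have hk : ∀ i j, Real.exp (-(t * |a i - a j|)) = Real.exp (-(t * a i)) * Real.exp (-(t * a j))
        * min (Real.exp (2 * t * a i)) (Real.exp (2 * t * a j)) := by
      intro i j
      rw [← Real.exp_monotone.map_min, ← Real.exp_add, ← Real.exp_add]
      congr 1
      rcases le_total (a i) (a j) with h | h
      · rw [min_eq_left (by nlinarith), abs_of_nonpos (by linarith)]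
        ring
      · rw [min_eq_right (by nlinarith), abs_of_nonneg (by linarith)]
        ring
    have := sum_min_nonneg c.support (fun i => Real.exp (2 * t * a i))
      (fun i => c i * Real.exp (-(t * a i))) (fun i => Real.exp_pos _)
    refine this.trans_eq ?_
    simp only [Finsupp.sum, Matrix.of_apply, star_trivial, hk]
    refine Finset.sum_congr rfl fun i _ => Finset.sum_congr rfl fun j _ => by ring

/-- The multi-dimensional Laplace kernel is positive semidefinite. -/
theorem posSemidef_expSum {ι : Type*} {p : ℕ} (a : ι → Fin p → ℝ) (t : ℝ) (ht : 0 ≤ t)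
    (s : Finset (Fin p)) :
    (Matrix.of fun i j => Real.exp (-(t * ∑ l ∈ s, |a i l - a j l|)) :
      Matrix ι ι ℝ).PosSemidef := by
  classical
  induction s using Finset.induction_on with
  | empty =>
    have := posSemidef_laplace (fun _ : ι => (0 : ℝ)) 0 le_rfl
    simpa using this
  | insert l s hl ih =>
    have := (posSemidef_laplace (fun i => a i l) t ht).hadamard ih
    convert! this using 1
    ext i j
    simp [Finset.sum_insert hl, ← Real.exp_add, mul_add, add_comm]

theorem integrableOn_exp {μ : Measure ℝ} [IsFiniteMeasure μ] {z : ℝ} (hz : 0 ≤ z) :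
    IntegrableOn (fun t => Real.exp (-(t * z))) (Set.Ioi 0) μ := by
  refine Integrable.mono' (integrable_const (1 : ℝ)) (by fun_prop) ?_
  filter_upwards [ae_restrict_mem measurableSet_Ioi] with t ht
  rw [Real.norm_eq_abs, abs_of_pos (Real.exp_pos _), Real.exp_le_one_iff]
  have : 0 ≤ t * z := mul_nonneg (le_of_lt ht) hz
  linarith

theorem sum_kernelFn_nonneg {p : ℕ} (μ : Measure ℝ) [IsFiniteMeasure μ]
    (c : (Fin p → ℝ) →₀ ℝ) :
    0 ≤ c.sum fun x w => c.sum fun y w' => w * kernelFn μ x y * w' := by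
  have hpt : ∀ t ∈ Set.Ioi (0 : ℝ), 0 ≤ ∑ x ∈ c.support, ∑ y ∈ c.support,
      c x * Real.exp (-(t * ∑ j, |x j - y j|)) * c y := by
    intro t ht
    have := (posSemidef_expSum (fun x : Fin p → ℝ => x) t (le_of_lt ht) Finset.univ).2 c
    simpa [Finsupp.sum] using this
  have hint : ∀ x y : Fin p → ℝ, Integrable (fun t => c x * Real.exp (-(t * ∑ j, |x j - y j|)) * c y)
      (μ.restrict (Set.Ioi 0)) := fun x y =>
    ((integrableOn_exp (Finset.sum_nonneg fun j _ => abs_nonneg _)).const_mul _).mul_const _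
  have key : (c.sum fun x w => c.sum fun y w' => w * kernelFn μ x y * w')
      = ∫ t in Set.Ioi (0 : ℝ), ∑ x ∈ c.support, ∑ y ∈ c.support,
        c x * Real.exp (-(t * ∑ j, |x j - y j|)) * c y ∂μ := by
    rw [integral_finsetSum _ fun x _ => integrable_finsetSum _ fun y _ => hint x y]
    refine Finset.sum_congr rfl fun x _ => ?_
    rw [integral_finsetSum _ fun y _ => hint x y]
    refine Finset.sum_congr rfl fun y _ => ?_
    rw [integral_mul_const, integral_const_mul]
    rfl
  rw [key]
  exact setIntegral_nonneg measurableSet_Ioi hpt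

theorem posSemidef_kernelMatrix (p : ℕ) (μ : Measure ℝ) [IsFiniteMeasure μ] :
    (kernelMatrix p μ).PosSemidef := by
  have hsymm : ∀ x y : Fin p → ℝ, kernelFn μ y x = kernelFn μ x y := fun x y => by
    simp [kernelFn, abs_sub_comm]
  have htfae := (RKHS.posSemidef_tfae (K := kernelMatrix p μ)).out 0 2
  rw [htfae]
  refine ⟨?_, fun c => ?_⟩
  · ext x y
    have hid : star (ContinuousLinearMap.id ℝ ℝ) = ContinuousLinearMap.id ℝ ℝ :=
      star_one (ℝ →L[ℝ] ℝ)
    simp [kernelMatrix, Matrix.conjTranspose_apply, hsymm x y, hid]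
  · refine (sum_kernelFn_nonneg μ c).trans_eq ?_
    simp only [RCLike.re_to_real, Finsupp.sum]
    refine Finset.sum_congr rfl fun x _ => Finset.sum_congr rfl fun y _ => ?_
    simp only [kernelMatrix, Matrix.of_apply, hsymm x y, smul_apply,
      ContinuousLinearMap.id_apply, smul_eq_mul, RCLike.inner_apply, conj_trivial]
    ring

instance (p : ℕ) (μ : Measure ℝ) [IsFiniteMeasure μ] : Fact (kernelMatrix p μ).PosSemidef :=
  ⟨posSemidef_kernelMatrix p μ⟩

/-- The reproducing kernel Hilbert space `ℋ` of functions on `ℝ^p` with kernel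
`k(x, x') = h(‖x - x'‖₁)`. -/
abbrev KernelSpace (p : ℕ) (μ : Measure ℝ) [IsFiniteMeasure μ] : Type :=
  RKHS.OfKernel (kernelMatrix p μ)

/-! ### The kernel ridge regression objective -/

/-- The kernel ridge regression objective (for `q = 1`)
`F_λ(β; Q) = min_{f ∈ ℋ} ½ E_Q[(Y - f(β ⊙ X))²] + (λ/2) ‖f‖²_ℋ`. -/
def krrObjective {p : ℕ} (μ : Measure ℝ) [IsFiniteMeasure μ] (lam : ℝ)
    (Q : Measure ((Fin p → ℝ) × ℝ)) (β : EuclideanSpace ℝ (Fin p)) : ℝ :=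
  ⨅ f : KernelSpace p μ,
    (1 / 2) * ∫ z, (z.2 - f (fun j => β j * z.1 j)) ^ 2 ∂Q + (lam / 2) * ‖f‖ ^ 2

/-- The empirical distribution `Q_n = n⁻¹ ∑ᵢ δ_{(Xᵢ, Yᵢ)}` of a sample. -/
def empirical {p n : ℕ} (d : Fin n → (Fin p → ℝ) × ℝ) : Measure ((Fin p → ℝ) × ℝ) :=
  (n : ENNReal)⁻¹ • ∑ i, Measure.dirac (d i)

/-! ### Projected gradient flow -/

/-- The feasible box `{β : β ≥ 0, ‖β‖_∞ ≤ M}`. -/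
def box (p : ℕ) (M : ℝ) : Set (EuclideanSpace ℝ (Fin p)) :=
  {β | ∀ j, 0 ≤ β j ∧ β j ≤ M}

/-- The normal cone of a set at a point (empty at points outside the set). -/
def normalCone {p : ℕ} (B : Set (EuclideanSpace ℝ (Fin p))) (x : EuclideanSpace ℝ (Fin p)) :
    Set (EuclideanSpace ℝ (Fin p)) :=
  {w | x ∈ B ∧ ∀ y ∈ B, ⟪w, y - x⟫ ≤ 0}

/-- The right-hand side `-∇F(x) - N_B(x)` of the projected gradient inclusion. The objective
is a function on `B`, so its gradient is taken within `B`: at boundary points the partial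
derivatives are the one-sided ones. -/
def gradientInclusion {p : ℕ} (F : EuclideanSpace ℝ (Fin p) → ℝ)
    (B : Set (EuclideanSpace ℝ (Fin p))) (x : EuclideanSpace ℝ (Fin p)) :
    Set (EuclideanSpace ℝ (Fin p)) :=
  {v | ∃ g w, HasGradientWithinAt F g B x ∧ w ∈ normalCone B x ∧ v = -g - w}

/-- `β : [0, ∞) → ℝ^p` is a trajectory of the projected gradient flow
`β'(t) ∈ -∇F(β(t)) - N_B(β(t))`: an absolutely continuous function which is the integral of a
locally integrable selection of the right-hand side. -/
def IsGradientFlow {p : ℕ} (F : EuclideanSpace ℝ (Fin p) → ℝ)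
    (B : Set (EuclideanSpace ℝ (Fin p))) (β : ℝ → EuclideanSpace ℝ (Fin p)) : Prop :=
  ∃ v : ℝ → EuclideanSpace ℝ (Fin p),
    (∀ t, 0 ≤ t → IntervalIntegrable v volume 0 t) ∧
    (∀ t, 0 ≤ t → β t = β 0 + ∫ s in (0 : ℝ)..t, v s) ∧
    ∀ᵐ s ∂(volume.restrict (Set.Ici (0 : ℝ))), v s ∈ gradientInclusion F B (β s)

/-- The support of a vector. -/
def supp {p : ℕ} (β : EuclideanSpace ℝ (Fin p)) : Set (Fin p) := {j | β j ≠ 0}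

/-! ### Assumptions on the population distribution and the signal set -/

/-- The standing assumptions on the distribution `Q` of `(X, Y)`. -/
structure IsRegularDistribution {p : ℕ} (Q : Measure ((Fin p → ℝ) × ℝ)) : Prop where
  centered : ∫ z, z.2 ∂Q = 0
  bounded_X : ∃ MX : ℝ, ∀ᵐ z ∂Q, ∀ j, |z.1 j| ≤ MX
  bounded_Y : ∃ MY : ℝ, ∀ᵐ z ∂Q, |z.2| ≤ MY
  variance_pos : ∀ j, 0 < variance (fun z : (Fin p → ℝ) × ℝ => z.1 j) Q

/-- The conditional expectation `E_Q[Y | X_A]`, as a random variable. -/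
def regression {p : ℕ} (Q : Measure ((Fin p → ℝ) × ℝ)) (A : Finset (Fin p)) :
    (Fin p → ℝ) × ℝ → ℝ :=
  condExp (MeasurableSpace.comap (fun z : (Fin p → ℝ) × ℝ => A.restrict z.1) inferInstance) Q
    (fun z => z.2)

/-- `E_Q[Y | X] = E_Q[Y | X_S]` and `X_S` is independent of `X_{Sᶜ}`. -/
structure IsSignalCandidate {p : ℕ} (Q : Measure ((Fin p → ℝ) × ℝ)) (S : Finset (Fin p)) :
    Prop where
  regression_eq : regression Q Finset.univ =ᵐ[Q] regression Q S
  indep : IndepFun (fun z : (Fin p → ℝ) × ℝ => S.restrict z.1)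
    (fun z : (Fin p → ℝ) × ℝ => Sᶜ.restrict z.1) Q

/-- The signal set: the minimal set of features with the two properties above. -/
def IsSignalSet {p : ℕ} (Q : Measure ((Fin p → ℝ) × ℝ)) (S : Finset (Fin p)) : Prop :=
  Minimal (IsSignalCandidate Q) S

/-- The set of main effect signals, `{l ∈ S : Var_Q(E_Q[Y | X_l]) ≠ 0}`. -/
def mainEffects {p : ℕ} (Q : Measure ((Fin p → ℝ) × ℝ)) (S : Finset (Fin p)) : Set (Fin p) :=
  {l | l ∈ S ∧ variance (regression Q {l}) Q ≠ 0}

end KernelSelection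

end

/-!
Let `r_w` be the residual `y - f_w` of the ridge estimator `f_w` at nonnegative weights `w`. It
solves the integral equation `λ (y - r_w(z)) = E[r_w(Z) k_w(Z, z)]` with the kernel
`k_w(z, z') = h(∑ⱼ wⱼ |xⱼ - x'ⱼ|)`, the objective equals `½ E[Y r_w]`, and its partial derivatives
are `(2λ)⁻¹ E[r_w(Z) r_w(Z') α_l(Z, Z')]` with `α_l = -h'(·) |x_l - x'_l|` (`krrGradient`,
`abs_krr_taylor_le`). Since `k_w` is positive semidefinite, the integral equation is stable in `L¹`
(`integral_abs_le_of_eq`); this makes the gradient bounded by `O(λ⁻¹)` and Lipschitz with a constant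
`O(λ⁻²)`, and it turns a uniform error `e` in the integral equation into an error `O(e / λ)` of the
residual. All estimates hold for every distribution of the data in a fixed bounded set, hence for
the population `Q` and for the empirical distribution at once.

Two facts concern the population.
* At `w = 0` and for a main effect signal `l`, the partial derivative is a positive multiple of
  `λ⁻¹ E[Y Y' |X_l - X'_l|]`, which is negative: `-|x - x'|` is conditionally positive definite, and
  strictly so unless `E[Y | X_l]` is constant (`pairing_neg_of_mem_mainEffects`,
  `krrGradient_zero`).
* If `w` is supported in `S` and `l ∉ S`, then independence of `X_S` and `X_{Sᶜ}` factorizes the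
  partial derivative as `E|X_l - X'_l|` times a quadratic form in `r_w` with the kernel `-h'`. As
  `-h'(z) = a h(z) + ∫ (t - a) exp(-t z) μ(dt)` with `μ` living on `t ≥ a`, that form dominates
  `a E[r_w r_w' k_w] = a λ² ‖f_w‖²`, and the derivative is at least a multiple of `λ ‖f_w‖²`
  (`krrGradient_noise_ge`).

The flow from the origin then runs through two phases (`IsBoxTrajectory.supp_subset`). Up to a time
`t₁` of order `λ²`, the slope of order `λ⁻¹` in a main effect direction lowers the objective by an
amount `δ` that does not depend on `λ`, while the coordinates outside `S`, whose derivatives are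
almost nonnegative, stay of total size below `κ`, of order `λ³`. From then on the objective remains
below its initial value by `δ`, so the weights are nonzero and the norm of the population estimator
is bounded below (`le_norm_ridge_of_objective_le`); hence the derivatives outside `S` are at least a
multiple of `λ`, which drives these coordinates to zero within a time of order `κ / λ`.

For the empirical distribution the same argument runs with gradients that deviate from those of the
population by a small multiple of `λ`. This holds if the empirical averages of `r_w(·) k_w(·, z)`
and `r_w(·) α_l(·, z)`, with the population residual `r_w`, are within `η λ³` of their expectations,
uniformly in `w` and `z` (`abs_krrGradient_sub_le_of_deviation`). These functions are bounded by
`O(λ^{-1/2})` and Lipschitz in `(w, z)`, so Hoeffding's inequality on a grid gives this with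
probability at least `1 - exp(-c n λ⁸)` (`exists_deviation_event`); the union bound is absorbed
because the exponent in Hoeffding's inequality is of order `n λ⁷`.

A trajectory exists by the Euler scheme with projections onto the box (`exists_flow`).
-/

namespace KernelSelection

/-! ### Kernel ridge regression in a Hilbert space of features -/

section Ridge

variable {Z H : Type*} [MeasurableSpace Z] [NormedAddCommGroup H] [InnerProductSpace ℝ H]
  {P : Measure Z} {Φ : Z → H} {C : ℝ} {Y : Z → ℝ} {MY lam : ℝ}

theorem integrable_smul_feature [IsFiniteMeasure P] (hΦ : AEStronglyMeasurable Φ P)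
    (hC : ∀ z, ‖Φ z‖ ≤ C) {u : Z → ℝ} (hu : Integrable u P) :
    Integrable (fun z => u z • Φ z) P :=
  hu.smul_bdd C hΦ (ae_of_all _ hC)

theorem integrable_inner_feature [IsFiniteMeasure P] (hΦ : AEStronglyMeasurable Φ P)
    (hC : ∀ z, ‖Φ z‖ ≤ C) (f : H) : Integrable (fun z => ⟪Φ z, f⟫) P :=
  Integrable.of_bound (hΦ.inner_const (𝕜 := ℝ)) (C * ‖f‖)
    (ae_of_all _ fun z => (norm_inner_le_norm _ _).trans (by gcongr; exact hC z))

variable [CompleteSpace H]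

/-- The normal equation of ridge regression has a solution, by the Lax–Milgram theorem. -/
theorem exists_ridge [IsFiniteMeasure P] (hΦ : AEStronglyMeasurable Φ P)
    (hC : ∀ z, ‖Φ z‖ ≤ C) (hY : Integrable Y P) (hlam : 0 < lam) :
    ∃ f : H, lam • f = ∫ z, (Y z - ⟪Φ z, f⟫) • Φ z ∂P := by
  have hcont : Continuous fun h : H => (innerSL ℝ h).smulRight h := by
    fun_prop
  have hTi : Integrable (fun z => (innerSL ℝ (Φ z)).smulRight (Φ z)) P := by
    refine Integrable.of_bound (hcont.comp_aestronglyMeasurable hΦ) (C * C)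
      (ae_of_all _ fun z => ?_)
    rw [ContinuousLinearMap.norm_smulRight_apply, innerSL_apply_norm]
    have := (norm_nonneg _).trans (hC z)
    exact mul_le_mul (hC z) (hC z) (norm_nonneg _) this
  let T : H →L[ℝ] H := ∫ z, (innerSL ℝ (Φ z)).smulRight (Φ z) ∂P
  have hT : ∀ f, T f = ∫ z, ⟪Φ z, f⟫ • Φ z ∂P := fun f => by
    simp only [T]
    rw [ContinuousLinearMap.integral_apply hTi]
    simp
  let B : H →L[ℝ] H →L[ℝ] ℝ := (innerSL ℝ).comp (T + lam • ContinuousLinearMap.id ℝ H)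
  have hB : ∀ f g, B f g = ⟪T f + lam • f, g⟫ := fun f g => by
    simp [B, inner_add_left, real_inner_smul_left]
    exact Or.inl rfl
  have hco : IsCoercive B := by
    refine ⟨lam, hlam, fun f => ?_⟩
    rw [hB, inner_add_left, hT, real_inner_smul_left, real_inner_self_eq_norm_sq, real_inner_comm,
      ← integral_inner (integrable_smul_feature hΦ hC (integrable_inner_feature hΦ hC f))]
    have : 0 ≤ ∫ z, ⟪f, ⟪Φ z, f⟫ • Φ z⟫ ∂P := integral_nonneg fun z => by
      simp only [real_inner_smul_right, Pi.zero_apply]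
      rw [real_inner_comm]
      exact mul_self_nonneg _
    nlinarith
  refine ⟨hco.continuousLinearEquivOfBilin.symm (∫ z, Y z • Φ z ∂P), ?_⟩
  set f := hco.continuousLinearEquivOfBilin.symm (∫ z, Y z • Φ z ∂P) with hf
  have h1 : T f + lam • f = ∫ z, Y z • Φ z ∂P := by
    rw [hco.unique_continuousLinearEquivOfBilin (fun w => (hB f w).symm), hf,
      ContinuousLinearEquiv.apply_symm_apply]
  simp_rw [sub_smul]
  rw [integral_sub (integrable_smul_feature hΦ hC hY)
    (integrable_smul_feature hΦ hC (integrable_inner_feature hΦ hC f)), ← h1, hT]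
  abel

theorem inner_ridge [IsFiniteMeasure P] (hΦ : AEStronglyMeasurable Φ P)
    (hC : ∀ z, ‖Φ z‖ ≤ C) {u : Z → ℝ} (hu : Integrable u P) (g : H) :
    ⟪∫ z, u z • Φ z ∂P, g⟫ = ∫ z, u z * ⟪Φ z, g⟫ ∂P := by
  rw [real_inner_comm, ← integral_inner (integrable_smul_feature hΦ hC hu)]
  refine integral_congr_ae (ae_of_all _ fun z => ?_)
  simp only [real_inner_smul_right, real_inner_comm]

theorem inner_integral_smul_feature [IsFiniteMeasure P] (hΦ : AEStronglyMeasurable Φ P)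
    (hC : ∀ z, ‖Φ z‖ ≤ C) {u v : Z → ℝ} (hu : Integrable u P) (hv : Integrable v P) :
    ⟪∫ z, u z • Φ z ∂P, ∫ z, v z • Φ z ∂P⟫
      = ∫ z, u z * ∫ w, v w * ⟪Φ z, Φ w⟫ ∂P ∂P := by
  rw [inner_ridge hΦ hC hu]
  refine integral_congr_ae (ae_of_all _ fun z => ?_)
  dsimp only
  rw [real_inner_comm, inner_ridge hΦ hC hv]
  simp only [real_inner_comm]

/-- The energy identity at a solution of the normal equation. -/
theorem ridge_energy [IsFiniteMeasure P] (hΦ : AEStronglyMeasurable Φ P)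
    (hC : ∀ z, ‖Φ z‖ ≤ C) (hY : Integrable Y P) {f : H}
    (hf : lam • f = ∫ z, (Y z - ⟪Φ z, f⟫) • Φ z ∂P) (g : H) :
    lam * ⟪f, g⟫ = ∫ z, (Y z - ⟪Φ z, f⟫) * ⟪Φ z, g⟫ ∂P := by
  have hi : Integrable (fun z => Y z - ⟪Φ z, f⟫) P := hY.sub (integrable_inner_feature hΦ hC f)
  rw [← real_inner_smul_left, hf, inner_ridge hΦ hC hi]

/-- The value of the ridge regression problem is half the correlation between response and
residual. -/
theorem ridge_value [IsFiniteMeasure P] (hΦ : AEStronglyMeasurable Φ P)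
    (hC : ∀ z, ‖Φ z‖ ≤ C) (hY : AEStronglyMeasurable Y P) (hYb : ∀ᵐ z ∂P, |Y z| ≤ MY)
    (hlam : 0 < lam) {f : H} (hf : lam • f = ∫ z, (Y z - ⟪Φ z, f⟫) • Φ z ∂P) :
    ⨅ g : H, (1 / 2) * ∫ z, (Y z - ⟪Φ z, g⟫) ^ 2 ∂P + (lam / 2) * ‖g‖ ^ 2
      = (1 / 2) * ∫ z, Y z * (Y z - ⟪Φ z, f⟫) ∂P := by
  have hm : ∀ g : H, MemLp (fun z => ⟪Φ z, g⟫) 2 P := fun g =>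
    MemLp.of_bound (hΦ.inner_const (𝕜 := ℝ)) (C * ‖g‖)
      (ae_of_all _ fun z => (norm_inner_le_norm _ _).trans (by gcongr; exact hC z))
  have hYm : MemLp Y 2 P := MemLp.of_bound hY MY hYb
  have hYi : Integrable Y P := hYm.integrable (by norm_num)
  have hr : MemLp (fun z => Y z - ⟪Φ z, f⟫) 2 P := hYm.sub (hm f)
  have key : ∀ g : H, (1 / 2) * ∫ z, (Y z - ⟪Φ z, g⟫) ^ 2 ∂P + (lam / 2) * ‖g‖ ^ 2
      = (1 / 2) * ∫ z, Y z * (Y z - ⟪Φ z, f⟫) ∂P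
        + ((1 / 2) * ∫ z, ⟪Φ z, g - f⟫ ^ 2 ∂P + (lam / 2) * ‖g - f‖ ^ 2) := by
    intro g
    have e1 := ridge_energy hΦ hC hYi hf (g - f)
    have e2 := ridge_energy hΦ hC hYi hf f
    have i1 : Integrable (fun z => (Y z - ⟪Φ z, f⟫) * ⟪Φ z, g - f⟫) P := hr.integrable_mul (hm _)
    have i2 : Integrable (fun z => (Y z - ⟪Φ z, f⟫) * ⟪Φ z, f⟫) P := hr.integrable_mul (hm _)
    have i3 : Integrable (fun z => Y z * (Y z - ⟪Φ z, f⟫)) P := hYm.integrable_mul hr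
    have i4 : Integrable (fun z => ⟪Φ z, g - f⟫ ^ 2) P := (hm _).integrable_sq
    have h1 : ∫ z, (Y z - ⟪Φ z, g⟫) ^ 2 ∂P
        = ∫ z, Y z * (Y z - ⟪Φ z, f⟫) ∂P - ∫ z, (Y z - ⟪Φ z, f⟫) * ⟪Φ z, f⟫ ∂P
          - 2 * ∫ z, (Y z - ⟪Φ z, f⟫) * ⟪Φ z, g - f⟫ ∂P + ∫ z, ⟪Φ z, g - f⟫ ^ 2 ∂P := by
      have i5 : Integrable (fun z => Y z * (Y z - ⟪Φ z, f⟫) - (Y z - ⟪Φ z, f⟫) * ⟪Φ z, f⟫) P :=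
        i3.sub i2
      have i6 : Integrable (fun z => Y z * (Y z - ⟪Φ z, f⟫) - (Y z - ⟪Φ z, f⟫) * ⟪Φ z, f⟫
          - 2 * ((Y z - ⟪Φ z, f⟫) * ⟪Φ z, g - f⟫)) P := i5.sub (i1.const_mul 2)
      rw [← integral_const_mul, ← integral_sub i3 i2, ← integral_sub i5 (i1.const_mul 2),
        ← integral_add i6 i4]
      refine integral_congr_ae (ae_of_all _ fun z => ?_)
      simp only [inner_sub_right]
      ring
    have h2 : ‖g‖ ^ 2 = ‖g - f‖ ^ 2 + 2 * ⟪f, g - f⟫ + ⟪f, f⟫ := by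
      rw [← real_inner_self_eq_norm_sq, ← real_inner_self_eq_norm_sq]
      simp only [inner_sub_left, inner_sub_right, real_inner_comm]
      ring
    rw [h1, h2, ← e1, ← e2]
    ring
  have hnn : ∀ g : H, 0 ≤ (1 / 2) * ∫ z, ⟪Φ z, g - f⟫ ^ 2 ∂P + (lam / 2) * ‖g - f‖ ^ 2 :=
    fun g => add_nonneg (mul_nonneg (by norm_num) (integral_nonneg fun z => sq_nonneg _))
      (by positivity)
  refine le_antisymm ?_ (le_ciInf fun g => by rw [key g]; linarith [hnn g])
  refine (ciInf_le ⟨(1 / 2) * ∫ z, Y z * (Y z - ⟪Φ z, f⟫) ∂P, ?_⟩ f).trans_eq ?_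
  · rintro _ ⟨g, rfl⟩
    dsimp only
    rw [key g]
    linarith [hnn g]
  · rw [key f]
    simp

end Ridge

/-! ### The kernel profile and its slope -/

/-- Minus the derivative of the profile, `-h'(z) = ∫₀^∞ t exp(-t z) μ(dt)`. -/
noncomputable def slope (μ : Measure ℝ) (z : ℝ) : ℝ :=
  ∫ t in Set.Ioi (0 : ℝ), t * Real.exp (-(t * z)) ∂μ

theorem abs_exp_neg_sub_le {x y : ℝ} (hx : 0 ≤ x) (hy : 0 ≤ y) :
    |Real.exp (-x) - Real.exp (-y)| ≤ |x - y| := by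
  wlog h : x ≤ y generalizing x y
  · rw [abs_sub_comm, abs_sub_comm x]
    exact this hy hx (le_of_not_ge h)
  have h1 := Real.add_one_le_exp (-(y - x))
  have h2 : Real.exp (-y) = Real.exp (-x) * Real.exp (-(y - x)) := by rw [← Real.exp_add]; ring_nf
  have h3 : Real.exp (-x) ≤ 1 := Real.exp_le_one_iff.2 (by linarith)
  have h4 : Real.exp (-(y - x)) ≤ 1 := Real.exp_le_one_iff.2 (by linarith)
  rw [abs_of_nonneg (by rw [h2]; nlinarith [Real.exp_pos (-x)]), abs_of_nonpos (by linarith), h2]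
  nlinarith [Real.exp_pos (-x)]

theorem abs_exp_neg_taylor_le {x y : ℝ} (hx : 0 ≤ x) (hy : 0 ≤ y) :
    |Real.exp (-y) - Real.exp (-x) + Real.exp (-x) * (y - x)| ≤ (y - x) ^ 2 := by
  have tangent : ∀ a b : ℝ, Real.exp (-a) - Real.exp (-a) * (b - a) ≤ Real.exp (-b) := by
    intro a b
    have h2 : Real.exp (-b) = Real.exp (-a) * Real.exp (-(b - a)) := by
      rw [← Real.exp_add]; ring_nf
    rw [h2]
    nlinarith [Real.exp_pos (-a), Real.add_one_le_exp (-(b - a))]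
  rw [abs_of_nonneg (by linarith [tangent x y])]
  have h1 := tangent y x
  have h2 := abs_exp_neg_sub_le hx hy
  calc _ ≤ (Real.exp (-x) - Real.exp (-y)) * (y - x) := by nlinarith
    _ ≤ |Real.exp (-x) - Real.exp (-y)| * |y - x| := by rw [← abs_mul]; exact le_abs_self _
    _ ≤ |x - y| * |y - x| := by gcongr
    _ = (y - x) ^ 2 := by rw [abs_sub_comm x, ← abs_mul, ← sq, abs_of_nonneg (sq_nonneg _)]

section Profile

variable {μ : Measure ℝ} {a b : ℝ}

theorem ae_restrict_mem_Icc (hab : ∀ᵐ t ∂μ, t ∈ Set.Icc a b) :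
    ∀ᵐ t ∂μ.restrict (Set.Ioi 0), 0 < t ∧ t ≤ b := by
  filter_upwards [ae_restrict_of_ae hab, ae_restrict_mem measurableSet_Ioi] with t ht h0
  exact ⟨h0, ht.2⟩

theorem setIntegral_Ioi_eq (ha : 0 < a) (hab : ∀ᵐ t ∂μ, t ∈ Set.Icc a b) (f : ℝ → ℝ) :
    ∫ t in Set.Ioi (0 : ℝ), f t ∂μ = ∫ t, f t ∂μ := by
  rw [Measure.restrict_eq_self_of_ae_mem]
  filter_upwards [hab] with t ht using ha.trans_le ht.1

theorem profile_nonneg (z : ℝ) : 0 ≤ profile μ z :=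
  integral_nonneg fun _ => (Real.exp_pos _).le

theorem profile_zero (ha : 0 < a) (hab : ∀ᵐ t ∂μ, t ∈ Set.Icc a b) :
    profile μ 0 = μ.real Set.univ := by
  rw [profile, setIntegral_Ioi_eq ha hab]
  simp

variable [IsFiniteMeasure μ]

theorem real_restrict_le : (μ.restrict (Set.Ioi 0)).real Set.univ ≤ μ.real Set.univ := by
  rw [Measure.real, Measure.real]
  exact ENNReal.toReal_mono (measure_ne_top _ _) (Measure.restrict_le_self _)

theorem abs_setIntegral_Ioi_le {f : ℝ → ℝ} {c : ℝ}
    (h : ∀ᵐ t ∂μ.restrict (Set.Ioi 0), |f t| ≤ c) (hc : 0 ≤ c) :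
    |∫ t in Set.Ioi (0 : ℝ), f t ∂μ| ≤ c * μ.real Set.univ := by
  refine (norm_integral_le_of_norm_le_const (f := f) h).trans ?_
  exact mul_le_mul_of_nonneg_left real_restrict_le hc

theorem integrableOn_mul_exp (hab : ∀ᵐ t ∂μ, t ∈ Set.Icc a b) {z : ℝ} (hz : 0 ≤ z) :
    IntegrableOn (fun t => t * Real.exp (-(t * z))) (Set.Ioi 0) μ := by
  refine Integrable.of_bound (C := b) (by fun_prop) ?_
  filter_upwards [ae_restrict_mem_Icc hab] with t ht
  rw [Real.norm_eq_abs, abs_of_nonneg (by have := ht.1; positivity)]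
  have : Real.exp (-(t * z)) ≤ 1 := Real.exp_le_one_iff.2 (by nlinarith)
  nlinarith

theorem profile_le {z : ℝ} (hz : 0 ≤ z) : profile μ z ≤ μ.real Set.univ := by
  have := abs_setIntegral_Ioi_le (μ := μ) (f := fun t => Real.exp (-(t * z))) (c := 1) (by
    filter_upwards [ae_restrict_mem measurableSet_Ioi] with t ht
    rw [abs_of_nonneg (Real.exp_pos _).le]
    exact Real.exp_le_one_iff.2 (by nlinarith [Set.mem_Ioi.1 ht])) zero_le_one
  rw [one_mul] at this
  exact (le_abs_self _).trans this

theorem abs_profile_le {z : ℝ} (hz : 0 ≤ z) : |profile μ z| ≤ μ.real Set.univ := by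
  rw [abs_of_nonneg (profile_nonneg z)]
  exact profile_le hz

theorem abs_slope_le (hb : 0 ≤ b) (hab : ∀ᵐ t ∂μ, t ∈ Set.Icc a b) {z : ℝ} (hz : 0 ≤ z) :
    |slope μ z| ≤ b * μ.real Set.univ := by
  refine abs_setIntegral_Ioi_le ?_ hb
  filter_upwards [ae_restrict_mem_Icc hab] with t ht
  rw [abs_of_nonneg (by have := ht.1; positivity)]
  have : Real.exp (-(t * z)) ≤ 1 := Real.exp_le_one_iff.2 (by nlinarith)
  nlinarith

theorem abs_profile_sub_le (hb : 0 ≤ b) (hab : ∀ᵐ t ∂μ, t ∈ Set.Icc a b) {z w : ℝ} (hz : 0 ≤ z)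
    (hw : 0 ≤ w) : |profile μ z - profile μ w| ≤ b * μ.real Set.univ * |z - w| := by
  rw [profile, profile, ← integral_sub (integrableOn_exp hz) (integrableOn_exp hw), mul_right_comm]
  refine abs_setIntegral_Ioi_le ?_ (by positivity)
  filter_upwards [ae_restrict_mem_Icc hab] with t ht
  refine (abs_exp_neg_sub_le (mul_nonneg ht.1.le hz) (mul_nonneg ht.1.le hw)).trans ?_
  rw [← mul_sub, abs_mul, abs_of_pos ht.1]
  exact mul_le_mul_of_nonneg_right ht.2 (abs_nonneg _)

theorem abs_slope_sub_le (hb : 0 ≤ b) (hab : ∀ᵐ t ∂μ, t ∈ Set.Icc a b) {z w : ℝ} (hz : 0 ≤ z)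
    (hw : 0 ≤ w) : |slope μ z - slope μ w| ≤ b ^ 2 * μ.real Set.univ * |z - w| := by
  rw [slope, slope, ← integral_sub (integrableOn_mul_exp hab hz) (integrableOn_mul_exp hab hw),
    mul_right_comm]
  refine abs_setIntegral_Ioi_le ?_ (by positivity)
  filter_upwards [ae_restrict_mem_Icc hab] with t ht
  have := abs_exp_neg_sub_le (mul_nonneg ht.1.le hz) (mul_nonneg ht.1.le hw)
  rw [← mul_sub, abs_mul, abs_of_pos ht.1] at this
  rw [← mul_sub, abs_mul, abs_of_pos ht.1]
  calc t * _ ≤ b * (b * |z - w|) :=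
        mul_le_mul ht.2 (this.trans (mul_le_mul_of_nonneg_right ht.2 (abs_nonneg _)))
          (abs_nonneg _) hb
    _ = _ := by ring

theorem abs_profile_taylor_le (hab : ∀ᵐ t ∂μ, t ∈ Set.Icc a b) {z w : ℝ} (hz : 0 ≤ z)
    (hw : 0 ≤ w) :
    |profile μ w - profile μ z + slope μ z * (w - z)| ≤ b ^ 2 * μ.real Set.univ * (w - z) ^ 2 := by
  have hi : IntegrableOn (fun t => Real.exp (-(t * w)) - Real.exp (-(t * z))) (Set.Ioi 0) μ :=
    (integrableOn_exp hw).sub (integrableOn_exp hz)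
  rw [profile, profile, slope, ← integral_sub (integrableOn_exp hw) (integrableOn_exp hz),
    ← integral_mul_const, ← integral_add hi ((integrableOn_mul_exp hab hz).mul_const _),
    mul_right_comm]
  refine abs_setIntegral_Ioi_le ?_ (by positivity)
  filter_upwards [ae_restrict_mem_Icc hab] with t ht
  have := abs_exp_neg_taylor_le (mul_nonneg ht.1.le hz) (mul_nonneg ht.1.le hw)
  rw [← mul_sub, mul_pow] at this
  refine (le_of_eq (by congr 1; ring)).trans (this.trans ?_)
  have := ht.1
  have := ht.2
  gcongr

theorem slope_zero_pos (ha : 0 < a) (hab : ∀ᵐ t ∂μ, t ∈ Set.Icc a b) (hμ : μ ≠ 0) :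
    0 < slope μ 0 := by
  have hm : 0 < μ.real Set.univ := by
    rw [Measure.real]
    exact ENNReal.toReal_pos (by simpa using hμ) (measure_ne_top _ _)
  refine (mul_pos ha hm).trans_le ?_
  have hi := integrableOn_mul_exp hab (le_refl (0 : ℝ))
  rw [slope, ← profile_zero ha hab, profile, ← integral_const_mul]
  refine integral_mono_ae ((integrableOn_exp le_rfl).const_mul a) hi ?_
  filter_upwards [ae_restrict_of_ae hab] with t ht
  simpa using ht.1

/-- Since `μ` lives on `[a, b]`, the function `-h' - a h` is again the profile of a finite measure
on `[a, b]`. -/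
theorem exists_profile_eq_slope_sub (hab : ∀ᵐ t ∂μ, t ∈ Set.Icc a b) :
    ∃ ν : Measure ℝ, IsFiniteMeasure ν ∧ (∀ᵐ t ∂ν, t ∈ Set.Icc a b) ∧
      ∀ z, 0 ≤ z → profile ν z = slope μ z - a * profile μ z := by
  have hmeas : Measurable fun t : ℝ => ENNReal.ofReal (t - a) := by fun_prop
  refine ⟨μ.withDensity fun t => ENNReal.ofReal (t - a), ?_, ?_, fun z hz => ?_⟩
  · have : Integrable (fun t : ℝ => t - a) μ := by
      refine Integrable.of_bound (C := b - a) (by fun_prop) ?_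
      filter_upwards [hab] with t ht
      rw [Real.norm_eq_abs, abs_of_nonneg (by linarith [ht.1])]
      linarith [ht.2]
    refine isFiniteMeasure_withDensity ?_
    exact this.lintegral_lt_top.ne
  · exact (withDensity_absolutelyContinuous _ _).ae_le hab
  · rw [profile, slope, profile, ← integral_const_mul,
      ← integral_sub (integrableOn_mul_exp hab hz) ((integrableOn_exp hz).const_mul a),
      setIntegral_withDensity_eq_setIntegral_toReal_smul hmeas (by simp) _ measurableSet_Ioi]
    refine integral_congr_ae ?_
    filter_upwards [ae_restrict_of_ae hab] with t ht
    rw [ENNReal.toReal_ofReal (by linarith [ht.1]), smul_eq_mul]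
    ring

end Profile

/-! ### The weighted kernel and the feature map -/

section Feature

variable {p : ℕ} {μ : Measure ℝ} {a b : ℝ}

/-- The distance `‖w ⊙ (x - y)‖₁` for a nonnegative weight vector `w`. -/
def wdist (w x y : Fin p → ℝ) : ℝ := ∑ j, w j * |x j - y j|

theorem wdist_nonneg {w : Fin p → ℝ} (hw : ∀ j, 0 ≤ w j) (x y : Fin p → ℝ) : 0 ≤ wdist w x y :=
  Finset.sum_nonneg fun j _ => mul_nonneg (hw j) (abs_nonneg _)

theorem wdist_comm (w x y : Fin p → ℝ) : wdist w x y = wdist w y x := by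
  simp [wdist, abs_sub_comm]

theorem continuous_wdist (w : Fin p → ℝ) :
    Continuous fun q : (Fin p → ℝ) × (Fin p → ℝ) => wdist w q.1 q.2 := by
  unfold wdist
  fun_prop

theorem kernelFn_mul {w : Fin p → ℝ} (hw : ∀ j, 0 ≤ w j) (x y : Fin p → ℝ) :
    kernelFn μ (fun j => w j * x j) (fun j => w j * y j) = profile μ (wdist w x y) := by
  unfold kernelFn wdist
  congr 1
  refine Finset.sum_congr rfl fun j _ => ?_
  rw [← mul_sub, abs_mul, abs_of_nonneg (hw j)]

variable [IsFiniteMeasure μ]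

/-- The kernel section `k(x, ·)` as an element of the reproducing kernel Hilbert space. -/
noncomputable def feature (μ : Measure ℝ) [IsFiniteMeasure μ] (x : Fin p → ℝ) : KernelSpace p μ :=
  RKHS.kerFun (KernelSpace p μ) x (1 : ℝ)

theorem inner_feature (x : Fin p → ℝ) (f : KernelSpace p μ) : ⟪feature μ x, f⟫ = f x := by
  simp [feature]

theorem inner_feature_feature (x y : Fin p → ℝ) :
    ⟪feature μ x, feature μ y⟫ = kernelFn μ x y := by
  rw [inner_feature, feature, RKHS.kerFun_apply, RKHS.OfKernel.kernel_ofKernel]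
  simp [kernelMatrix]

theorem norm_feature_sq (x : Fin p → ℝ) : ‖feature μ x‖ ^ 2 = profile μ 0 := by
  rw [← real_inner_self_eq_norm_sq, inner_feature_feature, kernelFn]
  simp

theorem norm_feature_le (x : Fin p → ℝ) : ‖feature μ x‖ ≤ √(μ.real Set.univ) := by
  apply Real.le_sqrt_of_sq_le
  rw [norm_feature_sq]
  exact profile_le le_rfl

theorem continuous_feature (hb : 0 ≤ b) (hab : ∀ᵐ t ∂μ, t ∈ Set.Icc a b) :
    Continuous (feature μ : (Fin p → ℝ) → KernelSpace p μ) := by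
  rw [continuous_iff_continuousAt]
  intro x
  rw [ContinuousAt, tendsto_iff_norm_sub_tendsto_zero]
  have hb0 : ∀ y : Fin p → ℝ, ‖feature μ y - feature μ x‖ ≤
      √(2 * (b * μ.real Set.univ * ∑ j, |y j - x j|)) := by
    intro y
    apply Real.le_sqrt_of_sq_le
    have h1 : ‖feature μ y - feature μ x‖ ^ 2 = 2 * (profile μ 0 - kernelFn μ y x) := by
      rw [norm_sub_sq_real, norm_feature_sq, norm_feature_sq, inner_feature_feature]
      ring
    have h0 : 0 ≤ ∑ j, |y j - x j| := Finset.sum_nonneg fun j _ => abs_nonneg _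
    have h2 := (le_abs_self _).trans (abs_profile_sub_le hb hab (le_refl 0) h0)
    rw [zero_sub, abs_neg, abs_of_nonneg h0] at h2
    rw [h1, kernelFn]
    linarith
  refine squeeze_zero (fun _ => norm_nonneg _) hb0 ?_
  have : Continuous fun y : Fin p → ℝ => √(2 * (b * μ.real Set.univ * ∑ j, |y j - x j|)) := by
    fun_prop
  simpa using this.tendsto x

end Feature

/-! ### Double integrals against a bounded kernel -/

section Pairing

variable {Z : Type*} [MeasurableSpace Z] {P : Measure Z} {K K' : Z → Z → ℝ} {c c' W lam : ℝ}
  {u v u' v' g : Z → ℝ}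

/-- The double integral `E[u(Z) v(Z') K(Z, Z')]` over two independent copies of `Z ∼ P`. -/
noncomputable def pairing (P : Measure Z) (K : Z → Z → ℝ) (u v : Z → ℝ) : ℝ :=
  ∫ q, u q.1 * v q.2 * K q.1 q.2 ∂(P.prod P)

/-- A jointly measurable kernel which is almost surely bounded by `c`. -/
structure IsBddKernel (P : Measure Z) (K : Z → Z → ℝ) (c : ℝ) : Prop where
  measurable : Measurable fun q : Z × Z => K q.1 q.2
  bound : ∀ᵐ q ∂(P.prod P), |K q.1 q.2| ≤ c

theorem ae_prod_mem [IsProbabilityMeasure P] {D : Set Z} (hD : ∀ᵐ z ∂P, z ∈ D) :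
    ∀ᵐ q ∂(P.prod P), q.1 ∈ D ∧ q.2 ∈ D := by
  filter_upwards [Measure.quasiMeasurePreserving_fst.ae hD,
    Measure.quasiMeasurePreserving_snd.ae hD] with q h1 h2 using ⟨h1, h2⟩

theorem IsBddKernel.integrable [IsProbabilityMeasure P] (hK : IsBddKernel P K c)
    (hu : Integrable u P) (hv : Integrable v P) :
    Integrable (fun q : Z × Z => u q.1 * v q.2 * K q.1 q.2) (P.prod P) :=
  (hu.mul_prod hv).mul_bdd (c := c) hK.measurable.aestronglyMeasurable hK.bound

theorem IsBddKernel.sub (hK : IsBddKernel P K c) (hK' : IsBddKernel P K' c') :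
    IsBddKernel P (fun z w => K z w - K' z w) (c + c') where
  measurable := hK.measurable.sub hK'.measurable
  bound := by
    filter_upwards [hK.bound, hK'.bound] with q h h'
    exact (abs_sub _ _).trans (add_le_add h h')

theorem pairing_eq_left [IsProbabilityMeasure P] (hK : IsBddKernel P K c)
    (hu : Integrable u P) (hv : Integrable v P) :
    pairing P K u v = ∫ z, u z * ∫ w, v w * K z w ∂P ∂P := by
  rw [pairing, integral_prod _ (hK.integrable hu hv)]
  refine integral_congr_ae (ae_of_all _ fun z => ?_)
  simp only [mul_assoc, integral_const_mul]

theorem pairing_eq_right [IsProbabilityMeasure P] (hK : IsBddKernel P K c)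
    (hu : Integrable u P) (hv : Integrable v P) :
    pairing P K u v = ∫ w, v w * ∫ z, u z * K z w ∂P ∂P := by
  rw [pairing, integral_prod_symm _ (hK.integrable hu hv)]
  refine integral_congr_ae (ae_of_all _ fun z => ?_)
  dsimp only
  rw [← integral_const_mul]
  congr 1
  ext w
  ring

theorem abs_pairing_le [IsProbabilityMeasure P] (hK : IsBddKernel P K c)
    (hu : Integrable u P) (hv : Integrable v P) :
    |pairing P K u v| ≤ c * ((∫ z, |u z| ∂P) * ∫ z, |v z| ∂P) := by
  rw [pairing, ← integral_prod_mul (fun z => |u z|) (fun z => |v z|), ← integral_const_mul]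
  rw [← Real.norm_eq_abs]
  refine norm_integral_le_of_norm_le ((hu.abs.mul_prod hv.abs).const_mul c) ?_
  filter_upwards [hK.bound] with q hq
  rw [Real.norm_eq_abs, abs_mul, abs_mul, mul_comm]
  exact mul_le_mul_of_nonneg_right hq (by positivity)

theorem pairing_sub_left [IsProbabilityMeasure P] (hK : IsBddKernel P K c)
    (hu : Integrable u P) (hu' : Integrable u' P) (hv : Integrable v P) :
    pairing P K (fun z => u z - u' z) v = pairing P K u v - pairing P K u' v := by
  rw [pairing, pairing, pairing, ← integral_sub (hK.integrable hu hv) (hK.integrable hu' hv)]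
  congr 1
  ext q
  ring

theorem pairing_sub_right [IsProbabilityMeasure P] (hK : IsBddKernel P K c)
    (hu : Integrable u P) (hv : Integrable v P) (hv' : Integrable v' P) :
    pairing P K u (fun z => v z - v' z) = pairing P K u v - pairing P K u v' := by
  rw [pairing, pairing, pairing, ← integral_sub (hK.integrable hu hv) (hK.integrable hu hv')]
  congr 1
  ext q
  ring

theorem pairing_sub_kernel [IsProbabilityMeasure P] (hK : IsBddKernel P K c)
    (hK' : IsBddKernel P K' c') (hu : Integrable u P) (hv : Integrable v P) :
    pairing P (fun z w => K z w - K' z w) u v = pairing P K u v - pairing P K' u v := by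
  rw [pairing, pairing, pairing, ← integral_sub (hK.integrable hu hv) (hK'.integrable hu hv)]
  congr 1
  ext q
  ring

theorem sq_integral_abs_le [IsProbabilityMeasure P] (hu : MemLp u 2 P) :
    (∫ z, |u z| ∂P) ^ 2 ≤ ∫ z, u z ^ 2 ∂P := by
  have hui : Integrable u P := hu.integrable (by norm_num)
  set c := ∫ z, |u z| ∂P with hc
  have h1 : Integrable (fun z => u z ^ 2 - 2 * c * |u z|) P :=
    hu.integrable_sq.sub (hui.abs.const_mul _)
  have h : 0 ≤ ∫ z, (u z ^ 2 - 2 * c * |u z| + c ^ 2) ∂P := integral_nonneg fun z => by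
    rw [← sq_abs (u z)]
    have : 0 ≤ (|u z| - c) ^ 2 := sq_nonneg _
    simp only [Pi.zero_apply]
    linarith
  rw [integral_add h1 (integrable_const _),
    integral_sub hu.integrable_sq (hui.abs.const_mul _), integral_const_mul, ← hc] at h
  simp only [integral_const, probReal_univ, one_smul] at h
  linarith

/-- Stability of the second-kind integral equation `u + λ⁻¹ K u = g` with a positive semidefinite
kernel: the solution is bounded in `L¹` by the sup norm of the right-hand side. -/
theorem integral_abs_le_of_eq [IsProbabilityMeasure P] (hK : IsBddKernel P K c)
    (hu : MemLp u 2 P) (hlam : 0 < lam) (hg : ∀ᵐ z ∂P, |g z| ≤ W)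
    (hpos : 0 ≤ pairing P K u u) (heq : ∀ᵐ z ∂P, u z = g z - lam⁻¹ * ∫ w, u w * K w z ∂P) :
    ∫ z, |u z| ∂P ≤ W := by
  have hui : Integrable u P := hu.integrable (by norm_num)
  have hint : Integrable (fun z => u z * ∫ w, u w * K w z ∂P) P := by
    have := (hK.integrable hui hui).integral_prod_right
    refine this.congr (ae_of_all _ fun z => ?_)
    dsimp only
    rw [← integral_const_mul]
    congr 1
    ext w
    ring
  have h1 : ∫ z, (u z ^ 2 + lam⁻¹ * (u z * ∫ w, u w * K w z ∂P)) ∂P ≤ ∫ z, W * |u z| ∂P := by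
    refine integral_mono_ae (hu.integrable_sq.add (hint.const_mul _)) (hui.abs.const_mul W) ?_
    filter_upwards [hg, heq] with z hz hz'
    have : u z ^ 2 + lam⁻¹ * (u z * ∫ w, u w * K w z ∂P) = g z * u z := by
      have : g z = u z + lam⁻¹ * ∫ w, u w * K w z ∂P := by linarith
      rw [this]
      ring
    rw [this]
    exact (le_abs_self _).trans (by rw [abs_mul]; gcongr)
  rw [integral_add hu.integrable_sq (hint.const_mul _), integral_const_mul, integral_const_mul,
    ← pairing_eq_right hK hui hui] at h1
  have h2 := sq_integral_abs_le hu
  have h3 : 0 ≤ lam⁻¹ * pairing P K u u := mul_nonneg (inv_nonneg.2 hlam.le) hpos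
  have h4 : 0 ≤ ∫ z, |u z| ∂P := integral_nonneg fun z => abs_nonneg _
  obtain ⟨z, hz⟩ := hg.exists
  have hW : 0 ≤ W := (abs_nonneg _).trans hz
  by_contra! hlt
  nlinarith

end Pairing

/-! ### Residuals of kernel ridge regression -/

section Residual

variable {p : ℕ} {μ : Measure ℝ} {a b MX MY lam : ℝ} {P : Measure ((Fin p → ℝ) × ℝ)}
  {w w' : Fin p → ℝ}

/-- The set in which the data lie almost surely. -/
def dataBox (p : ℕ) (MX MY : ℝ) : Set ((Fin p → ℝ) × ℝ) :=
  {z | (∀ j, |z.1 j| ≤ MX) ∧ |z.2| ≤ MY}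

/-- The kernel `h(‖w ⊙ (x - x')‖₁)` as a function of two data points. -/
noncomputable def wker (μ : Measure ℝ) (w : Fin p → ℝ) (z z' : (Fin p → ℝ) × ℝ) : ℝ :=
  profile μ (wdist w z.1 z'.1)

/-- Minus the partial derivative of the kernel `h(‖w ⊙ (x - x')‖₁)` in `w_l`. -/
noncomputable def gker (μ : Measure ℝ) (w : Fin p → ℝ) (l : Fin p) (z z' : (Fin p → ℝ) × ℝ) : ℝ :=
  slope μ (wdist w z.1 z'.1) * |z.1 l - z'.1 l|

theorem wker_comm (z z' : (Fin p → ℝ) × ℝ) : wker μ w z z' = wker μ w z' z := by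
  rw [wker, wdist_comm, wker]

theorem gker_comm (l : Fin p) (z z' : (Fin p → ℝ) × ℝ) : gker μ w l z z' = gker μ w l z' z := by
  rw [gker, wdist_comm, gker, abs_sub_comm]

theorem abs_sub_le_of_mem_dataBox {z z' : (Fin p → ℝ) × ℝ} (hz : z ∈ dataBox p MX MY)
    (hz' : z' ∈ dataBox p MX MY) (l : Fin p) : |z.1 l - z'.1 l| ≤ 2 * MX := by
  have h1 := hz.1 l
  have h2 := hz'.1 l
  have := abs_sub (z.1 l) (z'.1 l)
  linarith

variable [IsFiniteMeasure μ]

theorem continuous_profile_comp {X : Type*} [TopologicalSpace X] (hb : 0 ≤ b)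
    (hab : ∀ᵐ t ∂μ, t ∈ Set.Icc a b) {f : X → ℝ} (hf : Continuous f) (h0 : ∀ x, 0 ≤ f x) :
    Continuous fun x => profile μ (f x) := by
  have : ContinuousOn (profile μ) (Set.Ici 0) := by
    refine (LipschitzOnWith.of_dist_le_mul (K := (b * μ.real Set.univ).toNNReal)
      fun x hx y hy => ?_).continuousOn
    rw [Real.dist_eq, Real.dist_eq, Real.coe_toNNReal _ (by positivity)]
    exact abs_profile_sub_le hb hab hx hy
  exact this.comp_continuous hf h0

theorem continuous_slope_comp {X : Type*} [TopologicalSpace X] (hb : 0 ≤ b)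
    (hab : ∀ᵐ t ∂μ, t ∈ Set.Icc a b) {f : X → ℝ} (hf : Continuous f) (h0 : ∀ x, 0 ≤ f x) :
    Continuous fun x => slope μ (f x) := by
  have : ContinuousOn (slope μ) (Set.Ici 0) := by
    refine (LipschitzOnWith.of_dist_le_mul (K := (b ^ 2 * μ.real Set.univ).toNNReal)
      fun x hx y hy => ?_).continuousOn
    rw [Real.dist_eq, Real.dist_eq, Real.coe_toNNReal _ (by positivity)]
    exact abs_slope_sub_le hb hab hx hy
  exact this.comp_continuous hf h0

theorem continuous_wker (hb : 0 ≤ b) (hab : ∀ᵐ t ∂μ, t ∈ Set.Icc a b) (hw : ∀ j, 0 ≤ w j) :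
    Continuous fun q : ((Fin p → ℝ) × ℝ) × ((Fin p → ℝ) × ℝ) => wker μ w q.1 q.2 :=
  continuous_profile_comp hb hab (by unfold wdist; fun_prop) fun _ => wdist_nonneg hw _ _

theorem continuous_gker (hb : 0 ≤ b) (hab : ∀ᵐ t ∂μ, t ∈ Set.Icc a b) (hw : ∀ j, 0 ≤ w j)
    (l : Fin p) :
    Continuous fun q : ((Fin p → ℝ) × ℝ) × ((Fin p → ℝ) × ℝ) => gker μ w l q.1 q.2 :=
  (continuous_slope_comp hb hab (by unfold wdist; fun_prop) fun _ => wdist_nonneg hw _ _).mul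
    (by fun_prop)

theorem isBddKernel_wker (hb : 0 ≤ b) (hab : ∀ᵐ t ∂μ, t ∈ Set.Icc a b) (hw : ∀ j, 0 ≤ w j) :
    IsBddKernel P (wker μ w) (μ.real Set.univ) where
  measurable := (continuous_wker hb hab hw).measurable
  bound := ae_of_all _ fun _ => abs_profile_le (wdist_nonneg hw _ _)

theorem isBddKernel_gker [IsProbabilityMeasure P] (hb : 0 ≤ b) (hab : ∀ᵐ t ∂μ, t ∈ Set.Icc a b)
    (hw : ∀ j, 0 ≤ w j) (hP : ∀ᵐ z ∂P, z ∈ dataBox p MX MY) (l : Fin p) :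
    IsBddKernel P (gker μ w l) (b * μ.real Set.univ * (2 * MX)) where
  measurable := (continuous_gker hb hab hw l).measurable
  bound := by
    filter_upwards [ae_prod_mem hP] with q hq
    rw [gker, abs_mul, abs_abs]
    exact mul_le_mul (abs_slope_le hb hab (wdist_nonneg hw _ _))
      (abs_sub_le_of_mem_dataBox hq.1 hq.2 l) (abs_nonneg _) (by positivity)

/-- The coordinatewise product `w ⊙ x`. -/
def scale (w x : Fin p → ℝ) : Fin p → ℝ := fun j => w j * x j

theorem continuous_scaledFeature (hb : 0 ≤ b) (hab : ∀ᵐ t ∂μ, t ∈ Set.Icc a b)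
    (w : Fin p → ℝ) :
    Continuous fun z : (Fin p → ℝ) × ℝ => feature μ (scale w z.1) :=
  (continuous_feature hb hab).comp (by unfold scale; fun_prop)

theorem inner_scaledFeature (hw : ∀ j, 0 ≤ w j) (z z' : (Fin p → ℝ) × ℝ) :
    ⟪feature μ (scale w z.1), feature μ (scale w z'.1)⟫ = wker μ w z z' := by
  rw [inner_feature_feature]
  exact kernelFn_mul hw _ _

/-- The kernel is positive semidefinite as an integral operator. -/
theorem pairing_wker_nonneg [IsProbabilityMeasure P] (hb : 0 ≤ b)
    (hab : ∀ᵐ t ∂μ, t ∈ Set.Icc a b) (hw : ∀ j, 0 ≤ w j) {u : (Fin p → ℝ) × ℝ → ℝ}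
    (hu : Integrable u P) : 0 ≤ pairing P (wker μ w) u u := by
  rw [pairing_eq_left (isBddKernel_wker hb hab hw) hu hu]
  have := inner_integral_smul_feature (P := P)
    (continuous_scaledFeature hb hab w).aestronglyMeasurable (fun z => norm_feature_le _) hu hu
  simp only [inner_scaledFeature hw] at this
  rw [← this]
  exact real_inner_self_nonneg

/-- The solution of the kernel ridge regression problem with weights `w` under `P`, chosen as a
solution of the normal equation; for `λ > 0` and bounded data there is one by `exists_ridge`. -/
noncomputable def ridge (μ : Measure ℝ) [IsFiniteMeasure μ] (lam : ℝ)
    (P : Measure ((Fin p → ℝ) × ℝ)) (w : Fin p → ℝ) : KernelSpace p μ :=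
  Classical.epsilon fun f => lam • f =
    ∫ z, (z.2 - ⟪feature μ (scale w z.1), f⟫) • feature μ (scale w z.1) ∂P

/-- The residual `y - f(w ⊙ x)` of the kernel ridge regression solution. -/
noncomputable def residual (μ : Measure ℝ) [IsFiniteMeasure μ] (lam : ℝ)
    (P : Measure ((Fin p → ℝ) × ℝ)) (w : Fin p → ℝ) (z : (Fin p → ℝ) × ℝ) : ℝ :=
  z.2 - ⟪feature μ (scale w z.1), ridge μ lam P w⟫

theorem continuous_residual (hb : 0 ≤ b) (hab : ∀ᵐ t ∂μ, t ∈ Set.Icc a b) :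
    Continuous (residual μ lam P w) :=
  continuous_snd.sub ((continuous_scaledFeature hb hab w).inner continuous_const)

theorem abs_fit_le (z : (Fin p → ℝ) × ℝ) :
    |z.2 - residual μ lam P w z| ≤ √(μ.real Set.univ) * ‖ridge μ lam P w‖ := by
  rw [residual, sub_sub_cancel]
  exact (abs_real_inner_le_norm _ _).trans
    (mul_le_mul_of_nonneg_right (norm_feature_le _) (norm_nonneg _))

theorem ae_abs_snd_le (hP : ∀ᵐ z ∂P, z ∈ dataBox p MX MY) : ∀ᵐ z ∂P, |z.2| ≤ MY := by
  filter_upwards [hP] with z hz using hz.2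

variable [IsProbabilityMeasure P]

theorem memLp_snd (hP : ∀ᵐ z ∂P, z ∈ dataBox p MX MY) :
    MemLp (fun z : (Fin p → ℝ) × ℝ => z.2) 2 P :=
  MemLp.of_bound continuous_snd.aestronglyMeasurable MY (ae_abs_snd_le hP)

theorem integrable_snd (hP : ∀ᵐ z ∂P, z ∈ dataBox p MX MY) :
    Integrable (fun z : (Fin p → ℝ) × ℝ => z.2) P :=
  (memLp_snd hP).integrable (by norm_num)

theorem ridge_spec (hb : 0 ≤ b) (hab : ∀ᵐ t ∂μ, t ∈ Set.Icc a b)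
    (hP : ∀ᵐ z ∂P, z ∈ dataBox p MX MY) (hlam : 0 < lam) (w : Fin p → ℝ) :
    lam • ridge μ lam P w = ∫ z, residual μ lam P w z • feature μ (scale w z.1) ∂P :=
  Classical.epsilon_spec (exists_ridge (continuous_scaledFeature hb hab w).aestronglyMeasurable
    (fun _ => norm_feature_le _) (integrable_snd hP) hlam)

theorem memLp_residual (hb : 0 ≤ b) (hab : ∀ᵐ t ∂μ, t ∈ Set.Icc a b)
    (hP : ∀ᵐ z ∂P, z ∈ dataBox p MX MY) {P' : Measure ((Fin p → ℝ) × ℝ)} (w : Fin p → ℝ) :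
    MemLp (residual μ lam P' w) 2 P := by
  refine (memLp_snd hP).sub (MemLp.of_bound
    ((continuous_scaledFeature hb hab w).inner continuous_const).aestronglyMeasurable
    (√(μ.real Set.univ) * ‖ridge μ lam P' w‖) (ae_of_all _ fun z => ?_))
  exact (norm_inner_le_norm _ _).trans (by gcongr; exact norm_feature_le _)

theorem integrable_residual (hb : 0 ≤ b) (hab : ∀ᵐ t ∂μ, t ∈ Set.Icc a b)
    (hP : ∀ᵐ z ∂P, z ∈ dataBox p MX MY) {P' : Measure ((Fin p → ℝ) × ℝ)} (w : Fin p → ℝ) :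
    Integrable (residual μ lam P' w) P :=
  (memLp_residual hb hab hP w).integrable (by norm_num)

/-- The integral equation `λ (y - r(z)) = E[r(Z) k(Z, z)]` for the residual `r`. -/
theorem fit_eq (hb : 0 ≤ b) (hab : ∀ᵐ t ∂μ, t ∈ Set.Icc a b)
    (hP : ∀ᵐ z ∂P, z ∈ dataBox p MX MY) (hlam : 0 < lam) (hw : ∀ j, 0 ≤ w j)
    (z : (Fin p → ℝ) × ℝ) :
    lam * (z.2 - residual μ lam P w z) = ∫ z', residual μ lam P w z' * wker μ w z' z ∂P := by
  have h := inner_ridge (P := P) (continuous_scaledFeature hb hab w).aestronglyMeasurable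
    (fun _ => norm_feature_le _) (integrable_residual (lam := lam) (P' := P) hb hab hP w)
    (feature μ (scale w z.1))
  rw [← ridge_spec hb hab hP hlam, real_inner_smul_left, real_inner_comm] at h
  simp only [inner_scaledFeature hw] at h
  rw [← h, residual, sub_sub_cancel]

theorem sq_norm_ridge (hb : 0 ≤ b) (hab : ∀ᵐ t ∂μ, t ∈ Set.Icc a b)
    (hP : ∀ᵐ z ∂P, z ∈ dataBox p MX MY) (hlam : 0 < lam) (hw : ∀ j, 0 ≤ w j) :
    lam ^ 2 * ‖ridge μ lam P w‖ ^ 2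
      = pairing P (wker μ w) (residual μ lam P w) (residual μ lam P w) := by
  have hr := integrable_residual (lam := lam) (P' := P) hb hab hP w
  rw [pairing_eq_left (isBddKernel_wker hb hab hw) hr hr]
  have h := inner_integral_smul_feature (P := P)
    (continuous_scaledFeature hb hab w).aestronglyMeasurable (fun z => norm_feature_le _) hr hr
  simp only [inner_scaledFeature hw] at h
  rw [← h, ← ridge_spec hb hab hP hlam, real_inner_self_eq_norm_sq, norm_smul, mul_pow,
    Real.norm_eq_abs, sq_abs]

theorem sq_norm_ridge_le (hb : 0 ≤ b) (hab : ∀ᵐ t ∂μ, t ∈ Set.Icc a b)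
    (hP : ∀ᵐ z ∂P, z ∈ dataBox p MX MY) (hlam : 0 < lam) (w : Fin p → ℝ) :
    lam * ‖ridge μ lam P w‖ ^ 2 ≤ MY ^ 2 := by
  have h := ridge_energy (P := P) (continuous_scaledFeature hb hab w).aestronglyMeasurable
    (fun _ => norm_feature_le _) (integrable_snd hP) (ridge_spec hb hab hP hlam w)
    (ridge μ lam P w)
  rw [real_inner_self_eq_norm_sq] at h
  rw [h]
  refine (integral_mono_ae (g := fun _ => MY ^ 2) ?_ (integrable_const _) ?_).trans (by simp)
  · have h1 := memLp_residual (lam := lam) (P' := P) hb hab hP w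
    exact h1.integrable_mul (((memLp_snd hP).sub h1).ae_eq
      (ae_of_all _ fun z => by simp [residual]))
  · filter_upwards [ae_abs_snd_le hP] with z hz
    have := sq_le_sq' (by linarith [neg_abs_le z.2]) ((le_abs_self _).trans hz)
    nlinarith [sq_nonneg (z.2 - 2 * ⟪feature μ (scale w z.1), ridge μ lam P w⟫), sq_nonneg z.2]

/-- The value of the kernel ridge regression objective in terms of the residual. -/
theorem krrObjective_eq (hb : 0 ≤ b) (hab : ∀ᵐ t ∂μ, t ∈ Set.Icc a b)
    (hP : ∀ᵐ z ∂P, z ∈ dataBox p MX MY) (hlam : 0 < lam) (β : EuclideanSpace ℝ (Fin p)) :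
    krrObjective μ lam P β = (1 / 2) * ∫ z, z.2 * residual μ lam P β.ofLp z ∂P := by
  have h := ridge_value (P := P) (continuous_scaledFeature hb hab β.ofLp).aestronglyMeasurable
    (fun _ => norm_feature_le _) (memLp_snd hP).1 (ae_abs_snd_le hP) hlam
    (ridge_spec hb hab hP hlam β.ofLp)
  simp only [inner_feature] at h
  simp only [residual, inner_feature]
  exact h

end Residual

/-! ### The gradient of the objective -/

section Gradient

variable {p : ℕ} {μ : Measure ℝ} {a b MX MY lam : ℝ} {P : Measure ((Fin p → ℝ) × ℝ)}
  {w w' : Fin p → ℝ} {z z' : (Fin p → ℝ) × ℝ}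

/-- The `ℓ₁` distance of two weight vectors. -/
def dist1 (w w' : Fin p → ℝ) : ℝ := ∑ j, |w' j - w j|

theorem dist1_nonneg (w w' : Fin p → ℝ) : 0 ≤ dist1 w w' :=
  Finset.sum_nonneg fun _ _ => abs_nonneg _

theorem wdist_sub (w w' x y : Fin p → ℝ) :
    wdist w' x y - wdist w x y = ∑ j, (w' j - w j) * |x j - y j| := by
  rw [wdist, wdist, ← Finset.sum_sub_distrib]
  exact Finset.sum_congr rfl fun j _ => by ring

theorem abs_wdist_sub_le (hz : z ∈ dataBox p MX MY) (hz' : z' ∈ dataBox p MX MY)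
    (w w' : Fin p → ℝ) :
    |wdist w' z.1 z'.1 - wdist w z.1 z'.1| ≤ 2 * MX * dist1 w w' := by
  rw [wdist_sub, dist1, Finset.mul_sum]
  refine (Finset.abs_sum_le_sum_abs _ _).trans (Finset.sum_le_sum fun j _ => ?_)
  rw [abs_mul, abs_abs, mul_comm]
  exact mul_le_mul_of_nonneg_right (abs_sub_le_of_mem_dataBox hz hz' j) (abs_nonneg _)

variable [IsFiniteMeasure μ]

theorem abs_wker_sub_le (hb : 0 ≤ b) (hab : ∀ᵐ t ∂μ, t ∈ Set.Icc a b) (hw : ∀ j, 0 ≤ w j)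
    (hw' : ∀ j, 0 ≤ w' j) (hz : z ∈ dataBox p MX MY) (hz' : z' ∈ dataBox p MX MY) :
    |wker μ w' z z' - wker μ w z z'| ≤ b * μ.real Set.univ * (2 * MX) * dist1 w w' := by
  refine (abs_profile_sub_le hb hab (wdist_nonneg hw' _ _) (wdist_nonneg hw _ _)).trans ?_
  rw [mul_assoc (b * _)]
  exact mul_le_mul_of_nonneg_left (abs_wdist_sub_le hz hz' w w') (by positivity)

theorem abs_gker_sub_le (hb : 0 ≤ b) (hab : ∀ᵐ t ∂μ, t ∈ Set.Icc a b) (hw : ∀ j, 0 ≤ w j)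
    (hw' : ∀ j, 0 ≤ w' j) (hz : z ∈ dataBox p MX MY) (hz' : z' ∈ dataBox p MX MY) (l : Fin p) :
    |gker μ w' l z z' - gker μ w l z z'|
      ≤ b ^ 2 * μ.real Set.univ * (2 * MX) ^ 2 * dist1 w w' := by
  rw [gker, gker, ← sub_mul, abs_mul, abs_abs]
  have h1 := abs_slope_sub_le hb hab (wdist_nonneg hw' z.1 z'.1) (wdist_nonneg hw z.1 z'.1)
  have h2 := abs_wdist_sub_le hz hz' w w'
  have h3 := abs_sub_le_of_mem_dataBox hz hz' l
  have h4 : 0 ≤ 2 * MX := (abs_nonneg _).trans h3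
  have h5 := dist1_nonneg w w'
  calc _ ≤ (b ^ 2 * μ.real Set.univ * (2 * MX * dist1 w w')) * (2 * MX) :=
        mul_le_mul (h1.trans (mul_le_mul_of_nonneg_left h2 (by positivity))) h3 (abs_nonneg _)
          (by positivity)
    _ = _ := by ring

/-- The first order expansion of the kernel in the weights. -/
theorem abs_wker_taylor_le (hab : ∀ᵐ t ∂μ, t ∈ Set.Icc a b) (hw : ∀ j, 0 ≤ w j)
    (hw' : ∀ j, 0 ≤ w' j) (hz : z ∈ dataBox p MX MY) (hz' : z' ∈ dataBox p MX MY) :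
    |wker μ w z z' - wker μ w' z z' - ∑ l, (w' l - w l) * gker μ w l z z'|
      ≤ b ^ 2 * μ.real Set.univ * (2 * MX) ^ 2 * dist1 w w' ^ 2 := by
  have h1 := abs_profile_taylor_le hab (wdist_nonneg hw z.1 z'.1) (wdist_nonneg hw' z.1 z'.1)
  have h2 : ∑ l, (w' l - w l) * gker μ w l z z'
      = slope μ (wdist w z.1 z'.1) * (wdist w' z.1 z'.1 - wdist w z.1 z'.1) := by
    rw [wdist_sub, Finset.mul_sum]
    exact Finset.sum_congr rfl fun l _ => by rw [gker]; ring
  rw [h2, ← abs_neg]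
  refine (le_of_eq (by rw [wker, wker]; congr 1; ring)).trans (h1.trans ?_)
  rw [mul_assoc (b ^ 2 * _), ← mul_pow]
  exact mul_le_mul_of_nonneg_left (sq_le_sq' (abs_le.1 (abs_wdist_sub_le hz hz' w w')).1
    (abs_le.1 (abs_wdist_sub_le hz hz' w w')).2) (by positivity)

/-- The partial derivatives of the objective in the weights. -/
noncomputable def krrGradient (μ : Measure ℝ) [IsFiniteMeasure μ] (lam : ℝ)
    (P : Measure ((Fin p → ℝ) × ℝ)) (w : Fin p → ℝ) (l : Fin p) : ℝ :=
  (2 * lam)⁻¹ * pairing P (gker μ w l) (residual μ lam P w) (residual μ lam P w)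

theorem abs_integral_mul_le {u g : (Fin p → ℝ) × ℝ → ℝ} {c : ℝ} (hu : Integrable u P)
    (hg : ∀ᵐ z ∂P, |g z| ≤ c) : |∫ z, u z * g z ∂P| ≤ c * ∫ z, |u z| ∂P := by
  rw [← integral_const_mul, ← Real.norm_eq_abs]
  refine norm_integral_le_of_norm_le (hu.abs.const_mul c) ?_
  filter_upwards [hg] with z hz
  rw [Real.norm_eq_abs, abs_mul, mul_comm]
  exact mul_le_mul_of_nonneg_right hz (abs_nonneg _)

theorem integrable_mul_wker (hb : 0 ≤ b) (hab : ∀ᵐ t ∂μ, t ∈ Set.Icc a b) (hw : ∀ j, 0 ≤ w j)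
    {u : (Fin p → ℝ) × ℝ → ℝ} (hu : Integrable u P) (z : (Fin p → ℝ) × ℝ) :
    Integrable (fun z' => u z' * wker μ w z' z) P := by
  refine hu.mul_bdd (c := μ.real Set.univ) ?_
    (ae_of_all _ fun z' => abs_profile_le (wdist_nonneg hw z'.1 z.1))
  exact ((continuous_wker hb hab hw).comp (Continuous.prodMk_left z)).aestronglyMeasurable

variable [IsProbabilityMeasure P]

theorem integral_abs_residual_le (hb : 0 ≤ b) (hab : ∀ᵐ t ∂μ, t ∈ Set.Icc a b)
    (hP : ∀ᵐ z ∂P, z ∈ dataBox p MX MY) (hlam : 0 < lam) (hw : ∀ j, 0 ≤ w j) :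
    ∫ z, |residual μ lam P w z| ∂P ≤ MY := by
  refine integral_abs_le_of_eq (g := fun z => z.2) (isBddKernel_wker hb hab hw)
    (memLp_residual hb hab hP w) hlam (ae_abs_snd_le hP)
    (pairing_wker_nonneg hb hab hw (integrable_residual hb hab hP w)) (ae_of_all _ fun z => ?_)
  rw [← fit_eq hb hab hP hlam hw, inv_mul_cancel_left₀ hlam.ne']
  ring

/-- Comparison of the residual of `P` at weights `w` with any other function `s` that satisfies its
integral equation up to a uniform error. -/
theorem integral_abs_residual_sub_le (hb : 0 ≤ b) (hab : ∀ᵐ t ∂μ, t ∈ Set.Icc a b)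
    (hP : ∀ᵐ z ∂P, z ∈ dataBox p MX MY) (hlam : 0 < lam) (hw : ∀ j, 0 ≤ w j)
    {s : (Fin p → ℝ) × ℝ → ℝ} (hs : MemLp s 2 P) {e : ℝ}
    (he : ∀ᵐ z ∂P, |lam * (z.2 - s z) - ∫ z', s z' * wker μ w z' z ∂P| ≤ e) :
    ∫ z, |residual μ lam P w z - s z| ∂P ≤ lam⁻¹ * e := by
  have hr := memLp_residual (lam := lam) (P' := P) hb hab hP w
  have hri : Integrable (residual μ lam P w) P := hr.integrable (by norm_num)
  have hsi : Integrable s P := hs.integrable (by norm_num)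
  refine integral_abs_le_of_eq (K := wker μ w)
    (g := fun z => lam⁻¹ * (lam * (z.2 - s z) - ∫ z', s z' * wker μ w z' z ∂P))
    (isBddKernel_wker hb hab hw) (hr.sub hs) hlam ?_ (pairing_wker_nonneg hb hab hw (hri.sub hsi))
    (ae_of_all _ fun z => ?_)
  · filter_upwards [he] with z hz
    rw [abs_mul, abs_of_pos (inv_pos.2 hlam)]
    exact mul_le_mul_of_nonneg_left hz (inv_nonneg.2 hlam.le)
  · have h1 := fit_eq hb hab hP hlam hw z
    have h2 : ∫ z', (residual μ lam P w z' - s z') * wker μ w z' z ∂P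
        = lam * (z.2 - residual μ lam P w z) - ∫ z', s z' * wker μ w z' z ∂P := by
      rw [h1, ← integral_sub (integrable_mul_wker hb hab hw hri z)
        (integrable_mul_wker hb hab hw hsi z)]
      congr 1
      ext z'
      ring
    simp only [h2]
    field_simp
    ring

theorem integral_abs_residual_sub_residual_le (hb : 0 ≤ b) (hab : ∀ᵐ t ∂μ, t ∈ Set.Icc a b)
    (hP : ∀ᵐ z ∂P, z ∈ dataBox p MX MY) (hlam : 0 < lam) (hw : ∀ j, 0 ≤ w j)
    (hw' : ∀ j, 0 ≤ w' j) :
    ∫ z, |residual μ lam P w' z - residual μ lam P w z| ∂P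
      ≤ lam⁻¹ * (b * μ.real Set.univ * (2 * MX) * dist1 w w' * MY) := by
  obtain ⟨z₀, hz₀⟩ := hP.exists
  have hri := integrable_residual (lam := lam) (P' := P) hb hab hP w
  refine integral_abs_residual_sub_le hb hab hP hlam hw' (memLp_residual hb hab hP w) ?_
  filter_upwards [hP] with z hz
  rw [fit_eq hb hab hP hlam hw, ← integral_sub (integrable_mul_wker hb hab hw hri z)
    (integrable_mul_wker hb hab hw' hri z)]
  simp only [← mul_sub]
  refine (abs_integral_mul_le (c := b * μ.real Set.univ * (2 * MX) * dist1 w w') hri ?_).trans ?_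
  · filter_upwards [hP] with z' hz'
    rw [abs_sub_comm]
    exact abs_wker_sub_le hb hab hw hw' hz' hz
  · have h0 : 0 ≤ 2 * MX * dist1 w w' := (abs_nonneg _).trans (abs_wdist_sub_le hz₀ hz₀ w w')
    refine mul_le_mul_of_nonneg_left (integral_abs_residual_le hb hab hP hlam hw) ?_
    rw [mul_assoc]
    positivity

/-- The exact increment of the objective between two weight vectors. -/
theorem krr_increment (hb : 0 ≤ b) (hab : ∀ᵐ t ∂μ, t ∈ Set.Icc a b)
    (hP : ∀ᵐ z ∂P, z ∈ dataBox p MX MY) (hlam : 0 < lam) (hw : ∀ j, 0 ≤ w j)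
    (hw' : ∀ j, 0 ≤ w' j) :
    (1 / 2) * ∫ z, z.2 * residual μ lam P w' z ∂P - (1 / 2) * ∫ z, z.2 * residual μ lam P w z ∂P
      = (2 * lam)⁻¹ * pairing P (fun z z' => wker μ w z z' - wker μ w' z z')
          (residual μ lam P w) (residual μ lam P w') := by
  have hr := memLp_residual (lam := lam) (P' := P) hb hab hP w
  have hr' := memLp_residual (lam := lam) (P' := P) hb hab hP w'
  have hri : Integrable (residual μ lam P w) P := hr.integrable (by norm_num)
  have hri' : Integrable (residual μ lam P w') P := hr'.integrable (by norm_num)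
  have hY := memLp_snd hP
  have i1 : Integrable (fun z => z.2 * residual μ lam P w z) P := hY.integrable_mul hr
  have i2 : Integrable (fun z => z.2 * residual μ lam P w' z) P := hY.integrable_mul hr'
  have i3 : Integrable (fun z => residual μ lam P w z * residual μ lam P w' z) P :=
    hr.integrable_mul hr'
  have e1 : pairing P (wker μ w) (residual μ lam P w) (residual μ lam P w')
      = lam * (∫ z, z.2 * residual μ lam P w' z ∂P
        - ∫ z, residual μ lam P w z * residual μ lam P w' z ∂P) := by
    rw [pairing_eq_right (isBddKernel_wker hb hab hw) hri hri', ← integral_sub i2 i3,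
      ← integral_const_mul]
    refine integral_congr_ae (ae_of_all _ fun z => ?_)
    dsimp only
    rw [← fit_eq hb hab hP hlam hw]
    ring
  have e2 : pairing P (wker μ w') (residual μ lam P w) (residual μ lam P w')
      = lam * (∫ z, z.2 * residual μ lam P w z ∂P
        - ∫ z, residual μ lam P w z * residual μ lam P w' z ∂P) := by
    rw [pairing_eq_left (isBddKernel_wker hb hab hw') hri hri', ← integral_sub i1 i3,
      ← integral_const_mul]
    refine integral_congr_ae (ae_of_all _ fun z => ?_)
    dsimp only
    simp only [wker_comm (w := w') z]
    rw [← fit_eq hb hab hP hlam hw']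
    ring
  rw [pairing_sub_kernel (isBddKernel_wker hb hab hw) (isBddKernel_wker hb hab hw') hri hri',
    e1, e2]
  field_simp
  ring

theorem abs_krrGradient_le (hb : 0 ≤ b) (hab : ∀ᵐ t ∂μ, t ∈ Set.Icc a b)
    (hP : ∀ᵐ z ∂P, z ∈ dataBox p MX MY) (hlam : 0 < lam) (hw : ∀ j, 0 ≤ w j) (l : Fin p) :
    |krrGradient μ lam P w l| ≤ (2 * lam)⁻¹ * (b * μ.real Set.univ * (2 * MX) * MY ^ 2) := by
  have hri := integrable_residual (lam := lam) (P' := P) hb hab hP w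
  have h1 := integral_abs_residual_le hb hab hP hlam hw
  have h0 : 0 ≤ ∫ z, |residual μ lam P w z| ∂P := integral_nonneg fun _ => abs_nonneg _
  obtain ⟨z₀, hz₀⟩ := hP.exists
  have hMX : 0 ≤ MX := (abs_nonneg _).trans (hz₀.1 l)
  rw [krrGradient, abs_mul, abs_of_pos (by positivity), sq]
  refine mul_le_mul_of_nonneg_left ((abs_pairing_le (isBddKernel_gker hb hab hw hP l) hri
    hri).trans (mul_le_mul_of_nonneg_left (mul_le_mul h1 h1 h0 (h0.trans h1)) (by positivity)))
    (by positivity)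

theorem abs_krrGradient_sub_le (hb : 0 ≤ b) (hab : ∀ᵐ t ∂μ, t ∈ Set.Icc a b)
    (hP : ∀ᵐ z ∂P, z ∈ dataBox p MX MY) (hlam : 0 < lam) (hw : ∀ j, 0 ≤ w j)
    (hw' : ∀ j, 0 ≤ w' j) (l : Fin p) :
    |krrGradient μ lam P w' l - krrGradient μ lam P w l|
      ≤ (2 * lam)⁻¹ * (b ^ 2 * μ.real Set.univ * (2 * MX) ^ 2 * MY ^ 2
        + 2 * lam⁻¹ * (b * μ.real Set.univ * (2 * MX) * MY) ^ 2) * dist1 w w' := by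
  obtain ⟨z₀, hz₀⟩ := hP.exists
  have hMX : 0 ≤ MX := (abs_nonneg _).trans (hz₀.1 l)
  have hMY : 0 ≤ MY := (abs_nonneg _).trans hz₀.2
  have hd := dist1_nonneg w w'
  set r := residual μ lam P w with hr
  set r' := residual μ lam P w' with hr'
  have hri : Integrable r P := integrable_residual hb hab hP w
  have hri' : Integrable r' P := integrable_residual hb hab hP w'
  have h1 : ∫ z, |r z| ∂P ≤ MY := integral_abs_residual_le hb hab hP hlam hw
  have h1' : ∫ z, |r' z| ∂P ≤ MY := integral_abs_residual_le hb hab hP hlam hw'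
  have h2 : ∫ z, |r' z - r z| ∂P ≤ _ :=
    integral_abs_residual_sub_residual_le hb hab hP hlam hw hw'
  have h0 : 0 ≤ ∫ z, |r z| ∂P := integral_nonneg fun _ => abs_nonneg _
  have h0' : 0 ≤ ∫ z, |r' z| ∂P := integral_nonneg fun _ => abs_nonneg _
  have hK := isBddKernel_gker hb hab hw hP l
  have hK' := isBddKernel_gker hb hab hw' hP l
  have hKd : IsBddKernel P (fun z z' => gker μ w' l z z' - gker μ w l z z')
      (b ^ 2 * μ.real Set.univ * (2 * MX) ^ 2 * dist1 w w') :=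
    ⟨(hK'.sub hK).measurable, by
      filter_upwards [ae_prod_mem hP] with q hq
      exact abs_gker_sub_le hb hab hw hw' hq.1 hq.2 l⟩
  have e : pairing P (gker μ w' l) r' r' - pairing P (gker μ w l) r r
      = pairing P (gker μ w' l) (fun z => r' z - r z) r'
        + pairing P (gker μ w' l) r (fun z => r' z - r z)
        + pairing P (fun z z' => gker μ w' l z z' - gker μ w l z z') r r := by
    rw [pairing_sub_left hK' hri' hri hri', pairing_sub_right hK' hri hri' hri,
      pairing_sub_kernel hK' hK hri hri]
    ring
  have b1 := abs_pairing_le hK' (hri'.sub hri) hri'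
  have b2 := abs_pairing_le hK' hri (hri'.sub hri)
  have b3 := abs_pairing_le hKd hri hri
  simp only [Pi.sub_apply] at b1 b2
  have hc : 0 ≤ b * μ.real Set.univ * (2 * MX) := by positivity
  set c := b * μ.real Set.univ * (2 * MX) with hcdef
  set c2 := b ^ 2 * μ.real Set.univ * (2 * MX) ^ 2 with hc2def
  set D := lam⁻¹ * (c * dist1 w w' * MY) with hD
  have hD0 : 0 ≤ D := by positivity
  have b1' : |pairing P (gker μ w' l) (fun z => r' z - r z) r'| ≤ c * (D * MY) :=
    b1.trans (mul_le_mul_of_nonneg_left (mul_le_mul h2 h1' h0' hD0) hc)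
  have b2' : |pairing P (gker μ w' l) r (fun z => r' z - r z)| ≤ c * (MY * D) :=
    b2.trans (mul_le_mul_of_nonneg_left (mul_le_mul h1 h2
      (integral_nonneg fun _ => abs_nonneg _) hMY) hc)
  have b3' : |pairing P (fun z z' => gker μ w' l z z' - gker μ w l z z') r r|
      ≤ c2 * dist1 w w' * (MY * MY) :=
    b3.trans (mul_le_mul_of_nonneg_left (mul_le_mul h1 h1 h0 hMY) (by positivity))
  rw [krrGradient, krrGradient, ← mul_sub, abs_mul, abs_of_pos (by positivity), ← hr, ← hr', e,
    mul_assoc]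
  refine mul_le_mul_of_nonneg_left ((abs_add_three _ _ _).trans
    ((add_le_add (add_le_add b1' b2') b3').trans (le_of_eq ?_))) (by positivity)
  rw [hD]
  ring

/-- The first order expansion of the objective. -/
theorem abs_krr_taylor_le (hb : 0 ≤ b) (hab : ∀ᵐ t ∂μ, t ∈ Set.Icc a b)
    (hP : ∀ᵐ z ∂P, z ∈ dataBox p MX MY) (hlam : 0 < lam) (hw : ∀ j, 0 ≤ w j)
    (hw' : ∀ j, 0 ≤ w' j) :
    |(1 / 2) * ∫ z, z.2 * residual μ lam P w' z ∂P - (1 / 2) * ∫ z, z.2 * residual μ lam P w z ∂P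
        - ∑ l, (w' l - w l) * krrGradient μ lam P w l|
      ≤ (2 * lam)⁻¹ * (lam⁻¹ * (b * μ.real Set.univ * (2 * MX) * MY) ^ 2
        + b ^ 2 * μ.real Set.univ * (2 * MX) ^ 2 * MY ^ 2) * dist1 w w' ^ 2 := by
  obtain ⟨z₀, hz₀⟩ := hP.exists
  have hMY : 0 ≤ MY := (abs_nonneg _).trans hz₀.2
  have hd := dist1_nonneg w w'
  have hMXd : 0 ≤ 2 * MX * dist1 w w' := (abs_nonneg _).trans (abs_wdist_sub_le hz₀ hz₀ w w')
  set r := residual μ lam P w with hr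
  set r' := residual μ lam P w' with hr'
  have hri : Integrable r P := integrable_residual hb hab hP w
  have hri' : Integrable r' P := integrable_residual hb hab hP w'
  have h1 : ∫ z, |r z| ∂P ≤ MY := integral_abs_residual_le hb hab hP hlam hw
  have h2 : ∫ z, |r' z - r z| ∂P ≤ _ :=
    integral_abs_residual_sub_residual_le hb hab hP hlam hw hw'
  have h0 : 0 ≤ ∫ z, |r z| ∂P := integral_nonneg fun _ => abs_nonneg _
  have hK := isBddKernel_wker (P := P) hb hab hw
  have hK' := isBddKernel_wker (P := P) hb hab hw'
  have hKd : IsBddKernel P (fun z z' => wker μ w z z' - wker μ w' z z')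
      (b * μ.real Set.univ * (2 * MX * dist1 w w')) :=
    ⟨(hK.sub hK').measurable, by
      filter_upwards [ae_prod_mem hP] with q hq
      rw [abs_sub_comm, ← mul_assoc]
      exact abs_wker_sub_le hb hab hw hw' hq.1 hq.2⟩
  have hKs : IsBddKernel P (fun z z' => ∑ l, (w' l - w l) * gker μ w l z z')
      (∑ l, |w' l - w l| * (b * μ.real Set.univ * (2 * MX))) := by
    refine ⟨Finset.measurable_fun_sum _ fun l _ =>
      (isBddKernel_gker hb hab hw hP l).measurable.const_mul _, ?_⟩
    have : ∀ᵐ q ∂(P.prod P), ∀ l, |gker μ w l q.1 q.2| ≤ b * μ.real Set.univ * (2 * MX) :=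
      ae_all_iff.2 fun l => (isBddKernel_gker hb hab hw hP l).bound
    filter_upwards [this] with q hq
    refine (Finset.abs_sum_le_sum_abs _ _).trans (Finset.sum_le_sum fun l _ => ?_)
    rw [abs_mul]
    exact mul_le_mul_of_nonneg_left (hq l) (abs_nonneg _)
  have hKt : IsBddKernel P (fun z z' => wker μ w z z' - wker μ w' z z'
      - ∑ l, (w' l - w l) * gker μ w l z z')
      (b ^ 2 * μ.real Set.univ * (2 * MX * dist1 w w') ^ 2) :=
    ⟨(hKd.sub hKs).measurable, by
      filter_upwards [ae_prod_mem hP] with q hq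
      rw [mul_pow, ← mul_assoc]
      exact abs_wker_taylor_le hab hw hw' hq.1 hq.2⟩
  have es : ∑ l, (w' l - w l) * krrGradient μ lam P w l = (2 * lam)⁻¹ *
      pairing P (fun z z' => ∑ l, (w' l - w l) * gker μ w l z z') r r := by
    have : pairing P (fun z z' => ∑ l, (w' l - w l) * gker μ w l z z') r r
        = ∑ l, (w' l - w l) * pairing P (gker μ w l) r r := by
      simp only [pairing, ← integral_const_mul]
      rw [← integral_finsetSum _ fun l _ =>
        ((isBddKernel_gker hb hab hw hP l).integrable hri hri).const_mul _]
      congr 1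
      ext q
      rw [Finset.mul_sum]
      exact Finset.sum_congr rfl fun l _ => by ring
    rw [this, Finset.mul_sum]
    exact Finset.sum_congr rfl fun l _ => by rw [krrGradient]; ring
  have b1 := abs_pairing_le hKd hri (hri'.sub hri)
  have b2 := abs_pairing_le hKt hri hri
  simp only [Pi.sub_apply] at b1
  rw [krr_increment hb hab hP hlam hw hw', es, ← mul_sub, abs_mul, abs_of_pos (by positivity),
    mul_assoc]
  refine mul_le_mul_of_nonneg_left ?_ (by positivity)
  have e : pairing P (fun z z' => wker μ w z z' - wker μ w' z z') r r'
        - pairing P (fun z z' => ∑ l, (w' l - w l) * gker μ w l z z') r r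
      = pairing P (fun z z' => wker μ w z z' - wker μ w' z z') r (fun z => r' z - r z)
        + pairing P (fun z z' => wker μ w z z' - wker μ w' z z'
          - ∑ l, (w' l - w l) * gker μ w l z z') r r := by
    rw [pairing_sub_right hKd hri hri' hri, pairing_sub_kernel hKd hKs hri hri]
    ring
  rw [← hr, ← hr', e]
  refine (abs_add_le _ _).trans ((add_le_add (b1.trans (mul_le_mul_of_nonneg_left
    (mul_le_mul h1 h2 (integral_nonneg fun _ => abs_nonneg _) hMY) (by positivity)))
    (b2.trans (mul_le_mul_of_nonneg_left (mul_le_mul h1 h1 h0 hMY) (by positivity)))).trans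
    (le_of_eq ?_))
  ring

end Gradient

/-! ### Existence of projected gradient trajectories -/

section Existence

open Filter Topology

variable {E : Type*} [NormedAddCommGroup E] [InnerProductSpace ℝ E] {B : Set E} {G : E → E}
  {x : ℕ → E} {h D L R : ℝ}

theorem norm_euler_succ_sub_le (hx : ∀ k, x k ∈ B) (hh : 0 < h) (hD : ∀ u ∈ B, ‖G u‖ ≤ D)
    (hvar : ∀ k, ∀ y ∈ B, ⟪x k - h • G (x k) - x (k + 1), y - x (k + 1)⟫ ≤ 0) (k : ℕ) :
    ‖x (k + 1) - x k‖ ≤ h * D := by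
  have h1 := hvar k (x k) (hx k)
  have e : x k - h • G (x k) - x (k + 1) = (x k - x (k + 1)) - h • G (x k) := by abel
  rw [e, inner_sub_left, real_inner_self_eq_norm_sq, real_inner_smul_left] at h1
  have h2 := (real_inner_le_norm (G (x k)) (x k - x (k + 1))).trans
    (mul_le_mul_of_nonneg_right (hD _ (hx k)) (norm_nonneg _))
  have h3 := mul_le_mul_of_nonneg_left h2 hh.le
  rw [norm_sub_rev]
  by_contra! hlt
  have := (norm_nonneg (G (x k))).trans (hD _ (hx k))
  have h4 : 0 < ‖x k - x (k + 1)‖ := lt_of_le_of_lt (by positivity) hlt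
  nlinarith

theorem norm_euler_add_sub_le (hx : ∀ k, x k ∈ B) (hh : 0 < h) (hD : ∀ u ∈ B, ‖G u‖ ≤ D)
    (hvar : ∀ k, ∀ y ∈ B, ⟪x k - h • G (x k) - x (k + 1), y - x (k + 1)⟫ ≤ 0) (k j : ℕ) :
    ‖x (k + j) - x k‖ ≤ j * (h * D) := by
  induction j with
  | zero => simp
  | succ j ih =>
    have h1 := norm_euler_succ_sub_le hx hh hD hvar (k + j)
    have h2 := norm_add_le (x (k + j + 1) - x (k + j)) (x (k + j) - x k)
    rw [sub_add_sub_cancel] at h2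
    push_cast
    rw [← add_assoc]
    linarith

/-- Discrete evolution variational inequality for the projected Euler scheme. -/
theorem euler_energy (hx : ∀ k, x k ∈ B) (hh : 0 < h) (hD : ∀ u ∈ B, ‖G u‖ ≤ D)
    (hL : ∀ u ∈ B, ∀ v ∈ B, ‖G u - G v‖ ≤ L * ‖u - v‖) (hL0 : 0 ≤ L)
    (hR : ∀ u ∈ B, ∀ v ∈ B, ‖u - v‖ ≤ R)
    (hvar : ∀ k, ∀ y ∈ B, ⟪x k - h • G (x k) - x (k + 1), y - x (k + 1)⟫ ≤ 0)
    (k j : ℕ) {y : E} (hy : y ∈ B) :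
    1 / 2 * ‖x (k + j) - y‖ ^ 2 - 1 / 2 * ‖x k - y‖ ^ 2
      ≤ j * h * (⟪-G (x k), x k - y⟫ + (L * D * R + D * D) * (j * h)) := by
  have hD0 : 0 ≤ D := (norm_nonneg _).trans (hD _ hy)
  have hR0 : 0 ≤ R := (norm_nonneg _).trans (hR _ hy _ hy)
  induction j with
  | zero => simp
  | succ j ih =>
    set i := k + j with hi
    have h1 := hvar i y hy
    have e1 : x i - h • G (x i) - x (i + 1) = (x i - y) - (x (i + 1) - y) - h • G (x i) := by abel
    have e2 : y - x (i + 1) = -(x (i + 1) - y) := by abel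
    rw [e1, e2, inner_neg_right, inner_sub_left, inner_sub_left, real_inner_smul_left,
      real_inner_self_eq_norm_sq] at h1
    have h2 : ⟪x i - y, x (i + 1) - y⟫ ≤ 1 / 2 * ‖x i - y‖ ^ 2 + 1 / 2 * ‖x (i + 1) - y‖ ^ 2 := by
      have := real_inner_le_norm (x i - y) (x (i + 1) - y)
      nlinarith [sq_nonneg (‖x i - y‖ - ‖x (i + 1) - y‖)]
    have h3 : -⟪G (x i), x (i + 1) - y⟫ - ⟪-G (x k), x k - y⟫
        ≤ (L * D * R + D * D) * ((j + 1) * h) := by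
      have e3 : -⟪G (x i), x (i + 1) - y⟫ - ⟪-G (x k), x k - y⟫
          = -⟪G (x i) - G (x k), x (i + 1) - y⟫ - ⟪G (x k), x (i + 1) - x k⟫ := by
        simp only [inner_sub_left, inner_sub_right, inner_neg_left]
        ring
      have b1 : -⟪G (x i) - G (x k), x (i + 1) - y⟫ ≤ (L * (j * (h * D))) * R := by
        rw [← inner_neg_left]
        refine (real_inner_le_norm _ _).trans ?_
        rw [norm_neg]
        exact mul_le_mul ((hL _ (hx _) _ (hx _)).trans (mul_le_mul_of_nonneg_left
          (norm_euler_add_sub_le hx hh hD hvar k j) hL0)) (hR _ (hx _) _ hy) (norm_nonneg _)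
          (by positivity)
      have b2 : -⟪G (x k), x (i + 1) - x k⟫ ≤ D * ((j + 1) * (h * D)) := by
        rw [← inner_neg_left]
        refine (real_inner_le_norm _ _).trans ?_
        rw [norm_neg]
        have := norm_euler_add_sub_le hx hh hD hvar k (j + 1)
        push_cast at this
        exact mul_le_mul (hD _ (hx _)) this (norm_nonneg _) hD0
      rw [e3]
      have : 0 ≤ L * D * R * h := by positivity
      nlinarith
    have h4 := mul_le_mul_of_nonneg_left h3 hh.le
    have h5 : 0 ≤ (L * D * R + D * D) * h * h * j := by positivity
    push_cast
    rw [← add_assoc]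
    nlinarith

/-- The projected Euler iterates converge along an ultrafilter to a Lipschitz curve which satisfies
the evolution variational inequality. -/
theorem exists_evolution (hB : IsCompact B) (hconv : Convex ℝ B) (hD : ∀ u ∈ B, ‖G u‖ ≤ D)
    (hL : ∀ u ∈ B, ∀ v ∈ B, ‖G u - G v‖ ≤ L * ‖u - v‖) (hL0 : 0 ≤ L)
    (hR : ∀ u ∈ B, ∀ v ∈ B, ‖u - v‖ ≤ R) {x₀ : E} (hx₀ : x₀ ∈ B) :
    ∃ β : ℝ → E, β 0 = x₀ ∧ (∀ t, β t ∈ B) ∧ (∀ s t, ‖β t - β s‖ ≤ D * |t - s|) ∧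
      ∀ s t, 0 ≤ s → s ≤ t → ∀ y ∈ B, 1 / 2 * ‖β t - y‖ ^ 2 - 1 / 2 * ‖β s - y‖ ^ 2
        ≤ (t - s) * (⟪-G (β s), β s - y⟫ + (L * D * R + D * D) * (t - s)) := by
  have hD0 : 0 ≤ D := (norm_nonneg _).trans (hD _ hx₀)
  have hproj : ∀ u : E, ∃ v ∈ B, ∀ y ∈ B, ⟪u - v, y - v⟫ ≤ 0 := fun u => by
    obtain ⟨v, hv, h⟩ := exists_norm_eq_iInf_of_complete_convex ⟨x₀, hx₀⟩ hB.isComplete hconv u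
    exact ⟨v, hv, (norm_eq_iInf_iff_real_inner_le_zero hconv hv).1 h⟩
  choose π hπB hπ using hproj
  let h : ℕ → ℝ := fun N => 1 / ((N : ℝ) + 1)
  have hh : ∀ N, 0 < h N := fun N => by positivity
  let x : ℕ → ℕ → E := fun N => Nat.rec x₀ fun _ u => π (u - h N • G u)
  have hx : ∀ N k, x N k ∈ B := fun N k => by
    cases k with
    | zero => exact hx₀
    | succ k => exact hπB _
  have hvar : ∀ N k, ∀ y ∈ B,
      ⟪x N k - h N • G (x N k) - x N (k + 1), y - x N (k + 1)⟫ ≤ 0 := fun N k => hπ _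
  let idx : ℕ → ℝ → ℕ := fun N t => ⌊max t 0 * ((N : ℝ) + 1)⌋₊
  have hidx : ∀ t, Tendsto (fun N => (idx N t : ℝ) * h N) atTop (𝓝 (max t 0)) := fun t => by
    have h1 := (tendsto_nat_floor_mul_div_atTop (R := ℝ) (le_max_right t 0)).comp
      (tendsto_natCast_atTop_atTop.comp (tendsto_add_atTop_nat 1))
    refine h1.congr fun N => ?_
    simp [idx, h, div_eq_mul_inv]
  have hmono : ∀ N s t, s ≤ t → idx N s ≤ idx N t := fun N s t hst =>
    Nat.floor_le_floor (mul_le_mul_of_nonneg_right (max_le_max_right _ hst) (by positivity))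
  have hdiff : ∀ s t, s ≤ t → Tendsto (fun N => ((idx N t - idx N s : ℕ) : ℝ) * h N)
      (hyperfilter ℕ : Filter ℕ) (𝓝 (max t 0 - max s 0)) := fun s t hst => by
    refine (((hidx t).sub (hidx s)).mono_left Nat.hyperfilter_le_atTop).congr fun N => ?_
    rw [Nat.cast_sub (hmono N s t hst)]
    ring
  have hlim : ∀ t, ∃ y ∈ B, Tendsto (fun N => x N (idx N t)) (hyperfilter ℕ : Filter ℕ) (𝓝 y) := by
    intro t
    have := hB.ultrafilter_le_nhds ((hyperfilter ℕ).map fun N => x N (idx N t)) (by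
      rw [le_principal_iff]
      exact Filter.mem_map.2 (Filter.univ_mem' fun N => hx N _))
    exact this
  choose β hβB hβ using hlim
  refine ⟨β, ?_, hβB, ?_, ?_⟩
  · refine tendsto_nhds_unique (hβ 0) ?_
    have : ∀ N, x N (idx N 0) = x₀ := fun N => by simp [idx, x]
    simp [this]
  · have key : ∀ s t, s ≤ t → ‖β t - β s‖ ≤ D * |t - s| := by
      intro s t hst
      have h1 : ∀ N, ‖x N (idx N t) - x N (idx N s)‖
          ≤ ((idx N t - idx N s : ℕ) : ℝ) * h N * D := fun N => by
        have := norm_euler_add_sub_le (hx N) (hh N) hD (hvar N) (idx N s) (idx N t - idx N s)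
        rwa [Nat.add_sub_cancel' (hmono N s t hst), ← mul_assoc] at this
      have h2 := le_of_tendsto_of_tendsto' ((hβ t).sub (hβ s)).norm
        ((hdiff s t hst).mul_const D) h1
      refine h2.trans ?_
      rw [mul_comm]
      refine mul_le_mul_of_nonneg_left ((le_abs_self _).trans ?_) hD0
      exact abs_max_sub_max_le_abs t s 0
    intro s t
    rcases le_total s t with hst | hst
    · exact key s t hst
    · rw [norm_sub_rev, abs_sub_comm]
      exact key t s hst
  · intro s t hs hst y hy
    have h1 : ∀ N, 1 / 2 * ‖x N (idx N t) - y‖ ^ 2 - 1 / 2 * ‖x N (idx N s) - y‖ ^ 2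
        ≤ ((idx N t - idx N s : ℕ) : ℝ) * h N * (⟪-G (x N (idx N s)), x N (idx N s) - y⟫
          + (L * D * R + D * D) * (((idx N t - idx N s : ℕ) : ℝ) * h N)) := fun N => by
      have := euler_energy (hx N) (hh N) hD hL hL0 hR (hvar N) (idx N s) (idx N t - idx N s) hy
      rwa [Nat.add_sub_cancel' (hmono N s t hst)] at this
    have hd := hdiff s t hst
    rw [max_eq_left hs, max_eq_left (hs.trans hst)] at hd
    have hGc : ContinuousOn G B := by
      refine (LipschitzOnWith.of_dist_le_mul (K := L.toNNReal) fun u hu v hv => ?_).continuousOn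
      rw [dist_eq_norm, dist_eq_norm, Real.coe_toNNReal _ hL0]
      exact hL u hu v hv
    have hG : Tendsto (fun N => G (x N (idx N s))) (hyperfilter ℕ : Filter ℕ) (𝓝 (G (β s))) :=
      (hGc (β s) (hβB s)).tendsto.comp
        (tendsto_nhdsWithin_iff.2 ⟨hβ s, Eventually.of_forall fun N => hx N _⟩)
    refine le_of_tendsto_of_tendsto' (b := (hyperfilter ℕ : Filter ℕ)) ?_ ?_ h1
    · exact ((((hβ t).sub_const y).norm.pow 2).const_mul _).sub
        ((((hβ s).sub_const y).norm.pow 2).const_mul _)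
    · exact hd.mul ((hG.neg.inner ((hβ s).sub_const y)).add (hd.const_mul _))

/-- Existence for the differential inclusion `β' ∈ -G(β) - N_B(β)` with a Lipschitz field `G` on a
compact convex set `B`. -/
theorem exists_flow [FiniteDimensional ℝ E] (hB : IsCompact B) (hconv : Convex ℝ B)
    (hD : ∀ u ∈ B, ‖G u‖ ≤ D)
    (hL : ∀ u ∈ B, ∀ v ∈ B, ‖G u - G v‖ ≤ L * ‖u - v‖) (hL0 : 0 ≤ L) {x₀ : E} (hx₀ : x₀ ∈ B) :
    ∃ β v : ℝ → E, β 0 = x₀ ∧ (∀ t, β t ∈ B) ∧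
      (∀ t, IntervalIntegrable v volume 0 t) ∧ (∀ t, β t = β 0 + ∫ s in (0 : ℝ)..t, v s) ∧
      ∀ᵐ s ∂(volume.restrict (Set.Ici (0 : ℝ))), ∀ y ∈ B, ⟪-G (β s) - v s, y - β s⟫ ≤ 0 := by
  obtain ⟨R, hR⟩ := hB.isBounded.exists_norm_le
  have hR' : ∀ u ∈ B, ∀ v ∈ B, ‖u - v‖ ≤ R + R := fun u hu v hv =>
    (norm_sub_le _ _).trans (add_le_add (hR u hu) (hR v hv))
  obtain ⟨β, h0, hβB, hlip, hevi⟩ := exists_evolution hB hconv hD hL hL0 hR' hx₀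
  have hD0 : 0 ≤ D := (norm_nonneg _).trans (hD _ hx₀)
  have hLip : LipschitzWith D.toNNReal β := LipschitzWith.of_dist_le_mul fun t s => by
    rw [dist_eq_norm, Real.dist_eq, Real.coe_toNNReal _ hD0]
    exact hlip s t
  have hdiff : ∀ᵐ s : ℝ, DifferentiableAt ℝ β s := hLip.ae_differentiableAt_real
  have hint : ∀ t, IntervalIntegrable (deriv β) volume 0 t := fun t => by
    rw [intervalIntegrable_iff]
    refine Measure.integrableOn_of_bounded (M := D) (by simp)
      (stronglyMeasurable_deriv β).aestronglyMeasurable (ae_of_all _ fun s => ?_)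
    have := norm_deriv_le_of_lipschitz (x₀ := s) hLip
    rwa [Real.coe_toNNReal _ hD0] at this
  refine ⟨β, deriv β, h0, hβB, hint, fun t => ?_, ?_⟩
  · refine ext_inner_left ℝ fun c => ?_
    have hc : LipschitzWith (‖c‖ * D).toNNReal fun s => ⟪c, β s⟫ :=
      LipschitzWith.of_dist_le_mul fun u s => by
        rw [Real.dist_eq, Real.dist_eq, Real.coe_toNNReal _ (by positivity), ← inner_sub_right,
          mul_assoc]
        exact (abs_real_inner_le_norm _ _).trans
          (mul_le_mul_of_nonneg_left (hlip s u) (norm_nonneg _))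
    have h1 := ((hc.lipschitzOnWith (s := Set.uIcc 0 t)).absolutelyContinuousOnInterval
      ).integral_deriv_eq_sub
    have h2 : ∫ s in (0 : ℝ)..t, deriv (fun s => ⟪c, β s⟫) s
        = ∫ s in (0 : ℝ)..t, ⟪c, deriv β s⟫ := by
      refine intervalIntegral.integral_congr_ae ?_
      filter_upwards [hdiff] with s hs _
      exact ((innerSL ℝ c).hasFDerivAt.comp_hasDerivAt s hs.hasDerivAt).deriv
    have h3 : ∫ s in (0 : ℝ)..t, ⟪c, deriv β s⟫ = ⟪c, ∫ s in (0 : ℝ)..t, deriv β s⟫ :=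
      (innerSL ℝ c).intervalIntegral_comp_comm (hint t)
    rw [inner_add_right, ← h3, ← h2, h1]
    ring
  · filter_upwards [ae_restrict_of_ae hdiff, ae_restrict_mem measurableSet_Ici] with s hs hs0 y hy
    have hd : HasDerivAt (fun t => 1 / 2 * ‖β t - y‖ ^ 2) (⟪β s - y, deriv β s⟫) s := by
      have := ((hs.hasDerivAt.sub_const y).norm_sq).const_mul (1 / 2 : ℝ)
      convert! this using 1
      ring
    have hlim := hd.tendsto_slope_zero_right
    have hup : Tendsto (fun τ : ℝ => ⟪-G (β s), β s - y⟫ + (L * D * (R + R) + D * D) * τ)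
        (𝓝[>] 0) (𝓝 (⟪-G (β s), β s - y⟫ + (L * D * (R + R) + D * D) * 0)) := by
      refine Tendsto.mono_left ?_ nhdsWithin_le_nhds
      exact (Continuous.tendsto (by fun_prop) 0)
    have hle := le_of_tendsto_of_tendsto hlim hup (by
      filter_upwards [self_mem_nhdsWithin] with τ hτ
      have hτ0 : 0 < τ := hτ
      have := hevi s (s + τ) hs0 (by linarith) y hy
      rw [add_sub_cancel_left] at this
      rw [smul_eq_mul, inv_mul_le_iff₀ hτ0]
      exact this)
    rw [mul_zero, add_zero] at hle
    have e : y - β s = -(β s - y) := by abel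
    rw [e, inner_neg_right, inner_sub_left, real_inner_comm]
    rw [real_inner_comm] at hle
    rw [real_inner_comm] at hle
    linarith [real_inner_comm (deriv β s) (β s - y), real_inner_comm (-G (β s)) (β s - y)]

end Existence

/-! ### Analysis of projected gradient trajectories in a box -/

section Trajectory

open Filter Topology Set

variable {p : ℕ} {M : ℝ} {F : EuclideanSpace ℝ (Fin p) → ℝ}
  {G : EuclideanSpace ℝ (Fin p) → Fin p → ℝ}

theorem isClosed_box : IsClosed (box p M) := by
  have : box p M = ⋂ j, (fun β : EuclideanSpace ℝ (Fin p) => β j) ⁻¹' Icc 0 M := by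
    ext
    simp [box]
  rw [this]
  exact isClosed_iInter fun j => isClosed_Icc.preimage (by fun_prop)

theorem convex_box : Convex ℝ (box p M) := by
  intro x hx y hy s t hs ht hst j
  have h1 := hx j
  have h2 := hy j
  simp only [PiLp.add_apply, PiLp.smul_apply, smul_eq_mul]
  have : M = s * M + t * M := by rw [← add_mul, hst, one_mul]
  constructor
  · exact add_nonneg (mul_nonneg hs h1.1) (mul_nonneg ht h2.1)
  · rw [this]
    exact add_le_add (mul_le_mul_of_nonneg_left h1.2 hs) (mul_le_mul_of_nonneg_left h2.2 ht)

theorem isCompact_box : IsCompact (box p M) := by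
  refine Metric.isCompact_of_isClosed_isBounded isClosed_box ?_
  refine (Metric.isBounded_closedBall (x := 0) (r := √(∑ _j : Fin p, M ^ 2))).subset fun x hx => ?_
  rw [mem_closedBall_zero_iff, EuclideanSpace.norm_eq]
  refine Real.sqrt_le_sqrt (Finset.sum_le_sum fun j _ => ?_)
  rw [Real.norm_eq_abs, sq_abs]
  exact pow_le_pow_left₀ (hx j).1 (hx j).2 2

theorem zero_mem_box (hM : 0 < M) : (0 : EuclideanSpace ℝ (Fin p)) ∈ box p M :=
  fun _ => ⟨le_rfl, hM.le⟩

theorem uniqueDiffOn_box (hM : 0 < M) : UniqueDiffOn ℝ (box p M) := by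
  refine uniqueDiffOn_convex convex_box ⟨WithLp.toLp 2 fun _ => M / 2, ?_⟩
  rw [mem_interior]
  refine ⟨⋂ j, (fun β : EuclideanSpace ℝ (Fin p) => β j) ⁻¹' Ioo 0 M, fun x hx j => ?_,
    isOpen_iInter_of_finite fun j => isOpen_Ioo.preimage (by fun_prop), ?_⟩
  · have := mem_iInter.1 hx j
    exact ⟨this.1.le, this.2.le⟩
  · simp only [mem_iInter, mem_preimage, mem_Ioo]
    intro j
    constructor <;> linarith

/-- Normal vectors of a box are complementary to the active constraints. -/
theorem normalCone_box {x u : EuclideanSpace ℝ (Fin p)}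
    (hu : u ∈ normalCone (box p M) x) (j : Fin p) :
    (x j < M → u j ≤ 0) ∧ (0 < x j → 0 ≤ u j) := by
  have hx := hu.1
  have key : ∀ c, 0 ≤ x j + c → x j + c ≤ M → u j * c ≤ 0 := by
    intro c h0 h1
    have h := hu.2 (x + EuclideanSpace.single j c) fun i => by
      by_cases hij : i = j
      · subst hij
        simpa using ⟨h0, h1⟩
      · simpa [hij] using hx i
    rw [add_sub_cancel_left, EuclideanSpace.inner_single_right] at h
    simpa [mul_comm] using h
  constructor
  · intro h
    have := key (M - x j) (by linarith [(hx j).1]) (by linarith)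
    nlinarith
  · intro h
    have := key (-x j) (by linarith) (by linarith [(hx j).2])
    nlinarith

/-- A trajectory `γ` with velocity `v` of the projected gradient flow of a field `G` on a box,
described coordinate by coordinate: in the interior of its range a coordinate moves with velocity
`-G_j`, at an end point it rests and `-G_j` points outwards. -/
structure IsBoxTrajectory (M : ℝ) (G : EuclideanSpace ℝ (Fin p) → Fin p → ℝ)
    (γ v : ℝ → EuclideanSpace ℝ (Fin p)) : Prop where
  mem : ∀ t, γ t ∈ box p M
  intervalIntegrable : ∀ j s t, IntervalIntegrable (fun r => v r j) volume s t
  sub_eq : ∀ j s t, γ t j - γ s j = ∫ r in s..t, v r j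
  velocity : ∀ᵐ t, 0 < t → HasDerivAt γ (v t) t ∧ ∀ j,
    (0 < γ t j ∧ γ t j < M ∧ v t j = -G (γ t) j) ∨ (γ t j = 0 ∧ v t j = 0 ∧ 0 ≤ G (γ t) j) ∨
      (γ t j = M ∧ v t j = 0 ∧ G (γ t) j ≤ 0)

/-- Every trajectory in the sense of the differential inclusion is one in the coordinatewise
sense. -/
theorem IsGradientFlow.exists_isBoxTrajectory (hM : 0 < M)
    (hgrad : ∀ x ∈ box p M, HasGradientWithinAt F (WithLp.toLp 2 (G x)) (box p M) x)
    {β : ℝ → EuclideanSpace ℝ (Fin p)} (h0 : β 0 = 0) (hβ : IsGradientFlow F (box p M) β) :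
    ∃ γ v : ℝ → EuclideanSpace ℝ (Fin p), (∀ t, 0 ≤ t → γ t = β t) ∧ IsBoxTrajectory M G γ v := by
  obtain ⟨v₀, hint, hβ', hinc⟩ := hβ
  -- the velocity is extended by zero to negative times
  set v : ℝ → EuclideanSpace ℝ (Fin p) := (Ioi (0 : ℝ)).indicator v₀ with hv
  have hintv0 : ∀ t, IntervalIntegrable v volume 0 t := by
    intro t
    rcases le_total 0 t with ht | ht
    · refine (intervalIntegrable_congr fun s hs => ?_).2 (hint t ht)
      rw [uIoc_of_le ht] at hs
      simp [hv, indicator_of_mem (mem_Ioi.2 hs.1)]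
    · refine (intervalIntegrable_congr (g := fun _ => 0) fun s hs => ?_).2 (by simp)
      rw [uIoc_of_ge ht] at hs
      simp [hv, not_lt.2 hs.2]
  have hintv : ∀ s t, IntervalIntegrable v volume s t := fun s t =>
    (hintv0 s).symm.trans (hintv0 t)
  set γ : ℝ → EuclideanSpace ℝ (Fin p) := fun t => ∫ s in (0 : ℝ)..t, v s with hγ
  have hγβ : ∀ t, 0 ≤ t → γ t = β t := fun t ht => by
    rw [hβ' t ht, h0, zero_add]
    refine intervalIntegral.integral_congr_ae (ae_of_all _ fun s hs => ?_)
    rw [uIoc_of_le ht] at hs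
    simp [hv, indicator_of_mem (mem_Ioi.2 hs.1)]
  have hγneg : ∀ t, t ≤ 0 → γ t = 0 := fun t ht => by
    have : ∫ s in (0 : ℝ)..t, v s = ∫ s in (0 : ℝ)..t, 0 :=
      intervalIntegral.integral_congr_ae (ae_of_all _ fun s hs => by
        rw [uIoc_of_ge ht] at hs
        simp [hv, not_lt.2 hs.2])
    simp [hγ, this]
  have hcont : Continuous γ := intervalIntegral.continuous_primitive hintv 0
  have hinc' : ∀ᵐ s, 0 < s → v s ∈ gradientInclusion F (box p M) (γ s) := by
    rw [ae_restrict_iff' measurableSet_Ici] at hinc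
    filter_upwards [hinc] with s hs hs0
    rw [hγβ s hs0.le]
    simpa [hv, indicator_of_mem (mem_Ioi.2 hs0)] using hs hs0.le
  have hmem : ∀ t, γ t ∈ box p M := by
    have hae : ∀ᵐ t, γ t ∈ box p M := by
      filter_upwards [hinc'] with t ht
      rcases le_or_gt t 0 with h | h
      · rw [hγneg t h]
        exact zero_mem_box hM
      · obtain ⟨g, w, -, hw, -⟩ := ht h
        exact hw.1
    have hd := Measure.dense_of_ae hae
    have hc : IsClosed {t | γ t ∈ box p M} := isClosed_box.preimage hcont
    intro t
    have h1 : t ∈ closure {t | γ t ∈ box p M} := by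
      rw [hd.closure_eq]
      exact mem_univ t
    rwa [hc.closure_eq] at h1
  have hloc : LocallyIntegrable v volume := by
    rw [locallyIntegrable_iff]
    intro k hk
    obtain ⟨a, ha⟩ := hk.bddBelow
    obtain ⟨b, hb⟩ := hk.bddAbove
    rcases k.eq_empty_or_nonempty with rfl | ⟨x, hx⟩
    · simp
    · have h1 := (hintv a b).1
      refine ((intervalIntegrable_iff_integrableOn_Icc_of_le ((ha hx).trans (hb hx))).1
        (hintv a b)).mono_set fun y hy => ⟨ha hy, hb hy⟩
  refine ⟨γ, v, hγβ, hmem, fun j s t => ?_, fun j s t => ?_, ?_⟩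
  · exact ⟨(EuclideanSpace.proj (𝕜 := ℝ) j : EuclideanSpace ℝ (Fin p) →L[ℝ] ℝ).integrable_comp
        (hintv s t).1,
      (EuclideanSpace.proj (𝕜 := ℝ) j : EuclideanSpace ℝ (Fin p) →L[ℝ] ℝ).integrable_comp
        (hintv s t).2⟩
  · have h1 : γ t - γ s = ∫ r in s..t, v r :=
      intervalIntegral.integral_interval_sub_left (hintv 0 t) (hintv 0 s)
    have h2 := (EuclideanSpace.proj (𝕜 := ℝ) j : EuclideanSpace ℝ (Fin p) →L[ℝ] ℝ
      ).intervalIntegral_comp_comm (hintv s t)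
    rw [← h1] at h2
    simpa using h2.symm
  · filter_upwards [hinc', LocallyIntegrable.ae_hasDerivAt_integral hloc] with t ht hd ht0
    have hd' : HasDerivAt γ (v t) t := hd 0
    refine ⟨hd', fun j => ?_⟩
    obtain ⟨g, w, hg, hw, hvt⟩ := ht ht0
    have hgG : g = WithLp.toLp 2 (G (γ t)) := by
      have := (uniqueDiffOn_box hM (γ t) (hmem t)).eq hg.hasFDerivWithinAt
        (hgrad _ (hmem t)).hasFDerivWithinAt
      exact (InnerProductSpace.toDual ℝ _).injective this
    have hvj : v t j = -G (γ t) j - w j := by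
      rw [hvt, hgG]
      simp
    have hdj : HasDerivAt (fun s => γ s j) (v t j) t :=
      (EuclideanSpace.proj (𝕜 := ℝ) j : EuclideanSpace ℝ (Fin p) →L[ℝ] ℝ).hasFDerivAt.comp_hasDerivAt
        t hd'
    have hwj := normalCone_box hw j
    rcases (hmem t j).1.eq_or_lt with h | h
    · right; left
      have hz : v t j = 0 := IsLocalMin.hasDerivAt_eq_zero (f := fun s => γ s j)
        (Eventually.of_forall fun s => by dsimp only; rw [← h]; exact (hmem s j).1) hdj
      refine ⟨h.symm, hz, ?_⟩
      have := hwj.1 (by rw [← h]; exact hM)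
      linarith
    · rcases (hmem t j).2.eq_or_lt with h' | h'
      · right; right
        have hz : v t j = 0 := IsLocalMax.hasDerivAt_eq_zero (f := fun s => γ s j)
          (Eventually.of_forall fun s => by dsimp only; rw [h']; exact (hmem s j).2) hdj
        refine ⟨h', hz, ?_⟩
        have := hwj.2 h
        linarith
      · left
        refine ⟨h, h', ?_⟩
        have h1 := hwj.1 h'
        have h2 := hwj.2 h
        linarith

/-- A continuous function which cannot reach the level `κ` as long as it has not exceeded it stays
below `κ`. -/
theorem lt_of_barrier {f : ℝ → ℝ} (hf : Continuous f) {κ s e : ℝ} (hs : f s < κ)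
    (h : ∀ T, s ≤ T → T ≤ e → (∀ t, s ≤ t → t ≤ T → f t ≤ κ) → f T < κ) {T : ℝ} (hsT : s ≤ T)
    (hTe : T ≤ e) : f T < κ := by
  by_contra! hT
  have ivt : ∀ u, s ≤ u → κ ≤ f u → ∃ t ∈ Icc s u, f t = κ := fun u hu hfu =>
    intermediate_value_Icc hu hf.continuousOn ⟨hs.le, hfu⟩
  have hcomp : IsCompact (Icc s T ∩ f ⁻¹' {κ}) :=
    isCompact_Icc.inter_right (isClosed_singleton.preimage hf)
  obtain ⟨t', ht', hft'⟩ := ivt T hsT hT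
  obtain ⟨t₀, ⟨ht₀, hft₀⟩, hmin⟩ := hcomp.exists_isLeast ⟨t', ht', hft'⟩
  have := h t₀ ht₀.1 (ht₀.2.trans hTe) fun t hst htt₀ => by
    by_contra! hlt
    obtain ⟨u, hu, hfu⟩ := ivt t hst hlt.le
    have h1 := hmin ⟨⟨hu.1, hu.2.trans (htt₀.trans ht₀.2)⟩, hfu⟩
    have h2 : u = t := le_antisymm hu.2 (htt₀.trans h1)
    rw [h2] at hfu
    exact hlt.ne' hfu
  exact this.ne hft₀

namespace IsBoxTrajectory

variable {γ v : ℝ → EuclideanSpace ℝ (Fin p)} {s t c D K : ℝ}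

theorem sub_le_of_velocity_le (h : IsBoxTrajectory M G γ v) (hst : s ≤ t) (j : Fin p)
    (hc : ∀ᵐ r, s < r → r ≤ t → v r j ≤ c) : γ t j - γ s j ≤ c * (t - s) := by
  rw [h.sub_eq]
  refine (intervalIntegral.integral_mono_ae_restrict hst (h.intervalIntegrable j s t)
    (intervalIntegrable_const (c := c)) ?_).trans_eq (by simp [mul_comm])
  rw [EventuallyLE, ae_restrict_iff' measurableSet_Icc]
  have hne : ∀ᵐ r : ℝ, r ≠ s := by simp [ae_iff, measure_singleton]
  filter_upwards [hc, hne] with r hr hrs hmem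
  exact hr (lt_of_le_of_ne hmem.1 hrs.symm) hmem.2

theorem abs_sub_le (h : IsBoxTrajectory M G γ v) (hD : ∀ x ∈ box p M, ∀ j, |G x j| ≤ D)
    (hs : 0 ≤ s) (hst : s ≤ t) (j : Fin p) : |γ t j - γ s j| ≤ D * (t - s) := by
  have hv : ∀ᵐ r, 0 < r → |v r j| ≤ D := by
    filter_upwards [h.velocity] with r hr hr0
    have hG := hD _ (h.mem r) j
    rcases (hr hr0).2 j with ⟨-, -, h1⟩ | ⟨-, h1, -⟩ | ⟨-, h1, -⟩
    · rwa [h1, abs_neg]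
    · rw [h1, abs_zero]
      exact (abs_nonneg _).trans hG
    · rw [h1, abs_zero]
      exact (abs_nonneg _).trans hG
  rw [h.sub_eq]
  have := intervalIntegral.norm_integral_le_of_norm_le_const_ae (a := s) (b := t)
    (f := fun r => v r j) (C := D) (by
      filter_upwards [hv] with r hr hmem
      rw [uIoc_of_le hst] at hmem
      exact hr (hs.trans_lt hmem.1))
  rwa [abs_of_nonneg (sub_nonneg.2 hst), Real.norm_eq_abs] at this

theorem dist1_le (h : IsBoxTrajectory M G γ v) (hD : ∀ x ∈ box p M, ∀ j, |G x j| ≤ D)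
    (hs : 0 ≤ s) (hst : s ≤ t) : dist1 (γ s).ofLp (γ t).ofLp ≤ p * (D * (t - s)) := by
  rw [dist1]
  exact (Finset.sum_le_card_nsmul _ _ _ fun j _ => h.abs_sub_le hD hs hst j).trans_eq (by simp)

/-- Energy inequality: the objective decreases along a trajectory, with rate at least `c` where
some coordinate has a squared velocity of at least `c`. -/
theorem objective_sub_le (h : IsBoxTrajectory M G γ v)
    (hgrad : ∀ x ∈ box p M, HasGradientWithinAt F (WithLp.toLp 2 (G x)) (box p M) x)
    (hD : ∀ x ∈ box p M, ∀ j, |G x j| ≤ D)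
    (hF : ∀ x ∈ box p M, ∀ y ∈ box p M, |F y - F x| ≤ K * dist1 x.ofLp y.ofLp) (hK : 0 ≤ K)
    (hD0 : 0 ≤ D) (hs : 0 ≤ s) (hst : s ≤ t)
    (hc : ∀ᵐ r, s < r → r ≤ t → ∑ j, G (γ r) j * v r j ≤ -c) :
    F (γ t) - F (γ s) ≤ -(c * (t - s)) := by
  have hlip : LipschitzOnWith (K * (p * D)).toNNReal (fun r => F (γ r)) (uIcc s t) := by
    rw [uIcc_of_le hst]
    refine LipschitzOnWith.of_dist_le_mul fun x hx y hy => ?_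
    rw [Real.coe_toNNReal _ (by positivity), Real.dist_eq, Real.dist_eq]
    wlog hxy : y ≤ x generalizing x y
    · rw [abs_sub_comm, abs_sub_comm x]
      exact this y hy x hx (le_of_not_ge hxy)
    refine (hF _ (h.mem y) _ (h.mem x)).trans ?_
    rw [abs_of_nonneg (sub_nonneg.2 hxy), mul_assoc]
    refine mul_le_mul_of_nonneg_left ?_ hK
    rw [mul_assoc]
    exact h.dist1_le hD (hs.trans hy.1) hxy
  have hac := hlip.absolutelyContinuousOnInterval
  rw [← hac.integral_deriv_eq_sub]
  refine (intervalIntegral.integral_mono_ae_restrict hst hac.intervalIntegrable_deriv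
    (intervalIntegrable_const (c := -c)) ?_).trans_eq (by simp [mul_comm])
  rw [EventuallyLE, ae_restrict_iff' measurableSet_Icc]
  have hne : ∀ᵐ r : ℝ, r ≠ s := by simp [ae_iff, measure_singleton]
  filter_upwards [hc, hne, h.velocity] with r hr hrs hvel hmem
  have hr1 : s < r := lt_of_le_of_ne hmem.1 hrs.symm
  have hd := (hvel (hs.trans_lt hr1)).1
  have hcomp : HasDerivAt (fun r => F (γ r)) (⟪WithLp.toLp 2 (G (γ r)), v r⟫) r := by
    have := (hgrad _ (h.mem r)).hasFDerivWithinAt.comp_hasDerivAt r hd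
      (Eventually.of_forall h.mem)
    rw [InnerProductSpace.toDual_apply_apply] at this
    exact this
  rw [hcomp.deriv]
  refine le_trans (le_of_eq ?_) (hr hr1 hmem.2)
  simp [PiLp.inner_apply, mul_comm]

theorem sum_mul_velocity_le (h : IsBoxTrajectory M G γ v) :
    ∀ᵐ r, 0 < r → ∀ j, ∑ i, G (γ r) i * v r i ≤ -(v r j) ^ 2 := by
  filter_upwards [h.velocity] with r hr hr0 j
  have hi : ∀ i, G (γ r) i * v r i = -(v r i) ^ 2 := fun i => by
    rcases (hr hr0).2 i with ⟨-, -, h1⟩ | ⟨-, h1, -⟩ | ⟨-, h1, -⟩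
    · rw [h1]; ring
    · rw [h1]; ring
    · rw [h1]; ring
  simp only [hi, Finset.sum_neg_distrib]
  exact neg_le_neg (Finset.single_le_sum (f := fun i => v r i ^ 2) (fun i _ => sq_nonneg _)
    (Finset.mem_univ j))

end IsBoxTrajectory

/-- Selection along a trajectory. The coordinate `l₀` with a steep initial slope makes the objective
drop by `(g₀ / 2)² t₁` until time `t₁`, during which the coordinates outside `S` stay of total size
below `κ`; afterwards the partial derivatives outside `S` are at least `ρ`, so that these
coordinates are driven to zero. -/
theorem IsBoxTrajectory.supp_subset {γ v : ℝ → EuclideanSpace ℝ (Fin p)}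
    (h : IsBoxTrajectory M G γ v) (hγ0 : γ 0 = 0) {D K L g₀ t₁ A κ ρ : ℝ}
    (hgrad : ∀ x ∈ box p M, HasGradientWithinAt F (WithLp.toLp 2 (G x)) (box p M) x)
    (hD : ∀ x ∈ box p M, ∀ j, |G x j| ≤ D)
    (hF : ∀ x ∈ box p M, ∀ y ∈ box p M, |F y - F x| ≤ K * dist1 x.ofLp y.ofLp) (hK : 0 ≤ K)
    (hL : ∀ x ∈ box p M, ∀ y ∈ box p M, ∀ j, |G y j - G x j| ≤ L * dist1 x.ofLp y.ofLp)
    (hL0 : 0 ≤ L) {S : Finset (Fin p)} {l₀ : Fin p} (hg₀ : 0 < g₀) (hl₀ : G 0 l₀ ≤ -g₀)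
    (ht₁ : 0 < t₁) (hLt₁ : L * (p * (D * t₁)) ≤ g₀ / 2) (hDt₁ : D * t₁ < M)
    (hA : 0 ≤ A) (hκ : 0 < κ) (hAκ : p * (A * t₁) < κ) (hρ : 0 < ρ)
    (hphase1 : ∀ x ∈ box p M, ∑ l ∈ Sᶜ, x l ≤ κ → ∀ l ∈ Sᶜ, -A ≤ G x l)
    (hphase2 : ∀ x ∈ box p M, ∑ l ∈ Sᶜ, x l ≤ κ → F x ≤ F 0 - (g₀ / 2) ^ 2 * t₁ →
      ∀ l ∈ Sᶜ, ρ ≤ G x l) {t : ℝ} (ht : t₁ + κ / ρ ≤ t) :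
    (supp (γ t)).Nonempty ∧ supp (γ t) ⊆ S := by
  have hD0 : 0 ≤ D := (abs_nonneg _).trans (hD _ (h.mem 0) l₀)
  have htt₁ : t₁ ≤ t := by
    have : 0 ≤ κ / ρ := by positivity
    linarith
  -- decrease of the objective in the first phase
  have hdrop : F (γ t₁) - F (γ 0) ≤ -((g₀ / 2) ^ 2 * (t₁ - 0)) := by
    refine h.objective_sub_le hgrad hD hF hK hD0 le_rfl ht₁.le ?_
    filter_upwards [h.velocity, h.sum_mul_velocity_le] with r hr hsum hr0 hrt
    have h1 := hL _ (h.mem 0) _ (h.mem r) l₀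
    have h2 := h.dist1_le hD le_rfl hr0.le
    have h3 : L * dist1 (γ 0).ofLp (γ r).ofLp ≤ g₀ / 2 := by
      refine (mul_le_mul_of_nonneg_left (h2.trans ?_) hL0).trans hLt₁
      rw [sub_zero]
      gcongr
    have h4 : G (γ r) l₀ ≤ -(g₀ / 2) := by
      rw [hγ0] at h1 h3
      linarith [(abs_le.1 (h1.trans h3)).2]
    have h5 : g₀ / 2 ≤ v r l₀ := by
      rcases (hr hr0).2 l₀ with ⟨-, -, hv⟩ | ⟨-, -, hG⟩ | ⟨hM, -, -⟩
      · linarith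
      · linarith
      · have h6 := h.abs_sub_le hD le_rfl hr0.le l₀
        rw [hγ0, hM] at h6
        have h7 : D * (r - 0) ≤ D * t₁ := by rw [sub_zero]; gcongr
        have h8 := (le_abs_self _).trans h6
        simp at h8
        linarith
    have h6 := hsum hr0 l₀
    nlinarith
  have hdec : ∀ r, t₁ ≤ r → F (γ r) ≤ F 0 - (g₀ / 2) ^ 2 * t₁ := fun r hr => by
    have := h.objective_sub_le (c := 0) hgrad hD hF hK hD0 ht₁.le hr (by
      filter_upwards [h.sum_mul_velocity_le] with u hu hu0 _
      have := hu (ht₁.trans hu0) l₀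
      nlinarith [sq_nonneg (v u l₀)])
    rw [hγ0] at hdrop
    linarith
  have hcont : Continuous fun r => ∑ l ∈ Sᶜ, γ r l := by
    have hγj : ∀ j, Continuous fun r => γ r j := fun j => by
      have := intervalIntegral.continuous_primitive (h.intervalIntegrable j) 0
      refine (this.add (continuous_const (y := γ 0 j))).congr fun r => ?_
      simp only [Pi.add_apply]
      rw [← h.sub_eq j 0 r]
      ring
    exact continuous_finsetSum _ fun j _ => hγj j
  -- growth of the noise coordinates in the first phase
  have hone : ∀ T, 0 ≤ T → T ≤ t₁ → ∑ l ∈ Sᶜ, γ T l < κ := by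
    intro T hT hTt
    refine lt_of_barrier hcont (s := 0) (e := t₁) (by simpa [hγ0] using hκ) ?_ hT hTt
    intro T hT hTt hle
    have h1 : ∀ l ∈ Sᶜ, γ T l ≤ A * t₁ := fun l hl => by
      have := h.sub_le_of_velocity_le (c := A) hT l (by
        filter_upwards [h.velocity] with r hr hr0 hrT
        have hG := hphase1 _ (h.mem r) (hle r hr0.le hrT) l hl
        rcases (hr hr0).2 l with ⟨-, -, hv⟩ | ⟨-, hv, -⟩ | ⟨-, hv, -⟩ <;> linarith)
      rw [hγ0] at this
      have h2 : A * (T - 0) ≤ A * t₁ := by rw [sub_zero]; gcongr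
      simp at this
      linarith
    refine lt_of_le_of_lt ((Finset.sum_le_card_nsmul _ _ _ h1).trans ?_) hAκ
    rw [nsmul_eq_mul]
    have : (Sᶜ.card : ℝ) ≤ p := by
      exact_mod_cast (Finset.card_le_univ _).trans_eq (Fintype.card_fin p)
    gcongr
  have htwo : ∀ T, t₁ ≤ T → ∑ l ∈ Sᶜ, γ T l < κ := by
    intro T hT
    refine lt_of_barrier hcont (s := t₁) (e := T) (hone t₁ ht₁.le le_rfl) ?_ hT le_rfl
    intro T hT _ hle
    refine lt_of_le_of_lt (Finset.sum_le_sum fun l hl => ?_) (hone t₁ ht₁.le le_rfl)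
    have := h.sub_le_of_velocity_le (c := 0) hT l (by
      filter_upwards [h.velocity] with r hr hr0 hrT
      have hG := hphase2 _ (h.mem r) (hle r hr0.le hrT) (hdec r hr0.le) l hl
      rcases (hr (ht₁.trans hr0)).2 l with ⟨-, -, hv⟩ | ⟨-, hv, -⟩ | ⟨-, hv, -⟩ <;> linarith)
    linarith
  constructor
  · by_contra hne
    have hz : γ t = 0 := by
      ext j
      by_contra hj
      exact hne ⟨j, hj⟩
    have := hdec t htt₁
    rw [hz] at this
    have : 0 < (g₀ / 2) ^ 2 * t₁ := by positivity
    linarith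
  · intro l hl
    by_contra hlS
    have hlS' : l ∈ Sᶜ := Finset.mem_compl.2 hlS
    have hl0 : γ t l ≠ 0 := hl
    have hlpos : 0 < γ t l := lt_of_le_of_ne (h.mem t l).1 hl0.symm
    have hG : ∀ r, t₁ ≤ r → ρ ≤ G (γ r) l := fun r hr =>
      hphase2 _ (h.mem r) (htwo r hr).le (hdec r hr) l hlS'
    have hmono : ∀ s, t₁ ≤ s → s ≤ t → γ t l ≤ γ s l := fun s hs hst => by
      have := h.sub_le_of_velocity_le (c := 0) hst l (by
        filter_upwards [h.velocity] with r hr hr0 hrT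
        have hG := hG r (hs.trans hr0.le)
        rcases (hr (ht₁.trans_le (hs.trans hr0.le))).2 l with
          ⟨-, -, hv⟩ | ⟨-, hv, -⟩ | ⟨-, hv, -⟩ <;> linarith)
      linarith
    have hfall := h.sub_le_of_velocity_le (c := -ρ) htt₁ l (by
      filter_upwards [h.velocity] with r hr hr0 hrT
      have hG := hG r hr0.le
      have hpos := hlpos.trans_le (hmono r hr0.le hrT)
      rcases (hr (ht₁.trans hr0)).2 l with ⟨-, -, hv⟩ | ⟨hv, -, -⟩ | ⟨-, -, hv⟩ <;> linarith)
    have h1 : γ t₁ l < κ := lt_of_le_of_lt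
      (Finset.single_le_sum (f := fun l => γ t₁ l) (fun i _ => (h.mem t₁ i).1) hlS')
      (hone t₁ ht₁.le le_rfl)
    have h2 : κ ≤ ρ * (t - t₁) := by
      rw [mul_comm, ← div_le_iff₀ hρ]
      linarith
    linarith

end Trajectory

/-! ### The energy distance and main effects -/

section Energy

open Filter Topology Set

variable {Ω : Type*} [MeasurableSpace Ω] {Q : Measure Ω} [IsProbabilityMeasure Q] {X Y : Ω → ℝ}
  {K : ℝ}

/-- `|x - y|` is the integral over thresholds `s` of the squared difference of the indicators of
`x ≤ s` and `y ≤ s`. -/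
theorem setIntegral_indicator_Ici {x y : ℝ} (hx : |x| ≤ K) (hy : |y| ≤ K) :
    ∫ s in Icc (-K) K, ((Ici x).indicator 1 s + (Ici y).indicator 1 s
      - 2 * ((Ici x).indicator 1 s * (Ici y).indicator 1 s) : ℝ) = |x - y| := by
  wlog hxy : x ≤ y generalizing x y
  · rw [abs_sub_comm, ← this hy hx (le_of_not_ge hxy)]
    refine integral_congr_ae (ae_of_all _ fun s => ?_)
    dsimp only
    ring
  have h1 := abs_le.1 hx
  have h2 := abs_le.1 hy
  have e : ∀ s : ℝ, ((Ici x).indicator 1 s + (Ici y).indicator 1 s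
      - 2 * ((Ici x).indicator 1 s * (Ici y).indicator 1 s) : ℝ) = (Ico x y).indicator 1 s := by
    intro s
    simp only [indicator_apply, mem_Ici, mem_Ico, Pi.one_apply]
    by_cases hs : x ≤ s <;> by_cases hs' : y ≤ s
    · simp [hs, hs', not_lt.2 hs']; norm_num
    · simp [hs, hs', lt_of_not_ge hs']
    · exact absurd (hxy.trans hs') hs
    · simp [hs, hs']
  simp only [e]
  have hsub : Ico x y ⊆ Icc (-K) K := fun s hs => ⟨by linarith [hs.1], by linarith [hs.2]⟩
  rw [integral_indicator_one measurableSet_Ico, measureReal_restrict_apply measurableSet_Ico,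
    inter_eq_left.2 hsub, Measure.real,
    Real.volume_Ico, ENNReal.toReal_ofReal (by linarith), abs_sub_comm, abs_of_nonneg (by linarith)]

/-- For a centred `Y`, the quantity `E[Y Y' |X - X'|]` is `-2 ∫ E[Y 1{X ≤ s}]² ds`. -/
theorem pairing_abs_sub_eq (hX : Measurable X) (hXb : ∀ᵐ z ∂Q, |X z| ≤ K) (hY : Integrable Y Q)
    (hY0 : ∫ z, Y z ∂Q = 0) :
    pairing Q (fun z z' => |X z - X z'|) Y Y
      = -(2 * ∫ s in Icc (-K) K, (∫ z, Y z * (Ici (X z)).indicator 1 s ∂Q) ^ 2) := by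
  set ν : Measure ℝ := volume.restrict (Icc (-K) K) with hν
  let I : Ω → ℝ → ℝ := fun z s => (Ici (X z)).indicator 1 s
  have hIm : Measurable fun q : Ω × ℝ => I q.1 q.2 := by
    have : (fun q : Ω × ℝ => I q.1 q.2) = {q : Ω × ℝ | X q.1 ≤ q.2}.indicator 1 := by
      ext q
      simp [I, indicator_apply]
    rw [this]
    exact measurable_one.indicator (measurableSet_le (by fun_prop) (by fun_prop))
  have hIb : ∀ z s, |I z s| ≤ 1 := fun z s => by
    simp only [I, indicator_apply]
    split_ifs <;> simp
  have hYI : ∀ s, Integrable (fun z => Y z * I z s) Q := fun s =>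
    hY.mul_bdd (c := 1) (hIm.comp measurable_prodMk_right).aestronglyMeasurable
      (ae_of_all _ fun z => hIb z s)
  let J : Ω × Ω → ℝ → ℝ := fun q s => I q.1 s + I q.2 s - 2 * (I q.1 s * I q.2 s)
  have hJm : Measurable fun r : (Ω × Ω) × ℝ => J r.1 r.2 := by
    have h1 : Measurable fun r : (Ω × Ω) × ℝ => I r.1.1 r.2 :=
      hIm.comp (f := fun r : (Ω × Ω) × ℝ => (r.1.1, r.2)) (by fun_prop)
    have h2 : Measurable fun r : (Ω × Ω) × ℝ => I r.1.2 r.2 :=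
      hIm.comp (f := fun r : (Ω × Ω) × ℝ => (r.1.2, r.2)) (by fun_prop)
    exact (h1.add h2).sub ((h1.mul h2).const_mul 2)
  have hJb : ∀ q s, |J q s| ≤ 4 := fun q s => by
    have h1 := hIb q.1 s
    have h2 := hIb q.2 s
    have h3 : |I q.1 s * I q.2 s| ≤ 1 := by
      rw [abs_mul]
      exact mul_le_one₀ h1 (abs_nonneg _) h2
    rw [abs_le] at h1 h2 h3 ⊢
    constructor <;> simp only [J] <;> linarith
  have hint : Integrable (fun r : (Ω × Ω) × ℝ => (Y r.1.1 * Y r.1.2) * J r.1 r.2)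
      ((Q.prod Q).prod ν) :=
    ((hY.mul_prod hY).comp_fst ν).mul_bdd (c := 4) hJm.aestronglyMeasurable
      (ae_of_all _ fun r => hJb _ _)
  have e1 : pairing Q (fun z z' => |X z - X z'|) Y Y
      = ∫ q, ∫ s, (Y q.1 * Y q.2) * J q s ∂ν ∂(Q.prod Q) := by
    rw [pairing]
    refine integral_congr_ae ?_
    filter_upwards [ae_prod_mem (P := Q) (D := {z | |X z| ≤ K}) hXb] with q hq
    rw [integral_const_mul, setIntegral_indicator_Ici hq.1 hq.2]
  rw [e1, integral_integral_swap hint, ← integral_const_mul, ← integral_neg]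
  refine integral_congr_ae (ae_of_all _ fun s => ?_)
  dsimp only
  have i1 : Integrable (fun q : Ω × Ω => (Y q.1 * I q.1 s) * Y q.2) (Q.prod Q) :=
    (hYI s).mul_prod hY
  have i2 : Integrable (fun q : Ω × Ω => Y q.1 * (Y q.2 * I q.2 s)) (Q.prod Q) :=
    hY.mul_prod (hYI s)
  have i3 : Integrable (fun q : Ω × Ω => (Y q.1 * I q.1 s) * (Y q.2 * I q.2 s)) (Q.prod Q) :=
    (hYI s).mul_prod (hYI s)
  have i12 : Integrable (fun q : Ω × Ω => (Y q.1 * I q.1 s) * Y q.2 + Y q.1 * (Y q.2 * I q.2 s))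
    (Q.prod Q) := i1.add i2
  have e2 : ∫ q, (Y q.1 * Y q.2) * J q s ∂(Q.prod Q)
      = ∫ q, ((Y q.1 * I q.1 s) * Y q.2 + Y q.1 * (Y q.2 * I q.2 s)
        - 2 * ((Y q.1 * I q.1 s) * (Y q.2 * I q.2 s))) ∂(Q.prod Q) := by
    refine integral_congr_ae (ae_of_all _ fun q => ?_)
    simp only [J]
    ring
  rw [e2, integral_sub i12 (i3.const_mul 2), integral_add i1 i2, integral_const_mul,
    integral_prod_mul (fun z => Y z * I z s) Y, integral_prod_mul Y (fun z => Y z * I z s),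
    integral_prod_mul (fun z => Y z * I z s) (fun z => Y z * I z s), hY0]
  simp only [I]
  ring

/-- If the energy distance does not detect a dependence of a centred `Y` on `X`, then `Y` integrates
to zero over every event determined by `X`. -/
theorem setIntegral_preimage_eq_zero (hX : Measurable X) (hXb : ∀ᵐ z ∂Q, |X z| ≤ K)
    (hY : Integrable Y Q) (hY0 : ∫ z, Y z ∂Q = 0)
    (h : 0 ≤ pairing Q (fun z z' => |X z - X z'|) Y Y) {t : Set ℝ} (ht : MeasurableSet t) :
    ∫ z in X ⁻¹' t, Y z ∂Q = 0 := by
  rw [pairing_abs_sub_eq hX hXb hY hY0] at h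
  set g : ℝ → ℝ := fun s => ∫ z, Y z * (Ici (X z)).indicator 1 s ∂Q with hg
  have hgind : ∀ s, g s = ∫ z in X ⁻¹' Iic s, Y z ∂Q := fun s => by
    rw [← integral_indicator (hX measurableSet_Iic)]
    refine integral_congr_ae (ae_of_all _ fun z => ?_)
    by_cases hz : X z ≤ s <;> simp [hz]
  have hbd : ∀ s z, ‖Y z * (Ici (X z)).indicator 1 s‖ ≤ ‖Y z‖ := fun s z => by
    rw [norm_mul]
    refine mul_le_of_le_one_right (norm_nonneg _) ?_
    simp only [indicator_apply]
    split_ifs <;> simp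
  have hmeas : ∀ s, AEStronglyMeasurable (fun z => Y z * (Ici (X z)).indicator 1 s) Q := fun s => by
    have : (fun z => (Ici (X z)).indicator (1 : ℝ → ℝ) s) = (X ⁻¹' Iic s).indicator 1 := by
      ext z
      by_cases hz : X z ≤ s <;> simp [hz]
    refine hY.1.mul ?_
    rw [this]
    exact (measurable_one.indicator (hX measurableSet_Iic)).aestronglyMeasurable
  have hright : ∀ s, ContinuousWithinAt g (Ici s) s := fun s => by
    refine continuousWithinAt_of_dominated (Eventually.of_forall hmeas)
      (Eventually.of_forall fun u => ae_of_all _ (hbd u)) hY.norm (ae_of_all _ fun z => ?_)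
    refine continuousWithinAt_const.mul ?_
    rcases le_or_gt (X z) s with hz | hz
    · refine (continuousWithinAt_const (b := (1 : ℝ))).congr (fun u hu => ?_) ?_
      · simp [hz.trans hu]
      · simp [hz]
    · refine (continuousWithinAt_const (b := (0 : ℝ))).congr_of_eventuallyEq ?_ ?_
      · filter_upwards [mem_nhdsWithin_of_mem_nhds (Iio_mem_nhds hz)] with u hu
        have : ¬ X z ≤ u := not_le.2 hu
        simp [this]
      · simp [hz]
  have hout1 : ∀ s, s < -K → g s = 0 := fun s hs => by
    rw [hg]
    refine integral_eq_zero_of_ae ?_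
    filter_upwards [hXb] with z hz
    have : ¬ X z ≤ s := by linarith [(abs_le.1 hz).1]
    simp [this]
  have hout2 : ∀ s, K ≤ s → g s = 0 := fun s hs => by
    rw [← hY0]
    refine integral_congr_ae ?_
    filter_upwards [hXb] with z hz
    have : X z ≤ s := by linarith [(abs_le.1 hz).2]
    simp [this]
  have hgb : ∀ s, |g s| ≤ ∫ z, ‖Y z‖ ∂Q := fun s =>
    norm_integral_le_of_norm_le hY.norm (ae_of_all _ (hbd s))
  have hgm : AEStronglyMeasurable g (volume.restrict (Icc (-K) K)) := by
    have hm : Measurable fun q : ℝ × Ω => (Ici (X q.2)).indicator (1 : ℝ → ℝ) q.1 := by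
      have : (fun q : ℝ × Ω => (Ici (X q.2)).indicator (1 : ℝ → ℝ) q.1)
          = {q : ℝ × Ω | X q.2 ≤ q.1}.indicator 1 := by
        ext q
        simp [indicator_apply]
      rw [this]
      exact measurable_one.indicator (measurableSet_le (by fun_prop) (by fun_prop))
    exact (hY.1.comp_snd.mul hm.aestronglyMeasurable).integral_prod_right'
  have hint : Integrable (fun s => g s ^ 2) (volume.restrict (Icc (-K) K)) := by
    refine Integrable.of_bound (hgm.pow 2) ((∫ z, ‖Y z‖ ∂Q) ^ 2) (ae_of_all _ fun s => ?_)
    rw [norm_pow]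
    exact pow_le_pow_left₀ (norm_nonneg _) (hgb s) 2
  have hzero : ∀ᵐ s, g s = 0 := by
    have h1 : ∫ s in Icc (-K) K, g s ^ 2 = 0 :=
      le_antisymm (by linarith) (integral_nonneg fun s => sq_nonneg _)
    rw [integral_eq_zero_iff_of_nonneg (fun s => sq_nonneg _) hint, EventuallyEq,
      ae_restrict_iff' measurableSet_Icc] at h1
    filter_upwards [h1] with s hs
    by_cases hmem : s ∈ Icc (-K) K
    · simpa using hs hmem
    · rcases lt_or_ge s (-K) with h2 | h2
      · exact hout1 s h2
      · exact hout2 s (le_of_not_ge fun h3 => hmem ⟨h2, h3⟩)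
  have hall : ∀ s, g s = 0 := fun s => by
    by_contra hne
    have h1 : ∀ᶠ u in 𝓝[>] s, g u ≠ 0 :=
      ((hright s).mono Ioi_subset_Ici_self).eventually_ne hne
    obtain ⟨e, he, hsub⟩ := (mem_nhdsGT_iff_exists_Ioo_subset).1 h1
    have h2 : volume (Ioo s e) = 0 := measure_mono_null hsub (by simpa using ae_iff.1 hzero)
    rw [Real.volume_Ioo, ENNReal.ofReal_eq_zero] at h2
    exact absurd (mem_Ioi.1 he) (not_lt.2 (by linarith))
  refine MeasurableSpace.induction_on_inter
    (C := fun t _ => ∫ z in X ⁻¹' t, Y z ∂Q = 0)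
    ((BorelSpace.measurable_eq (α := ℝ)).trans (borel_eq_generateFrom_Iic ℝ)) isPiSystem_Iic
    (by simp) ?_ ?_ ?_ t ht
  · rintro _ ⟨s, rfl⟩
    rw [← hgind, hall]
  · intro t ht hzt
    have := integral_add_compl (hX ht) hY
    rw [hzt, hY0, zero_add] at this
    exact this
  · intro f hdisj hf hzf
    rw [preimage_iUnion, integral_iUnion (fun i => hX (hf i))
      (fun i j hij => (hdisj hij).preimage X) hY.integrableOn]
    simp [hzf]

end Energy

/-! ### The population gradient -/

section Population

variable {p : ℕ} {μ : Measure ℝ} {a b MX MY lam : ℝ} {Q : Measure ((Fin p → ℝ) × ℝ)}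
  {S : Finset (Fin p)} {l : Fin p} {w : Fin p → ℝ}

theorem measurable_eval_fst (l : Fin p) : Measurable fun z : (Fin p → ℝ) × ℝ => z.1 l :=
  (measurable_pi_apply l).comp measurable_fst

theorem IsSignalCandidate.integral_mul (hS : IsSignalCandidate Q S) (hl : l ∉ S)
    {u : (Fin p → ℝ) × ℝ → ℝ} (hu : Measurable[MeasurableSpace.comap
      (fun z : (Fin p → ℝ) × ℝ => S.restrict z.1) inferInstance] u)
    {φ : ℝ → ℝ} (hφ : Measurable φ) :
    ∫ z, u z * φ (z.1 l) ∂Q = (∫ z, u z ∂Q) * ∫ z, φ (z.1 l) ∂Q := by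
  have hr : Measurable fun z : (Fin p → ℝ) × ℝ => S.restrict z.1 :=
    (Finset.measurable_restrict _).comp measurable_fst
  have hind : IndepFun u (fun z => φ (z.1 l)) Q := by
    have h0 := hS.indep
    rw [IndepFun_iff_Indep] at h0 ⊢
    refine indep_of_indep_of_le_left (indep_of_indep_of_le_right h0 ?_) hu.comap_le
    have : (fun z : (Fin p → ℝ) × ℝ => φ (z.1 l)) = (fun x : (Sᶜ : Finset (Fin p)) → ℝ =>
        φ (x ⟨l, Finset.mem_compl.2 hl⟩)) ∘ fun z : (Fin p → ℝ) × ℝ => Sᶜ.restrict z.1 := rfl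
    rw [this]
    exact ((hφ.comp (measurable_pi_apply _)).comp (comap_measurable _)).comap_le
  exact hind.integral_fun_mul_eq_mul_integral
    (hu.mono hr.comap_le le_rfl).aestronglyMeasurable
    (hφ.comp (measurable_eval_fst l)).aestronglyMeasurable

variable [IsProbabilityMeasure Q]

/-- A main effect is detected by the energy distance. -/
theorem pairing_neg_of_mem_mainEffects (hQ : ∀ᵐ z ∂Q, z ∈ dataBox p MX MY)
    (hQ0 : ∫ z, z.2 ∂Q = 0) (hl : l ∈ mainEffects Q S) :
    pairing Q (fun z z' => |z.1 l - z'.1 l|) (fun z => z.2) (fun z => z.2) < 0 := by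
  by_contra! h
  refine hl.2 ?_
  have hXb : ∀ᵐ z ∂Q, |z.1 l| ≤ MX := by
    filter_upwards [hQ] with z hz using hz.1 l
  have key := fun {t : Set ℝ} (ht : MeasurableSet t) =>
    setIntegral_preimage_eq_zero (measurable_eval_fst l) hXb (integrable_snd hQ) hQ0 h ht
  have hr : Measurable fun z : (Fin p → ℝ) × ℝ => ({l} : Finset (Fin p)).restrict z.1 :=
    (Finset.measurable_restrict _).comp measurable_fst
  have hzero : (0 : (Fin p → ℝ) × ℝ → ℝ) =ᵐ[Q] regression Q {l} := by
    refine ae_eq_condExp_of_forall_setIntegral_eq hr.comap_le (integrable_snd hQ)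
      (fun _ _ _ => integrableOn_zero) (fun s hs _ => ?_) aestronglyMeasurable_zero
    obtain ⟨t, ht, rfl⟩ := hs
    have e : (fun z : (Fin p → ℝ) × ℝ => ({l} : Finset (Fin p)).restrict z.1) ⁻¹' t
        = (fun z : (Fin p → ℝ) × ℝ => z.1 l) ⁻¹' ((fun r : ℝ => fun _ => r) ⁻¹' t) := by
      ext z
      have : ({l} : Finset (Fin p)).restrict z.1 = fun _ => z.1 l := by
        funext i
        have : i.1 = l := Finset.mem_singleton.1 i.2
        simp [Finset.restrict, this]
      simp only [Set.mem_preimage, this]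
    rw [e, key (t := (fun r : ℝ => fun _ => r) ⁻¹' t)
      ((measurable_pi_lambda _ fun _ => measurable_id) ht)]
    simp
  rw [variance_congr hzero.symm, variance_zero]

/-- A function on `ℝ^p` which depends only on the coordinates in `S`. -/
def DependsOnly (S : Finset (Fin p)) (g : (Fin p → ℝ) → ℝ) : Prop :=
  ∀ x y : Fin p → ℝ, (∀ j ∈ S, x j = y j) → g x = g y

theorem DependsOnly.measurable_comap {g : (Fin p → ℝ) → ℝ} (hg : DependsOnly S g)
    (hgm : Measurable g) :
    Measurable[MeasurableSpace.comap (fun z : (Fin p → ℝ) × ℝ => S.restrict z.1) inferInstance]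
      fun z : (Fin p → ℝ) × ℝ => g z.1 := by
  classical
  let ext : (S → ℝ) → Fin p → ℝ := fun x j => if h : j ∈ S then x ⟨j, h⟩ else 0
  have hext : Measurable ext := measurable_pi_lambda _ fun j => by
    by_cases h : j ∈ S
    · simpa [ext, h] using measurable_pi_apply _
    · simp [ext, h]
  have e : (fun z : (Fin p → ℝ) × ℝ => g z.1)
      = (g ∘ ext) ∘ fun z : (Fin p → ℝ) × ℝ => S.restrict z.1 := by
    funext z
    refine hg _ _ fun j hj => ?_
    simp [ext, hj]
  rw [e]
  exact (hgm.comp hext).comp (comap_measurable _)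

/-- A function of a coordinate outside `S` is uncorrelated with the product of the response and a
function of the coordinates in `S`: the response may be replaced by `E[Y | X_S]`. -/
theorem integral_snd_mul_mul (hQ : ∀ᵐ z ∂Q, z ∈ dataBox p MX MY) (hS : IsSignalCandidate Q S)
    (hl : l ∉ S) {g : (Fin p → ℝ) → ℝ} (hg : DependsOnly S g) (hgm : Measurable g) {c d : ℝ}
    (hgc : ∀ᵐ z ∂Q, |g z.1| ≤ c) {φ : ℝ → ℝ} (hφ : Measurable φ)
    (hφd : ∀ᵐ z ∂Q, |φ (z.1 l)| ≤ d) :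
    ∫ z, z.2 * g z.1 * φ (z.1 l) ∂Q = (∫ z, z.2 * g z.1 ∂Q) * ∫ z, φ (z.1 l) ∂Q := by
  have hYi := integrable_snd hQ
  -- conditioning on all features replaces the response by its regression on `S`
  have hcond : ∀ u : (Fin p → ℝ) → ℝ, Measurable u → ∀ c, (∀ᵐ z ∂Q, |u z.1| ≤ c) →
      ∫ z, z.2 * u z.1 ∂Q = ∫ z, regression Q S z * u z.1 ∂Q := by
    intro u hu c hc
    have hr : Measurable fun z : (Fin p → ℝ) × ℝ => (Finset.univ : Finset (Fin p)).restrict z.1 :=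
      (Finset.measurable_restrict _).comp measurable_fst
    have hum := (DependsOnly.measurable_comap (S := Finset.univ) (g := u)
      (fun x y h => by rw [funext fun j => h j (Finset.mem_univ j)]) hu).stronglyMeasurable
    have h1 := condExp_stronglyMeasurable_mul_of_bound hr.comap_le hum hYi c hc
    rw [← integral_condExp hr.comap_le (f := fun z => z.2 * u z.1)]
    refine integral_congr_ae ?_
    have h2 : (fun z : (Fin p → ℝ) × ℝ => z.2 * u z.1)
        = (fun z => u z.1) * fun z : (Fin p → ℝ) × ℝ => z.2 := by
      funext z
      simp [mul_comm]
    rw [h2]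
    filter_upwards [h1, hS.regression_eq] with z hz hz'
    rw [hz, Pi.mul_apply, mul_comm, ← hz', regression]
  have hgφ : ∀ᵐ z ∂Q, |g z.1 * φ (z.1 l)| ≤ c * d := by
    filter_upwards [hgc, hφd] with z h1 h2
    rw [abs_mul]
    exact mul_le_mul h1 h2 (abs_nonneg _) ((abs_nonneg _).trans h1)
  have e1 := hcond (fun x => g x * φ (x l)) (by fun_prop) _ hgφ
  have e2 := hcond g hgm _ hgc
  simp only [← mul_assoc] at e1
  rw [e1, e2]
  have hρ : Measurable[MeasurableSpace.comap
      (fun z : (Fin p → ℝ) × ℝ => S.restrict z.1) inferInstance] (regression Q S) :=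
    stronglyMeasurable_condExp.measurable
  exact hS.integral_mul hl (hρ.mul (hg.measurable_comap hgm)) hφ

/-- The decoupling of a residual `y - f(x)`, with `f` a function of the coordinates in `S`. -/
theorem integral_residual_mul_mul (hQ : ∀ᵐ z ∂Q, z ∈ dataBox p MX MY)
    (hS : IsSignalCandidate Q S) (hl : l ∉ S) {f g : (Fin p → ℝ) → ℝ} (hf : DependsOnly S f)
    (hfm : Measurable f) {c c' d : ℝ} (hfc : ∀ᵐ z ∂Q, |f z.1| ≤ c') (hg : DependsOnly S g)
    (hgm : Measurable g) (hgc : ∀ᵐ z ∂Q, |g z.1| ≤ c) {φ : ℝ → ℝ} (hφ : Measurable φ)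
    (hφd : ∀ᵐ z ∂Q, |φ (z.1 l)| ≤ d) :
    ∫ z, (z.2 - f z.1) * (g z.1 * φ (z.1 l)) ∂Q
      = (∫ z, (z.2 - f z.1) * g z.1 ∂Q) * ∫ z, φ (z.1 l) ∂Q := by
  have hYi := integrable_snd hQ
  have hfi : Integrable (fun z : (Fin p → ℝ) × ℝ => f z.1) Q :=
    Integrable.of_bound (hfm.comp measurable_fst).aestronglyMeasurable c' hfc
  have hga : AEStronglyMeasurable (fun z : (Fin p → ℝ) × ℝ => g z.1) Q :=
    (hgm.comp measurable_fst).aestronglyMeasurable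
  have hφa : AEStronglyMeasurable (fun z : (Fin p → ℝ) × ℝ => φ (z.1 l)) Q :=
    (hφ.comp (measurable_eval_fst l)).aestronglyMeasurable
  have i1 : Integrable (fun z : (Fin p → ℝ) × ℝ => z.2 * g z.1) Q := hYi.mul_bdd hga hgc
  have i2 : Integrable (fun z : (Fin p → ℝ) × ℝ => f z.1 * g z.1) Q := hfi.mul_bdd hga hgc
  have i3 : Integrable (fun z : (Fin p → ℝ) × ℝ => z.2 * g z.1 * φ (z.1 l)) Q :=
    i1.mul_bdd hφa hφd
  have i4 : Integrable (fun z : (Fin p → ℝ) × ℝ => f z.1 * g z.1 * φ (z.1 l)) Q :=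
    i2.mul_bdd hφa hφd
  have e1 := integral_snd_mul_mul hQ hS hl hg hgm hgc hφ hφd
  have e2 := hS.integral_mul hl ((hf.measurable_comap hfm).mul (hg.measurable_comap hgm)) hφ
  simp only [Pi.mul_apply] at e2
  have e3 : ∫ z, (z.2 - f z.1) * (g z.1 * φ (z.1 l)) ∂Q
      = ∫ z, (z.2 * g z.1 * φ (z.1 l) - f z.1 * g z.1 * φ (z.1 l)) ∂Q :=
    integral_congr_ae (ae_of_all _ fun z => by ring)
  have e4 : ∫ z, (z.2 - f z.1) * g z.1 ∂Q = ∫ z, (z.2 * g z.1 - f z.1 * g z.1) ∂Q :=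
    integral_congr_ae (ae_of_all _ fun z => by ring)
  rw [e3, e4, integral_sub i3 i4, integral_sub i1 i2, e1, e2]
  ring

/-- The mean absolute difference of two independent copies of the feature `X_l`. -/
noncomputable def meanAbsDiff (Q : Measure ((Fin p → ℝ) × ℝ)) (l : Fin p) : ℝ :=
  ∫ z, ∫ z', |z'.1 l - z.1 l| ∂Q ∂Q

theorem meanAbsDiff_pos (hQ : ∀ᵐ z ∂Q, z ∈ dataBox p MX MY)
    (hvar : 0 < variance (fun z : (Fin p → ℝ) × ℝ => z.1 l) Q) : 0 < meanAbsDiff Q l := by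
  have hint : Integrable (fun q : ((Fin p → ℝ) × ℝ) × ((Fin p → ℝ) × ℝ) => |q.2.1 l - q.1.1 l|)
      (Q.prod Q) := by
    refine Integrable.of_bound (C := 2 * MX) (by fun_prop) ?_
    filter_upwards [ae_prod_mem hQ] with q hq
    rw [Real.norm_eq_abs, abs_abs]
    exact abs_sub_le_of_mem_dataBox hq.2 hq.1 l
  rw [meanAbsDiff, ← integral_prod _ hint]
  refine lt_of_le_of_ne (integral_nonneg fun q => abs_nonneg _) fun h => hvar.ne' ?_
  have h0 := (integral_eq_zero_iff_of_nonneg (fun q => abs_nonneg _) hint).1 h.symm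
  obtain ⟨z, hz⟩ := (Measure.ae_ae_of_ae_prod h0).exists
  have hconst : (fun z : (Fin p → ℝ) × ℝ => z.1 l) =ᵐ[Q] fun _ => z.1 l := by
    filter_upwards [hz] with z' hz'
    simpa [sub_eq_zero] using hz'
  rw [variance_congr hconst, variance_eq_integral aemeasurable_const]
  simp

variable [IsFiniteMeasure μ]

/-- At weights supported in `S`, the partial derivative in a direction outside `S` factorizes, and
it is bounded below by the squared norm of the fit. -/
theorem krrGradient_noise_ge (ha : 0 ≤ a) (hb : 0 ≤ b) (hab : ∀ᵐ t ∂μ, t ∈ Set.Icc a b)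
    (hQ : ∀ᵐ z ∂Q, z ∈ dataBox p MX MY) (hlam : 0 < lam) (hw : ∀ j, 0 ≤ w j)
    (hS : IsSignalCandidate Q S) (hwS : ∀ j ∉ S, w j = 0) (hl : l ∉ S) :
    a * meanAbsDiff Q l / 2 * lam * ‖ridge μ lam Q w‖ ^ 2 ≤ krrGradient μ lam Q w l := by
  set r := residual μ lam Q w with hr
  have hri : Integrable r Q := integrable_residual hb hab hQ w
  have hwd : ∀ x x' y y' : Fin p → ℝ, (∀ j ∈ S, x j = x' j) → (∀ j ∈ S, y j = y' j) →
      wdist w x y = wdist w x' y' := fun x x' y y' hx hy =>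
    Finset.sum_congr rfl fun j _ => by
      by_cases hj : j ∈ S
      · rw [hx j hj, hy j hj]
      · simp [hwS j hj]
  let f : (Fin p → ℝ) → ℝ := fun x => ⟪feature μ (scale w x), ridge μ lam Q w⟫
  have hrf : ∀ z, r z = z.2 - f z.1 := fun z => rfl
  have hfS : DependsOnly S f := fun x y h => by
    have : scale w x = scale w y := funext fun j => by
      by_cases hj : j ∈ S
      · simp [scale, h j hj]
      · simp [scale, hwS j hj]
    simp only [f, this]
  have hfc : Continuous f :=
    ((continuous_feature hb hab).comp (by unfold scale; fun_prop)).inner continuous_const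
  have hfb : ∀ᵐ z ∂Q, |f z.1| ≤ √(μ.real Set.univ) * ‖ridge μ lam Q w‖ := ae_of_all _ fun z => by
    have := abs_fit_le (μ := μ) (lam := lam) (P := Q) (w := w) z
    rwa [← hr, hrf, sub_sub_cancel] at this
  have hsb : ∀ x y, |slope μ (wdist w x y)| ≤ b * μ.real Set.univ := fun x y =>
    abs_slope_le hb hab (wdist_nonneg hw x y)
  have hsc : Continuous fun q : (Fin p → ℝ) × (Fin p → ℝ) => slope μ (wdist w q.1 q.2) :=
    continuous_slope_comp hb hab (continuous_wdist w) fun q => wdist_nonneg hw _ _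
  let sker : (Fin p → ℝ) × ℝ → (Fin p → ℝ) × ℝ → ℝ := fun z z' => slope μ (wdist w z.1 z'.1)
  have hsk : IsBddKernel Q sker (b * μ.real Set.univ) :=
    ⟨(hsc.comp (by fun_prop : Continuous fun q : ((Fin p → ℝ) × ℝ) × ((Fin p → ℝ) × ℝ) =>
      (q.1.1, q.2.1))).measurable, ae_of_all _ fun q => hsb _ _⟩
  -- the partial derivative is `E[r(Z) A(X) φ(X_l)]` once `X'_l` has been split off from `Z'`
  let A : (Fin p → ℝ) → ℝ := fun x => ∫ z', r z' * slope μ (wdist w x z'.1) ∂Q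
  have hAm : Measurable A := by
    have h1 : Measurable fun q : (Fin p → ℝ) × ((Fin p → ℝ) × ℝ) =>
        r q.2 * slope μ (wdist w q.1 q.2.1) :=
      ((continuous_residual hb hab).measurable.comp measurable_snd).mul
        (hsc.comp (by fun_prop : Continuous fun q : (Fin p → ℝ) × ((Fin p → ℝ) × ℝ) =>
          (q.1, q.2.1))).measurable
    exact h1.stronglyMeasurable.integral_prod_right'.measurable
  have hAS : DependsOnly S A := fun x y h => by
    simp only [A]
    congr 1
    ext z'
    rw [hwd x y z'.1 z'.1 h fun _ _ => rfl]
  have hAb : ∀ᵐ z ∂Q, |A z.1| ≤ b * μ.real Set.univ * ∫ z', |r z'| ∂Q := ae_of_all _ fun z =>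
    abs_integral_mul_le hri (ae_of_all _ fun z' => hsb _ _)
  let φ : ℝ → ℝ := fun t => ∫ z', |z'.1 l - t| ∂Q
  have hφm : Measurable φ := by
    have h1 : Measurable fun q : ℝ × ((Fin p → ℝ) × ℝ) => |q.2.1 l - q.1| := by fun_prop
    exact h1.stronglyMeasurable.integral_prod_right'.measurable
  have hφb : ∀ᵐ z ∂Q, |φ (z.1 l)| ≤ 2 * MX := by
    filter_upwards [hQ] with z hz
    have : ∀ᵐ z' ∂Q, ‖|z'.1 l - z.1 l|‖ ≤ 2 * MX := by
      filter_upwards [hQ] with z' hz'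
      rw [Real.norm_eq_abs, abs_abs]
      exact abs_sub_le_of_mem_dataBox hz' hz l
    simpa using norm_integral_le_of_norm_le_const this
  have hfact : pairing Q (gker μ w l) r r = pairing Q sker r r * meanAbsDiff Q l := by
    rw [pairing_eq_left (isBddKernel_gker hb hab hw hQ l) hri hri]
    have hin : ∀ᵐ z ∂Q, ∫ z', r z' * gker μ w l z z' ∂Q = A z.1 * φ (z.1 l) := by
      filter_upwards [hQ] with z hz
      have := integral_residual_mul_mul hQ hS hl hfS hfc.measurable hfb
        (g := fun x => slope μ (wdist w z.1 x)) (fun x y h => by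
          simp only [hwd _ _ x y (fun _ _ => rfl) h])
        (hsc.comp (Continuous.prodMk_right z.1)).measurable (ae_of_all _ fun z' => hsb _ _)
        (φ := fun t => |t - z.1 l|) (by fun_prop) (d := 2 * MX) (by
          filter_upwards [hQ] with z' hz'
          rw [abs_abs]
          exact abs_sub_le_of_mem_dataBox hz' hz l)
      simp only [← hrf] at this
      rw [← this]
      refine integral_congr_ae (ae_of_all _ fun z' => ?_)
      simp only [gker, abs_sub_comm]
    have h1 : ∫ z, r z * ∫ z', r z' * gker μ w l z z' ∂Q ∂Q
        = ∫ z, r z * (A z.1 * φ (z.1 l)) ∂Q := by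
      refine integral_congr_ae ?_
      filter_upwards [hin] with z hz
      rw [hz]
    have h2 := integral_residual_mul_mul hQ hS hl hfS hfc.measurable hfb hAS hAm hAb hφm hφb
    simp only [← hrf] at h2
    rw [h1, h2, pairing_eq_left hsk hri hri]
    rfl
  -- `-h' - a h` is the profile of a positive measure, so it gives a positive semidefinite kernel
  have hlow : a * (lam ^ 2 * ‖ridge μ lam Q w‖ ^ 2) ≤ pairing Q sker r r := by
    obtain ⟨ν, hν, hνab, hνp⟩ := exists_profile_eq_slope_sub hab
    have h1 := pairing_wker_nonneg (P := Q) hb hνab hw hri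
    have hak : IsBddKernel Q (fun z z' => a * wker μ w z z') (a * μ.real Set.univ) :=
      ⟨(isBddKernel_wker (P := Q) hb hab hw).measurable.const_mul a, by
        filter_upwards [(isBddKernel_wker (P := Q) hb hab hw).bound] with q hq
        rw [abs_mul, abs_of_nonneg ha]
        exact mul_le_mul_of_nonneg_left hq ha⟩
    have h2 : pairing Q (wker ν w) r r
        = pairing Q (fun z z' => sker z z' - a * wker μ w z z') r r := by
      rw [pairing, pairing]
      congr 1
      ext q
      rw [wker, hνp _ (wdist_nonneg hw _ _)]
      rfl
    have h3 : pairing Q (fun z z' => a * wker μ w z z') r r = a * pairing Q (wker μ w) r r := by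
      rw [pairing, pairing, ← integral_const_mul]
      congr 1
      ext q
      ring
    rw [h2, pairing_sub_kernel hsk hak hri hri, h3, ← sq_norm_ridge hb hab hQ hlam hw] at h1
    linarith
  have he : 0 ≤ meanAbsDiff Q l :=
    integral_nonneg fun z => integral_nonneg fun z' => abs_nonneg _
  have h4 := mul_le_mul_of_nonneg_right hlow he
  rw [krrGradient, ← hr, hfact]
  calc a * meanAbsDiff Q l / 2 * lam * ‖ridge μ lam Q w‖ ^ 2
      = (2 * lam)⁻¹ * (a * (lam ^ 2 * ‖ridge μ lam Q w‖ ^ 2) * meanAbsDiff Q l) := by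
        field_simp
    _ ≤ _ := mul_le_mul_of_nonneg_left h4 (by positivity)

/-- At zero weights the features carry no information and the residual is the response. -/
theorem residual_zero (hb : 0 ≤ b) (hab : ∀ᵐ t ∂μ, t ∈ Set.Icc a b)
    (hQ : ∀ᵐ z ∂Q, z ∈ dataBox p MX MY) (hQ0 : ∫ z, z.2 ∂Q = 0) (hlam : 0 < lam)
    (z : (Fin p → ℝ) × ℝ) : residual μ lam Q 0 z = z.2 := by
  have hri := integrable_residual (lam := lam) (P' := Q) hb hab hQ 0
  set I := ∫ z, residual μ lam Q 0 z ∂Q with hI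
  have h1 : ∀ z, lam * (z.2 - residual μ lam Q 0 z) = I * profile μ 0 := fun z => by
    rw [fit_eq (w := 0) hb hab hQ hlam (fun _ => le_rfl), hI, ← integral_mul_const]
    simp [wker, wdist]
  have h2 : ∫ z, lam * (z.2 - residual μ lam Q 0 z) ∂Q = ∫ _z, I * profile μ 0 ∂Q :=
    integral_congr_ae (ae_of_all _ h1)
  rw [integral_const_mul, integral_sub (integrable_snd hQ) hri, hQ0, ← hI] at h2
  simp only [integral_const, probReal_univ, one_smul] at h2
  have h3 : I = 0 := by
    have h4 : I * (lam + profile μ 0) = 0 := by linarith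
    rcases mul_eq_zero.1 h4 with h | h
    · exact h
    · exact absurd h (by have := profile_nonneg (μ := μ) 0; positivity)
  have h4 := h1 z
  rw [h3, zero_mul, mul_eq_zero] at h4
  linarith [h4.resolve_left hlam.ne']

theorem krrGradient_zero (hb : 0 ≤ b) (hab : ∀ᵐ t ∂μ, t ∈ Set.Icc a b)
    (hQ : ∀ᵐ z ∂Q, z ∈ dataBox p MX MY) (hQ0 : ∫ z, z.2 ∂Q = 0) (hlam : 0 < lam) (l : Fin p) :
    krrGradient μ lam Q 0 l = (2 * lam)⁻¹ * (slope μ 0 *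
      pairing Q (fun z z' => |z.1 l - z'.1 l|) (fun z => z.2) (fun z => z.2)) := by
  have : residual μ lam Q 0 = fun z => z.2 := funext (residual_zero hb hab hQ hQ0 hlam)
  rw [krrGradient, this, pairing, pairing]
  simp only [← integral_const_mul]
  refine integral_congr_ae (ae_of_all _ fun q => ?_)
  simp only [gker, wdist, Pi.zero_apply, zero_mul, Finset.sum_const_zero]
  ring

end Population

/-! ### The objective on the box -/

section ObjectiveOnBox

variable {p : ℕ} {μ : Measure ℝ} {a b MX MY lam M : ℝ} {P : Measure ((Fin p → ℝ) × ℝ)}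

theorem norm_le_sum_abs (x : EuclideanSpace ℝ (Fin p)) : ‖x‖ ≤ ∑ j, |x j| := by
  rw [EuclideanSpace.norm_eq]
  refine Real.sqrt_le_iff.2 ⟨Finset.sum_nonneg fun _ _ => abs_nonneg _, ?_⟩
  simp only [Real.norm_eq_abs]
  exact Finset.sum_sq_le_sq_sum_of_nonneg fun _ _ => abs_nonneg _

theorem dist1_le_norm_sub (x y : EuclideanSpace ℝ (Fin p)) :
    dist1 x.ofLp y.ofLp ≤ p * ‖y - x‖ := by
  refine (Finset.sum_le_sum fun j _ => ?_).trans (b := ∑ _j : Fin p, ‖y - x‖) (by simp)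
  exact PiLp.norm_apply_le (y - x) j

variable [IsFiniteMeasure μ] [IsProbabilityMeasure P]

theorem hasGradientWithinAt_krrObjective (hb : 0 ≤ b) (hab : ∀ᵐ t ∂μ, t ∈ Set.Icc a b)
    (hP : ∀ᵐ z ∂P, z ∈ dataBox p MX MY) (hlam : 0 < lam) {x : EuclideanSpace ℝ (Fin p)}
    (hx : x ∈ box p M) :
    HasGradientWithinAt (krrObjective μ lam P) (WithLp.toLp 2 (krrGradient μ lam P x.ofLp))
      (box p M) x := by
  rw [hasGradientWithinAt_iff_isLittleO]
  set c := (2 * lam)⁻¹ * (lam⁻¹ * (b * μ.real Set.univ * (2 * MX) * MY) ^ 2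
    + b ^ 2 * μ.real Set.univ * (2 * MX) ^ 2 * MY ^ 2) with hc
  have hc0 : 0 ≤ c := by positivity
  have h1 : (fun y => ‖y - x‖ ^ 2) =o[nhdsWithin x (box p M)] fun y => y - x :=
    (Asymptotics.isLittleO_pow_sub_sub x one_lt_two).mono nhdsWithin_le_nhds
  refine Asymptotics.IsBigO.trans_isLittleO (Asymptotics.IsBigO.of_bound (c * p ^ 2) ?_) h1
  filter_upwards [self_mem_nhdsWithin] with y hy
  have h2 := abs_krr_taylor_le hb hab hP hlam (fun j => (hx j).1) fun j => (hy j).1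
  have h3 : ⟪WithLp.toLp 2 (krrGradient μ lam P x.ofLp), y - x⟫
      = ∑ l, (y l - x l) * krrGradient μ lam P x.ofLp l := by
    simp [PiLp.inner_apply]
  rw [h3, krrObjective_eq hb hab hP hlam, krrObjective_eq hb hab hP hlam, Real.norm_eq_abs]
  refine h2.trans ?_
  rw [norm_pow, norm_norm, mul_assoc c, ← mul_pow]
  exact mul_le_mul_of_nonneg_left
    (pow_le_pow_left₀ (dist1_nonneg _ _) (dist1_le_norm_sub x y) 2) hc0

theorem abs_krrObjective_sub_le (hb : 0 ≤ b) (hab : ∀ᵐ t ∂μ, t ∈ Set.Icc a b)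
    (hP : ∀ᵐ z ∂P, z ∈ dataBox p MX MY) (hlam : 0 < lam) {x y : EuclideanSpace ℝ (Fin p)}
    (hx : x ∈ box p M) (hy : y ∈ box p M) :
    |krrObjective μ lam P y - krrObjective μ lam P x|
      ≤ (2 * lam)⁻¹ * (b * μ.real Set.univ * (2 * MX) * MY ^ 2) * dist1 x.ofLp y.ofLp := by
  obtain ⟨z₀, hz₀⟩ := hP.exists
  have h0 : 0 ≤ 2 * MX * dist1 x.ofLp y.ofLp :=
    (abs_nonneg _).trans (abs_wdist_sub_le hz₀ hz₀ x.ofLp y.ofLp)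
  have hx' : ∀ j, 0 ≤ x.ofLp j := fun j => (hx j).1
  have hy' : ∀ j, 0 ≤ y.ofLp j := fun j => (hy j).1
  have hK : IsBddKernel P (fun z z' => wker μ x.ofLp z z' - wker μ y.ofLp z z')
      (b * μ.real Set.univ * (2 * MX * dist1 x.ofLp y.ofLp)) := by
    refine ⟨((isBddKernel_wker (P := P) hb hab hx').sub
      (isBddKernel_wker (P := P) hb hab hy')).measurable, ?_⟩
    filter_upwards [ae_prod_mem hP] with q hq
    rw [abs_sub_comm]
    exact (abs_wker_sub_le hb hab hx' hy' hq.1 hq.2).trans_eq (by ring)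
  have h1 := integral_abs_residual_le hb hab hP hlam hx'
  have h2 := integral_abs_residual_le hb hab hP hlam hy'
  have h3 : 0 ≤ ∫ z, |residual μ lam P x.ofLp z| ∂P := integral_nonneg fun _ => abs_nonneg _
  have h4 : 0 ≤ ∫ z, |residual μ lam P y.ofLp z| ∂P := integral_nonneg fun _ => abs_nonneg _
  rw [krrObjective_eq hb hab hP hlam, krrObjective_eq hb hab hP hlam,
    krr_increment hb hab hP hlam hx' hy', abs_mul, abs_of_pos (by positivity), mul_assoc]
  refine mul_le_mul_of_nonneg_left ?_ (by positivity)
  refine (abs_pairing_le hK (integrable_residual hb hab hP _)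
    (integrable_residual hb hab hP _)).trans ?_
  refine (mul_le_mul_of_nonneg_left (mul_le_mul h1 h2 h4 (h3.trans h1)) (by positivity)).trans_eq
    (by ring)

/-- The projected gradient flow has a trajectory. -/
theorem exists_isGradientFlow (hb : 0 ≤ b) (hab : ∀ᵐ t ∂μ, t ∈ Set.Icc a b)
    (hP : ∀ᵐ z ∂P, z ∈ dataBox p MX MY) (hlam : 0 < lam) (hM : 0 < M) :
    ∃ β : ℝ → EuclideanSpace ℝ (Fin p), β 0 = 0 ∧
      IsGradientFlow (krrObjective μ lam P) (box p M) β := by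
  set L := (2 * lam)⁻¹ * (b ^ 2 * μ.real Set.univ * (2 * MX) ^ 2 * MY ^ 2
        + 2 * lam⁻¹ * (b * μ.real Set.univ * (2 * MX) * MY) ^ 2) with hLdef
  have hL0 : 0 ≤ L := by positivity
  let G : EuclideanSpace ℝ (Fin p) → EuclideanSpace ℝ (Fin p) := fun x =>
    WithLp.toLp 2 (krrGradient μ lam P x.ofLp)
  have hD : ∀ x ∈ box p M,
      ‖G x‖ ≤ ∑ _j : Fin p, (2 * lam)⁻¹ * (b * μ.real Set.univ * (2 * MX) * MY ^ 2) :=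
    fun x hx => (norm_le_sum_abs _).trans (Finset.sum_le_sum fun j _ =>
      abs_krrGradient_le hb hab hP hlam (fun j => (hx j).1) j)
  have hL : ∀ x ∈ box p M, ∀ y ∈ box p M, ‖G x - G y‖ ≤ (p * (L * p)) * ‖x - y‖ :=
    fun x hx y hy => by
      refine (norm_le_sum_abs _).trans ((Finset.sum_le_sum fun j _ =>
        (abs_krrGradient_sub_le hb hab hP hlam (fun j => (hy j).1) (fun j => (hx j).1) j).trans
          (mul_le_mul_of_nonneg_left (dist1_le_norm_sub y x) hL0)).trans_eq ?_)
      rw [Finset.sum_const, Finset.card_univ, Fintype.card_fin, nsmul_eq_mul]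
      ring
  obtain ⟨β, v, h0, hβ, hint, heq, hv⟩ := exists_flow isCompact_box convex_box hD hL
    (by positivity) (zero_mem_box hM)
  refine ⟨β, h0, v, fun t _ => hint t, fun t _ => heq t, ?_⟩
  filter_upwards [hv] with s hs
  exact ⟨G (β s), -G (β s) - v s, hasGradientWithinAt_krrObjective hb hab hP hlam (hβ s),
    ⟨hβ s, hs⟩, by abel⟩

end ObjectiveOnBox

/-! ### Comparison of the objectives of two distributions -/

section Comparison

variable {p : ℕ} {μ : Measure ℝ} {a b MX MY lam e : ℝ} {P Q : Measure ((Fin p → ℝ) × ℝ)}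
  {w : Fin p → ℝ} [IsFiniteMeasure μ] [IsProbabilityMeasure P] [IsProbabilityMeasure Q]

theorem integral_abs_residual_sub_le_of_deviation (hb : 0 ≤ b) (hab : ∀ᵐ t ∂μ, t ∈ Set.Icc a b)
    (hP : ∀ᵐ z ∂P, z ∈ dataBox p MX MY) (hQ : ∀ᵐ z ∂Q, z ∈ dataBox p MX MY) (hlam : 0 < lam)
    (hw : ∀ j, 0 ≤ w j)
    (hd : ∀ z ∈ dataBox p MX MY, |∫ z', residual μ lam Q w z' * wker μ w z' z ∂P
      - ∫ z', residual μ lam Q w z' * wker μ w z' z ∂Q| ≤ e) :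
    ∫ z, |residual μ lam P w z - residual μ lam Q w z| ∂P ≤ lam⁻¹ * e := by
  refine integral_abs_residual_sub_le hb hab hP hlam hw (memLp_residual hb hab hP w) ?_
  filter_upwards [hP] with z hz
  rw [fit_eq hb hab hQ hlam hw, abs_sub_comm]
  exact hd z hz

/-- If the averages of `r k_w(·, z)` and of `r ∂_l k_w(·, z)`, for the residual `r` of `Q` at the
weights `w`, agree under `P` and `Q` up to `e`, then so do the partial derivatives of the objective,
up to a multiple of `e / λ²`. -/
theorem abs_krrGradient_sub_le_of_deviation (hb : 0 ≤ b) (hab : ∀ᵐ t ∂μ, t ∈ Set.Icc a b)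
    (hP : ∀ᵐ z ∂P, z ∈ dataBox p MX MY) (hQ : ∀ᵐ z ∂Q, z ∈ dataBox p MX MY) (hlam : 0 < lam)
    (hw : ∀ j, 0 ≤ w j)
    (hd : ∀ z ∈ dataBox p MX MY, |∫ z', residual μ lam Q w z' * wker μ w z' z ∂P
      - ∫ z', residual μ lam Q w z' * wker μ w z' z ∂Q| ≤ e) {l : Fin p}
    (hdl : ∀ z ∈ dataBox p MX MY, |∫ z', residual μ lam Q w z' * gker μ w l z' z ∂P
      - ∫ z', residual μ lam Q w z' * gker μ w l z' z ∂Q| ≤ e) :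
    |krrGradient μ lam P w l - krrGradient μ lam Q w l|
      ≤ (2 * lam)⁻¹ * (e * (2 * MY + lam⁻¹ * e)
        * (lam⁻¹ * (b * μ.real Set.univ * (2 * MX)) + 1)) := by
  obtain ⟨z₀, hz₀⟩ := hP.exists
  have hMX : 0 ≤ MX := (abs_nonneg _).trans (hz₀.1 l)
  have he : 0 ≤ e := (abs_nonneg _).trans (hd z₀ hz₀)
  set r := residual μ lam Q w with hr
  set s := residual μ lam P w with hs
  have hrP : Integrable r P := integrable_residual hb hab hP w
  have hrQ : Integrable r Q := integrable_residual hb hab hQ w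
  have hsP : Integrable s P := integrable_residual hb hab hP w
  have hKP := isBddKernel_gker (P := P) hb hab hw hP l
  have hKQ := isBddKernel_gker (P := Q) hb hab hw hQ l
  set c := b * μ.real Set.univ * (2 * MX) with hc
  have hc0 : 0 ≤ c := by positivity
  have n1 : ∫ z, |s z - r z| ∂P ≤ lam⁻¹ * e :=
    integral_abs_residual_sub_le_of_deviation hb hab hP hQ hlam hw hd
  have n2 : ∫ z, |s z| ∂P ≤ MY := integral_abs_residual_le hb hab hP hlam hw
  have n3 : ∫ z, |r z| ∂Q ≤ MY := integral_abs_residual_le hb hab hQ hlam hw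
  have n4 : ∫ z, |r z| ∂P ≤ MY + lam⁻¹ * e := by
    refine (integral_mono hrP.abs (hsP.abs.add (hsP.sub hrP).abs) fun z => ?_).trans
      ((integral_add hsP.abs (hsP.sub hrP).abs).trans_le (add_le_add n2 n1))
    have := abs_sub (s z) (s z - r z)
    rwa [sub_sub_cancel] at this
  have p1 : 0 ≤ ∫ z, |s z - r z| ∂P := integral_nonneg fun _ => abs_nonneg _
  have p2 : 0 ≤ ∫ z, |s z| ∂P := integral_nonneg fun _ => abs_nonneg _
  have p3 : 0 ≤ ∫ z, |r z| ∂Q := integral_nonneg fun _ => abs_nonneg _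
  have p4 : 0 ≤ ∫ z, |r z| ∂P := integral_nonneg fun _ => abs_nonneg _
  -- replacing the residual of `P` by that of `Q`
  have t1 : |pairing P (gker μ w l) s s - pairing P (gker μ w l) r s| ≤ c * (lam⁻¹ * e * MY) := by
    rw [← pairing_sub_left hKP hsP hrP hsP]
    exact (abs_pairing_le hKP (hsP.sub hrP) hsP).trans
      (mul_le_mul_of_nonneg_left (mul_le_mul n1 n2 p2 (p1.trans n1)) hc0)
  have t2 : |pairing P (gker μ w l) r s - pairing P (gker μ w l) r r|
      ≤ c * ((MY + lam⁻¹ * e) * (lam⁻¹ * e)) := by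
    rw [← pairing_sub_right hKP hrP hsP hrP]
    exact (abs_pairing_le hKP hrP (hsP.sub hrP)).trans
      (mul_le_mul_of_nonneg_left (mul_le_mul n4 n1 p1 (p4.trans n4)) hc0)
  -- replacing `P` by `Q` in each of the two integrations
  let A : Measure ((Fin p → ℝ) × ℝ) → (Fin p → ℝ) × ℝ → ℝ := fun ν z =>
    ∫ z', r z' * gker μ w l z' z ∂ν
  have hmeas := (continuous_gker (μ := μ) hb hab hw l).measurable
  have iPQ : Integrable (fun q : ((Fin p → ℝ) × ℝ) × ((Fin p → ℝ) × ℝ) =>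
      r q.1 * r q.2 * gker μ w l q.1 q.2) (P.prod Q) := by
    refine (hrP.mul_prod hrQ).mul_bdd (c := c) hmeas.aestronglyMeasurable ?_
    have hbd : ∀ z ∈ dataBox p MX MY, ∀ z' ∈ dataBox p MX MY, |gker μ w l z z'| ≤ c :=
      fun z hz z' hz' => by
        rw [gker, abs_mul, abs_abs]
        exact mul_le_mul (abs_slope_le hb hab (wdist_nonneg hw _ _))
          (abs_sub_le_of_mem_dataBox hz hz' l) (abs_nonneg _) (by positivity)
    filter_upwards [Measure.quasiMeasurePreserving_fst.ae hP,
      Measure.quasiMeasurePreserving_snd.ae hQ] with q h1 h2 using hbd _ h1 _ h2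
  have hA : ∀ {ν ν' : Measure ((Fin p → ℝ) × ℝ)} [IsProbabilityMeasure ν] [IsProbabilityMeasure ν'],
      Integrable (fun q : ((Fin p → ℝ) × ℝ) × ((Fin p → ℝ) × ℝ) =>
        r q.1 * r q.2 * gker μ w l q.1 q.2) (ν.prod ν') → Integrable (fun z => r z * A ν' z) ν :=
    fun {ν ν'} _ _ h => h.integral_prod_left.congr (ae_of_all _ fun z => by
      simp only [A, mul_assoc, integral_const_mul, gker_comm (μ := μ) (w := w) l z])
  have swap : ∫ z, r z * A Q z ∂P = ∫ z, r z * A P z ∂Q := by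
    have h := integral_integral_swap (f := fun z z' => r z * r z' * gker μ w l z z') iPQ
    calc ∫ z, r z * A Q z ∂P = ∫ z, ∫ z', r z * r z' * gker μ w l z z' ∂Q ∂P := by
          simp only [A, mul_assoc, integral_const_mul, gker_comm (μ := μ) (w := w) l]
      _ = _ := h
      _ = _ := integral_congr_ae (ae_of_all _ fun z => by
          simp only [A]
          rw [← integral_const_mul]
          exact integral_congr_ae (ae_of_all _ fun z' => by ring))
  have ePP : pairing P (gker μ w l) r r = ∫ z, r z * A P z ∂P := by
    rw [pairing_eq_right hKP hrP hrP]
  have eQQ : pairing Q (gker μ w l) r r = ∫ z, r z * A Q z ∂Q := by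
    rw [pairing_eq_right hKQ hrQ hrQ]
  have iQP : Integrable (fun q : ((Fin p → ℝ) × ℝ) × ((Fin p → ℝ) × ℝ) =>
      r q.1 * r q.2 * gker μ w l q.1 q.2) (Q.prod P) := by
    refine iPQ.swap.congr (ae_of_all _ fun q => ?_)
    simp only [Function.comp, Prod.fst_swap, Prod.snd_swap, gker_comm (μ := μ) (w := w) l q.2]
    ring
  have t3 : |∫ z, r z * A P z ∂P - ∫ z, r z * A Q z ∂P| ≤ e * (MY + lam⁻¹ * e) := by
    rw [← integral_sub (hA (hKP.integrable hrP hrP)) (hA iPQ)]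
    simp only [← mul_sub]
    refine (abs_integral_mul_le hrP ?_).trans (mul_le_mul_of_nonneg_left n4 he)
    filter_upwards [hP] with z hz using hdl z hz
  have t4 : |∫ z, r z * A P z ∂Q - ∫ z, r z * A Q z ∂Q| ≤ e * MY := by
    rw [← integral_sub (hA iQP) (hA (hKQ.integrable hrQ hrQ))]
    simp only [← mul_sub]
    refine (abs_integral_mul_le hrQ ?_).trans (mul_le_mul_of_nonneg_left n3 he)
    filter_upwards [hQ] with z hz using hdl z hz
  rw [krrGradient, krrGradient, ← mul_sub, abs_mul, abs_of_pos (by positivity)]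
  refine mul_le_mul_of_nonneg_left ?_ (by positivity)
  have e1 : pairing P (gker μ w l) s s - pairing Q (gker μ w l) r r
      = (pairing P (gker μ w l) s s - pairing P (gker μ w l) r s)
        + (pairing P (gker μ w l) r s - pairing P (gker μ w l) r r)
        + (∫ z, r z * A P z ∂P - ∫ z, r z * A Q z ∂P)
        + (∫ z, r z * A P z ∂Q - ∫ z, r z * A Q z ∂Q) := by
    rw [← swap, ePP, eQQ]
    ring
  rw [e1]
  refine ((abs_add_le _ _).trans (add_le_add ((abs_add_le _ _).trans (add_le_add
    ((abs_add_le _ _).trans (add_le_add t1 t2)) t3)) t4)).trans_eq ?_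
  ring

end Comparison

/-! ### Uniform deviations of empirical averages -/

section Deviation

variable {Z : Type*} [MeasurableSpace Z] {Q : Measure Z} [IsProbabilityMeasure Q] {n : ℕ}
  {B e : ℝ}

theorem measureReal_pi_sum_ge_le {f : Z → ℝ} (hf : Measurable f) (hB : 0 < B)
    (hfB : ∀ᵐ z ∂Q, |f z| ≤ B) (hn : 0 < n) (he : 0 ≤ e) :
    (Measure.pi fun _ : Fin n => Q).real {d | n * e ≤ ∑ i, (f (d i) - ∫ z, f z ∂Q)}
      ≤ Real.exp (-(n * e ^ 2 / (2 * B ^ 2))) := by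
  have hind : iIndepFun (fun (i : Fin n) (d : Fin n → Z) => f (d i) - ∫ z, f z ∂Q)
      (Measure.pi fun _ : Fin n => Q) :=
    iIndepFun_pi (X := fun _ z => f z - ∫ z, f z ∂Q) fun _ =>
      (hf.sub_const (∫ z, f z ∂Q)).aemeasurable
  have hsub : ∀ i : Fin n, HasSubgaussianMGF (fun d : Fin n → Z => f (d i) - ∫ z, f z ∂Q)
      ((‖B - -B‖₊ / 2) ^ 2) (Measure.pi fun _ : Fin n => Q) := fun i => by
    have hm := measurePreserving_eval (fun _ : Fin n => Q) i
    have h := hasSubgaussianMGF_of_mem_Icc (μ := Measure.pi fun _ : Fin n => Q)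
      (X := fun d => f (d i)) (a := -B) (b := B) (hf.comp (measurable_pi_apply i)).aemeasurable
      (hm.quasiMeasurePreserving.ae (hfB.mono fun z hz => abs_le.1 hz))
    have h1 : ∫ d : Fin n → Z, f (d i) ∂(Measure.pi fun _ => Q) = ∫ z, f z ∂Q := by
      conv_rhs => rw [← hm.map_eq]
      rw [integral_map hm.measurable.aemeasurable hf.aestronglyMeasurable]
    rwa [h1] at h
  have h := HasSubgaussianMGF.measure_sum_ge_le_of_iIndepFun hind (s := Finset.univ)
    (fun i _ => hsub i) (ε := n * e) (by positivity)
  refine h.trans_eq (congrArg Real.exp ?_)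
  have h2 : (((‖B - -B‖₊ / 2) ^ 2 : NNReal) : ℝ) = B ^ 2 := by
    simp only [NNReal.coe_pow, NNReal.coe_div, coe_nnnorm, NNReal.coe_ofNat, Real.norm_eq_abs]
    rw [sub_neg_eq_add, abs_of_pos (by linarith)]
    ring
  have h3 : ((∑ _i : Fin n, (‖B - -B‖₊ / 2) ^ 2 : NNReal) : ℝ) = n * B ^ 2 := by
    rw [NNReal.coe_sum, Finset.sum_congr rfl fun _ _ => h2]
    simp
  rw [h3]
  have hn' : (0 : ℝ) < n := by exact_mod_cast hn
  field_simp

/-- For a finite family of bounded functions, all empirical averages are close to the expectations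
with high probability. -/
theorem exists_measurableSet_deviation_le {ι : Type*} [Fintype ι] {φ : ι → Z → ℝ}
    (hφ : ∀ k, Measurable (φ k)) (hB : 0 < B) (hφB : ∀ k, ∀ᵐ z ∂Q, |φ k z| ≤ B) {D : Set Z}
    (hD : MeasurableSet D) (hQ : ∀ᵐ z ∂Q, z ∈ D) (hn : 0 < n) (he : 0 ≤ e) :
    ∃ E : Set (Fin n → Z), MeasurableSet E ∧
      1 - Fintype.card ι * (2 * Real.exp (-(n * e ^ 2 / (2 * B ^ 2))))
        ≤ (Measure.pi fun _ : Fin n => Q).real E ∧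
      ∀ d ∈ E, (∀ i, d i ∈ D) ∧
        ∀ k, |(n : ℝ)⁻¹ * ∑ i, φ k (d i) - ∫ z, φ k z ∂Q| ≤ e := by
  set ν := Measure.pi fun _ : Fin n => Q with hν
  have hn' : (0 : ℝ) < n := by exact_mod_cast hn
  let E : Set (Fin n → Z) := {d | (∀ i, d i ∈ D) ∧
    ∀ k, |(n : ℝ)⁻¹ * ∑ i, φ k (d i) - ∫ z, φ k z ∂Q| ≤ e}
  have hE : MeasurableSet E := by
    have h1 : E = (⋂ i, (fun d : Fin n → Z => d i) ⁻¹' D) ∩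
        ⋂ k, {d | |(n : ℝ)⁻¹ * ∑ i, φ k (d i) - ∫ z, φ k z ∂Q| ≤ e} := by
      ext d
      simp [E]
    rw [h1]
    refine MeasurableSet.inter (MeasurableSet.iInter fun i => measurable_pi_apply i hD)
      (MeasurableSet.iInter fun k => measurableSet_le ?_ measurable_const)
    have : Measurable fun d : Fin n → Z => ∑ i, φ k (d i) :=
      Finset.measurable_fun_sum _ fun i _ => (hφ k).comp (measurable_pi_apply i)
    exact ((this.const_mul _).sub_const _).abs
  refine ⟨E, hE, ?_, fun d hd => hd⟩
  have hDae : ∀ᵐ d ∂ν, ∀ i, d i ∈ D := ae_all_iff.2 fun i =>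
    (measurePreserving_eval (fun _ : Fin n => Q) i).quasiMeasurePreserving.ae hQ
  let U : ι → Set (Fin n → Z) := fun k =>
    {d | n * e ≤ ∑ i, (φ k (d i) - ∫ z, φ k z ∂Q)} ∪
      {d | n * e ≤ ∑ i, (-φ k (d i) - ∫ z, -φ k z ∂Q)}
  have hU : ∀ k, ν.real (U k) ≤ 2 * Real.exp (-(n * e ^ 2 / (2 * B ^ 2))) := fun k => by
    refine (measureReal_union_le _ _).trans ?_
    rw [two_mul]
    exact add_le_add (measureReal_pi_sum_ge_le (hφ k) hB (hφB k) hn he)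
      (measureReal_pi_sum_ge_le (hφ k).neg hB ((hφB k).mono fun z hz => by
        rwa [Pi.neg_apply, abs_neg]) hn he)
  have hsub : Eᶜ ≤ᵐ[ν] ⋃ k, U k := by
    filter_upwards [hDae] with d hd hdE
    by_contra hcon
    refine hdE ⟨hd, fun k => ?_⟩
    have hk : d ∉ U k := fun h => hcon (Set.mem_iUnion.2 ⟨k, h⟩)
    simp only [U, Set.mem_union, Set.mem_ofPred_eq, not_or, not_le, Finset.sum_sub_distrib,
      Finset.sum_const, Finset.card_univ, Fintype.card_fin, nsmul_eq_mul, integral_neg,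
      Finset.sum_neg_distrib] at hk
    have h1 : (n : ℝ)⁻¹ * ∑ i, φ k (d i) - ∫ z, φ k z ∂Q
        = (n : ℝ)⁻¹ * (∑ i, φ k (d i) - n * ∫ z, φ k z ∂Q) := by field_simp
    rw [h1, abs_mul, abs_of_pos (inv_pos.2 hn'), inv_mul_le_iff₀ hn', abs_le]
    exact ⟨by linarith [hk.2], hk.1.le⟩
  have h2 : ν.real Eᶜ ≤ Fintype.card ι * (2 * Real.exp (-(n * e ^ 2 / (2 * B ^ 2)))) := by
    refine (ENNReal.toReal_mono (measure_ne_top _ _) (measure_mono_ae hsub)).trans ?_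
    refine (measureReal_iUnion_fintype_le U).trans ?_
    refine (Finset.sum_le_sum fun k _ => hU k).trans_eq ?_
    rw [Finset.sum_const, Finset.card_univ, nsmul_eq_mul]
  rw [probReal_compl_eq_one_sub hE] at h2
  linarith

end Deviation

section Empirical

variable {p n : ℕ} {d : Fin n → (Fin p → ℝ) × ℝ}

theorem integral_empirical (f : (Fin p → ℝ) × ℝ → ℝ) :
    ∫ z, f z ∂empirical d = (n : ℝ)⁻¹ * ∑ i, f (d i) := by
  rw [empirical, integral_smul_measure,
    integral_finsetSum_measure fun i _ => integrable_dirac (by simp)]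
  simp

theorem isProbabilityMeasure_empirical (hn : 0 < n) : IsProbabilityMeasure (empirical d) := by
  refine ⟨?_⟩
  simp only [empirical, Measure.smul_apply, Measure.coe_finsetSum, Finset.sum_apply, measure_univ,
    Finset.sum_const, Finset.card_univ, Fintype.card_fin, nsmul_eq_mul, mul_one, smul_eq_mul]
  exact ENNReal.inv_mul_cancel (by exact_mod_cast hn.ne') (by simp)

theorem ae_empirical_mem {D : Set ((Fin p → ℝ) × ℝ)} (hD : MeasurableSet D) (hd : ∀ i, d i ∈ D) :
    ∀ᵐ z ∂empirical d, z ∈ D := by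
  refine Measure.ae_smul_measure ?_ _
  rw [ae_iff, Measure.coe_finsetSum, Finset.sum_apply]
  refine Finset.sum_eq_zero fun i _ => ?_
  exact (Measure.dirac_apply' _ hD.compl).trans (by simp [hd i])

theorem measurableSet_dataBox {MX MY : ℝ} : MeasurableSet (dataBox p MX MY) := by
  have h1 : dataBox p MX MY = (⋂ j, {z : (Fin p → ℝ) × ℝ | |z.1 j| ≤ MX}) ∩
      {z | |z.2| ≤ MY} := by
    ext z
    simp [dataBox]
  rw [h1]
  exact (MeasurableSet.iInter fun j => measurableSet_le
    ((measurable_pi_apply j).comp measurable_fst).abs measurable_const).inter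
      (measurableSet_le measurable_snd.abs measurable_const)

end Empirical

/-! ### Uniform deviations for the residuals -/

section Grid

variable {p N : ℕ}

theorem exists_abs_grid_sub_le {lo len x : ℝ} (hN : 0 < N) (hlo : lo ≤ x) (hx : x ≤ lo + len) :
    ∃ k : Fin (N + 1), |x - (lo + len * (k / N))| ≤ len / N := by
  have hN' : (0 : ℝ) < N := by exact_mod_cast hN
  rcases eq_or_lt_of_le (show 0 ≤ len by linarith) with h0 | h0
  · refine ⟨0, ?_⟩
    have : x = lo := by linarith
    simp [this, ← h0]
  · set u := (x - lo) * N / len with hu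
    have hu0 : 0 ≤ u := by
      have : 0 ≤ x - lo := by linarith
      positivity
    have huN : u ≤ N := by
      rw [hu, div_le_iff₀ h0, mul_comm]
      gcongr
      linarith
    have hlt : ⌊u⌋₊ < N + 1 :=
      Nat.lt_succ_of_le ((Nat.floor_le_floor huN).trans_eq (Nat.floor_natCast N))
    refine ⟨⟨⌊u⌋₊, hlt⟩, ?_⟩
    have e1 : x - (lo + len * ((⌊u⌋₊ : ℝ) / N)) = len / N * (u - ⌊u⌋₊) := by
      rw [hu]
      field_simp
      ring
    have h1 := Nat.floor_le hu0
    have h2 := Nat.lt_floor_add_one u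
    dsimp only
    rw [e1, abs_mul, abs_of_nonneg (by positivity : 0 ≤ len / N)]
    exact mul_le_of_le_one_right (by positivity) (abs_le.2 ⟨by linarith, by linarith⟩)

/-- The points of the uniform grid with mesh `len / N` in the cube `[lo, lo + len]^p`. -/
noncomputable def gridPoint (lo len : ℝ) (k : Fin p → Fin (N + 1)) (j : Fin p) : ℝ :=
  lo + len * (k j / N)

theorem gridPoint_mem {lo len : ℝ} (hlen : 0 ≤ len) (k : Fin p → Fin (N + 1)) (j : Fin p) :
    lo ≤ gridPoint lo len k j ∧ gridPoint lo len k j ≤ lo + len := by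
  have h1 : ((k j : ℕ) : ℝ) / N ≤ 1 :=
    div_le_one_of_le₀ (by exact_mod_cast Nat.lt_succ_iff.1 (k j).2) (by positivity)
  have h2 : 0 ≤ ((k j : ℕ) : ℝ) / N := by positivity
  rw [gridPoint]
  exact ⟨by nlinarith, by nlinarith⟩

theorem exists_dist1_gridPoint_le {lo len : ℝ} {x : Fin p → ℝ} (hN : 0 < N)
    (hx : ∀ j, lo ≤ x j ∧ x j ≤ lo + len) :
    ∃ k : Fin p → Fin (N + 1), dist1 (gridPoint lo len k) x ≤ p * (len / N) := by
  choose k hk using fun j => exists_abs_grid_sub_le hN (hx j).1 (hx j).2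
  exact ⟨k, (Finset.sum_le_sum fun j _ => hk j).trans_eq (by simp)⟩

end Grid

section UniformDeviation

variable {p : ℕ} {μ : Measure ℝ} {a b MX MY lam M : ℝ} {Q : Measure ((Fin p → ℝ) × ℝ)}
  {w w' : Fin p → ℝ}

/-- The kernel (index `none`) together with minus its partial derivatives in the weights. -/
noncomputable def jetKer (μ : Measure ℝ) (w : Fin p → ℝ) (i : Option (Fin p))
    (z z' : (Fin p → ℝ) × ℝ) : ℝ :=
  i.elim (wker μ w z z') fun l => gker μ w l z z'

variable [IsFiniteMeasure μ]

theorem measurable_jetKer_left (hb : 0 ≤ b) (hab : ∀ᵐ t ∂μ, t ∈ Set.Icc a b) (hw : ∀ j, 0 ≤ w j)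
    (i : Option (Fin p)) (z' : (Fin p → ℝ) × ℝ) : Measurable fun z => jetKer μ w i z z' := by
  cases i with
  | none => exact ((continuous_wker hb hab hw).comp (Continuous.prodMk_left z')).measurable
  | some l => exact ((continuous_gker hb hab hw l).comp (Continuous.prodMk_left z')).measurable

theorem abs_jetKer_le (hb : 0 ≤ b) (hab : ∀ᵐ t ∂μ, t ∈ Set.Icc a b) (hw : ∀ j, 0 ≤ w j)
    {z z' : (Fin p → ℝ) × ℝ} (hz : z ∈ dataBox p MX MY) (hz' : z' ∈ dataBox p MX MY)
    (hMX : 0 ≤ MX) (i : Option (Fin p)) :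
    |jetKer μ w i z z'| ≤ μ.real Set.univ + b * μ.real Set.univ * (2 * MX) := by
  cases i with
  | none =>
    refine (abs_profile_le (wdist_nonneg hw _ _)).trans (le_add_of_nonneg_right (by positivity))
  | some l =>
    refine le_add_of_nonneg_of_le (by positivity) ?_
    simp only [jetKer, Option.elim, gker, abs_mul, abs_abs]
    exact mul_le_mul (abs_slope_le hb hab (wdist_nonneg hw _ _))
      (abs_sub_le_of_mem_dataBox hz hz' l) (abs_nonneg _) (by positivity)

theorem abs_wdist_sub_right_le (hw : ∀ j, 0 ≤ w j ∧ w j ≤ M) (x y y' : Fin p → ℝ) :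
    |wdist w x y' - wdist w x y| ≤ M * dist1 y y' := by
  rw [wdist, wdist, ← Finset.sum_sub_distrib, dist1, Finset.mul_sum]
  refine (Finset.abs_sum_le_sum_abs _ _).trans (Finset.sum_le_sum fun j _ => ?_)
  rw [← mul_sub, abs_mul, abs_of_nonneg (hw j).1]
  refine mul_le_mul (hw j).2 ?_ (abs_nonneg _) ((hw j).1.trans (hw j).2)
  refine (abs_abs_sub_abs_le_abs_sub _ _).trans_eq ?_
  rw [sub_sub_sub_cancel_left, abs_sub_comm]

/-- The kernel and its partial derivatives are Lipschitz in the weights and in the second data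
point. -/
theorem exists_abs_jetKer_sub_le (hb : 0 ≤ b) (hab : ∀ᵐ t ∂μ, t ∈ Set.Icc a b) (hMX : 0 ≤ MX)
    (hM : 0 ≤ M) :
    ∃ K, 0 ≤ K ∧ ∀ w w' : Fin p → ℝ, (∀ j, 0 ≤ w j ∧ w j ≤ M) → (∀ j, 0 ≤ w' j ∧ w' j ≤ M) →
      ∀ z ∈ dataBox p MX MY, ∀ z₁ ∈ dataBox p MX MY, ∀ z₂ ∈ dataBox p MX MY, ∀ i,
        |jetKer μ w' i z z₂ - jetKer μ w i z z₁| ≤ K * (dist1 w w' + dist1 z₁.1 z₂.1) := by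
  set m := μ.real Set.univ with hm
  have hm0 : 0 ≤ m := measureReal_nonneg
  set K₁ := b * m * (2 * MX) + b * m * M with hK₁
  set K₂ := b ^ 2 * m * (2 * MX) ^ 2 + (b ^ 2 * m * M * (2 * MX) + b * m) with hK₂
  have hK₁0 : 0 ≤ K₁ := by positivity
  have hK₂0 : 0 ≤ K₂ := by positivity
  refine ⟨K₁ + K₂, by positivity, fun w w' hw hw' z hz z₁ hz₁ z₂ hz₂ i => ?_⟩
  have d1 := dist1_nonneg w w'
  have d2 := dist1_nonneg z₁.1 z₂.1
  have hwd := abs_wdist_sub_right_le hw z.1 z₁.1 z₂.1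
  have hn₁ := wdist_nonneg (fun j => (hw j).1) z.1 z₁.1
  have hn₂ := wdist_nonneg (fun j => (hw j).1) z.1 z₂.1
  cases i with
  | none =>
    have h1 : |wker μ w' z z₂ - wker μ w z z₂| ≤ _ :=
      abs_wker_sub_le hb hab (fun j => (hw j).1) (fun j => (hw' j).1) hz hz₂
    have h2 : |wker μ w z z₂ - wker μ w z z₁| ≤ b * m * (M * dist1 z₁.1 z₂.1) :=
      (abs_profile_sub_le hb hab hn₂ hn₁).trans
        (mul_le_mul_of_nonneg_left hwd (by positivity))
    refine (abs_sub_le _ (wker μ w z z₂) _).trans ((add_le_add h1 h2).trans ?_)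
    have h3 : 0 ≤ b * m * (2 * MX) * dist1 z₁.1 z₂.1 := by positivity
    have h4 : 0 ≤ b * m * M * dist1 w w' := by positivity
    have h5 : 0 ≤ K₂ * (dist1 w w' + dist1 z₁.1 z₂.1) := by positivity
    rw [add_mul K₁, hK₁]
    nlinarith
  | some l =>
    have h1 : |gker μ w' l z z₂ - gker μ w l z z₂| ≤ _ :=
      abs_gker_sub_le hb hab (fun j => (hw j).1) (fun j => (hw' j).1) hz hz₂ l
    have h2 : |gker μ w l z z₂ - gker μ w l z z₁|
        ≤ (b ^ 2 * m * M * (2 * MX) + b * m) * dist1 z₁.1 z₂.1 := by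
      have e1 : gker μ w l z z₂ - gker μ w l z z₁
          = (slope μ (wdist w z.1 z₂.1) - slope μ (wdist w z.1 z₁.1)) * |z.1 l - z₂.1 l|
            + slope μ (wdist w z.1 z₁.1) * (|z.1 l - z₂.1 l| - |z.1 l - z₁.1 l|) := by
        rw [gker, gker]
        ring
      have e2 : |(|z.1 l - z₂.1 l| - |z.1 l - z₁.1 l|)| ≤ dist1 z₁.1 z₂.1 := by
        refine (abs_abs_sub_abs_le_abs_sub _ _).trans ?_
        rw [sub_sub_sub_cancel_left, abs_sub_comm]
        exact Finset.single_le_sum (f := fun j => |z₂.1 j - z₁.1 j|) (fun _ _ => abs_nonneg _)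
          (Finset.mem_univ l)
      have e3 := (abs_slope_sub_le hb hab hn₂ hn₁).trans
        (mul_le_mul_of_nonneg_left hwd (by positivity))
      rw [e1]
      refine (abs_add_le _ _).trans ?_
      rw [abs_mul, abs_mul, abs_abs]
      refine (add_le_add (mul_le_mul e3 (abs_sub_le_of_mem_dataBox hz hz₂ l) (abs_nonneg _)
        (by positivity)) (mul_le_mul (abs_slope_le hb hab hn₁) e2 (abs_nonneg _)
        (by positivity))).trans_eq ?_
      ring
    refine (abs_sub_le _ (gker μ w l z z₂) _).trans ((add_le_add h1 h2).trans ?_)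
    have h3 : 0 ≤ b ^ 2 * m * (2 * MX) ^ 2 * dist1 z₁.1 z₂.1 := by positivity
    have h4 : 0 ≤ (b ^ 2 * m * M * (2 * MX) + b * m) * dist1 w w' := by positivity
    have h5 : 0 ≤ K₁ * (dist1 w w' + dist1 z₁.1 z₂.1) := by positivity
    rw [add_mul K₁, hK₂]
    nlinarith

variable [IsProbabilityMeasure Q]

theorem abs_residual_le (hb : 0 ≤ b) (hab : ∀ᵐ t ∂μ, t ∈ Set.Icc a b)
    (hQ : ∀ᵐ z ∂Q, z ∈ dataBox p MX MY) (hlam : 0 < lam) (hlam1 : lam ≤ 1) (w : Fin p → ℝ)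
    {z : (Fin p → ℝ) × ℝ} (hz : z ∈ dataBox p MX MY) :
    |residual μ lam Q w z| ≤ (1 + √(μ.real Set.univ)) * MY / √lam := by
  have hMY : 0 ≤ MY := (abs_nonneg _).trans hz.2
  have hs : 0 < √lam := Real.sqrt_pos.2 hlam
  have hs1 : √lam ≤ 1 := Real.sqrt_le_one.2 hlam1
  have h1 : ‖ridge μ lam Q w‖ * √lam ≤ MY := by
    refine abs_le_of_sq_le_sq' ?_ hMY |>.2
    rw [mul_pow, Real.sq_sqrt hlam.le, mul_comm]
    exact sq_norm_ridge_le hb hab hQ hlam w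
  have h2 := abs_fit_le (μ := μ) (lam := lam) (P := Q) (w := w) z
  have h3 : |residual μ lam Q w z| ≤ |z.2| + |z.2 - residual μ lam Q w z| := by
    have := abs_sub z.2 (z.2 - residual μ lam Q w z)
    rwa [sub_sub_cancel] at this
  rw [le_div_iff₀ hs]
  have h4 : |z.2| * √lam ≤ MY := (mul_le_of_le_one_right (abs_nonneg _) hs1).trans hz.2
  have h5 : √(μ.real Set.univ) * (‖ridge μ lam Q w‖ * √lam) ≤ √(μ.real Set.univ) * MY :=
    mul_le_mul_of_nonneg_left h1 (Real.sqrt_nonneg _)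
  have h6 := mul_le_mul_of_nonneg_right (h3.trans (add_le_add_right h2 _)) hs.le
  linarith

theorem abs_residual_sub_residual_le (hb : 0 ≤ b) (hab : ∀ᵐ t ∂μ, t ∈ Set.Icc a b)
    (hQ : ∀ᵐ z ∂Q, z ∈ dataBox p MX MY) (hlam : 0 < lam) (hlam1 : lam ≤ 1)
    (hw : ∀ j, 0 ≤ w j) (hw' : ∀ j, 0 ≤ w' j)
    {z : (Fin p → ℝ) × ℝ} (hz : z ∈ dataBox p MX MY) :
    |residual μ lam Q w' z - residual μ lam Q w z|
      ≤ (1 + μ.real Set.univ) * (b * μ.real Set.univ * (2 * MX) * MY) / lam ^ 2 * dist1 w w' := by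
  have hri := integrable_residual (lam := lam) (P' := Q) hb hab hQ w
  have hri' := integrable_residual (lam := lam) (P' := Q) hb hab hQ w'
  have h1 := fit_eq hb hab hQ hlam hw z
  have h2 := fit_eq hb hab hQ hlam hw' z
  have h0 : 0 ≤ 2 * MX * dist1 w w' := (abs_nonneg _).trans (abs_wdist_sub_le hz hz w w')
  have hMY : 0 ≤ MY := (abs_nonneg _).trans hz.2
  set r := residual μ lam Q w with hr
  set r' := residual μ lam Q w' with hr'
  set m := μ.real Set.univ with hm
  have hm0 : 0 ≤ m := measureReal_nonneg
  have n1 : |∫ z', (r' z' - r z') * wker μ w' z' z ∂Q|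
      ≤ m * (lam⁻¹ * (b * m * (2 * MX) * dist1 w w' * MY)) :=
    (abs_integral_mul_le (hri'.sub hri) (ae_of_all _ fun z' =>
      abs_profile_le (wdist_nonneg hw' _ _))).trans (mul_le_mul_of_nonneg_left
        (integral_abs_residual_sub_residual_le hb hab hQ hlam hw hw') hm0)
  have n2 : |∫ z', r z' * (wker μ w' z' z - wker μ w z' z) ∂Q|
      ≤ b * m * (2 * MX) * dist1 w w' * MY := by
    refine (abs_integral_mul_le (c := b * m * (2 * MX) * dist1 w w') hri ?_).trans
      (mul_le_mul_of_nonneg_left (integral_abs_residual_le hb hab hQ hlam hw) ?_)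
    · filter_upwards [hQ] with z' hz' using abs_wker_sub_le hb hab hw hw' hz' hz
    · rw [mul_assoc (b * m)]
      positivity
  have e1 : lam * (r z - r' z) = ∫ z', (r' z' - r z') * wker μ w' z' z ∂Q
      + ∫ z', r z' * (wker μ w' z' z - wker μ w z' z) ∂Q := by
    have e2 : lam * (r z - r' z) = lam * (z.2 - r' z) - lam * (z.2 - r z) := by ring
    rw [e2, h1, h2]
    simp only [sub_mul, mul_sub]
    rw [integral_sub (integrable_mul_wker hb hab hw' hri' z) (integrable_mul_wker hb hab hw' hri z),
      integral_sub (integrable_mul_wker hb hab hw' hri z) (integrable_mul_wker hb hab hw hri z)]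
    ring
  have e3 : |r' z - r z| = lam⁻¹ * |lam * (r z - r' z)| := by
    rw [abs_mul, abs_of_pos hlam, inv_mul_cancel_left₀ hlam.ne', abs_sub_comm]
  rw [e3, e1]
  set T := b * m * (2 * MX) * dist1 w w' * MY with hT
  have hT0 : 0 ≤ T := by
    rw [hT, mul_assoc (b * m)]
    positivity
  calc _ ≤ lam⁻¹ * (m * (lam⁻¹ * T) + T) := by
        gcongr
        exact (abs_add_le _ _).trans (add_le_add n1 n2)
    _ ≤ lam⁻¹ * (m * (lam⁻¹ * T) + lam⁻¹ * T) := by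
        gcongr
        exact le_mul_of_one_le_left hT0 ((one_le_inv₀ hlam).2 hlam1)
    _ = _ := by
        rw [hT]
        field_simp
        ring

/-- The functions whose empirical averages are controlled are Lipschitz in their parameters, with a
constant of order `λ⁻²`. -/
theorem exists_abs_residual_mul_jetKer_sub_le (hb : 0 ≤ b) (hab : ∀ᵐ t ∂μ, t ∈ Set.Icc a b)
    (hQ : ∀ᵐ z ∂Q, z ∈ dataBox p MX MY) (hMX : 0 ≤ MX) (hMY : 0 ≤ MY) (hM : 0 ≤ M) :
    ∃ K, 0 ≤ K ∧ ∀ lam, 0 < lam → lam ≤ 1 →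
      ∀ w w' : Fin p → ℝ, (∀ j, 0 ≤ w j ∧ w j ≤ M) → (∀ j, 0 ≤ w' j ∧ w' j ≤ M) →
      ∀ z ∈ dataBox p MX MY, ∀ z₁ ∈ dataBox p MX MY, ∀ z₂ ∈ dataBox p MX MY, ∀ i,
        |residual μ lam Q w' z * jetKer μ w' i z z₂ - residual μ lam Q w z * jetKer μ w i z z₁|
          ≤ K / lam ^ 2 * (dist1 w w' + dist1 z₁.1 z₂.1) := by
  obtain ⟨K, hK, hjet⟩ := exists_abs_jetKer_sub_le (p := p) (MY := MY) hb hab hMX hM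
  set m := μ.real Set.univ with hm
  have hm0 : 0 ≤ m := measureReal_nonneg
  refine ⟨(1 + m) * (b * m * (2 * MX) * MY) * (m + b * m * (2 * MX)) + (1 + √m) * MY * K,
    by positivity, fun lam hlam hlam1 w w' hw hw' z hz z₁ hz₁ z₂ hz₂ i => ?_⟩
  have d1 := dist1_nonneg w w'
  have d2 := dist1_nonneg z₁.1 z₂.1
  have h1 := abs_residual_sub_residual_le hb hab hQ hlam hlam1 (fun j => (hw j).1)
    (fun j => (hw' j).1) hz
  have h2 := abs_jetKer_le hb hab (fun j => (hw' j).1) hz hz₂ hMX i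
  have h3 := hjet w w' hw hw' z hz z₁ hz₁ z₂ hz₂ i
  have h4 : |residual μ lam Q w z| ≤ (1 + √m) * MY / lam ^ 2 := by
    refine (abs_residual_le hb hab hQ hlam hlam1 w hz).trans
      (div_le_div_of_nonneg_left (by positivity) (by positivity) ?_)
    refine Real.le_sqrt_of_sq_le ?_
    rw [← pow_mul]
    exact pow_le_of_le_one hlam.le hlam1 (by norm_num)
  have e1 : residual μ lam Q w' z * jetKer μ w' i z z₂ - residual μ lam Q w z * jetKer μ w i z z₁
      = (residual μ lam Q w' z - residual μ lam Q w z) * jetKer μ w' i z z₂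
        + residual μ lam Q w z * (jetKer μ w' i z z₂ - jetKer μ w i z z₁) := by ring
  rw [e1]
  refine (abs_add_le _ _).trans ?_
  rw [abs_mul, abs_mul]
  calc _ ≤ (1 + m) * (b * m * (2 * MX) * MY) / lam ^ 2 * dist1 w w' * (m + b * m * (2 * MX))
        + (1 + √m) * MY / lam ^ 2 * (K * (dist1 w w' + dist1 z₁.1 z₂.1)) := by gcongr
    _ ≤ (1 + m) * (b * m * (2 * MX) * MY) / lam ^ 2 * (dist1 w w' + dist1 z₁.1 z₂.1)
          * (m + b * m * (2 * MX))
        + (1 + √m) * MY / lam ^ 2 * (K * (dist1 w w' + dist1 z₁.1 z₂.1)) := by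
        gcongr
        linarith
    _ = _ := by ring

end UniformDeviation

section DeviationEvent

variable {p : ℕ} {μ : Measure ℝ} {a b MX MY lam M e : ℝ} {P Q : Measure ((Fin p → ℝ) × ℝ)}
  {w w' : Fin p → ℝ}

theorem exists_forall_mul_pow_mul_exp_le_one (A : ℝ) (k : ℕ) {c : ℝ} (hc : 0 < c) :
    ∃ l₁, 0 < l₁ ∧ ∀ lam, 0 < lam → lam ≤ l₁ → A * (1 / lam) ^ k * Real.exp (-(c / lam)) ≤ 1 := by
  have h := (tendsto_rpow_mul_exp_neg_mul_atTop_nhds_zero k c hc).const_mul A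
  rw [mul_zero] at h
  obtain ⟨x₀, hx₀⟩ := Filter.eventually_atTop.1 (h.eventually_le_const one_pos)
  refine ⟨(max x₀ 1)⁻¹, by positivity, fun lam hlam hle => ?_⟩
  have h1 : x₀ ≤ 1 / lam := by
    rw [le_div_iff₀ hlam]
    have h2 : max x₀ 1 * lam ≤ 1 := by
      have h3 := mul_le_mul_of_nonneg_left hle (by positivity : (0 : ℝ) ≤ max x₀ 1)
      rwa [mul_inv_cancel₀ (by positivity)] at h3
    exact (mul_le_mul_of_nonneg_right (le_max_left _ _) hlam.le).trans h2
  have h2 := hx₀ _ h1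
  rw [Real.rpow_natCast, ← mul_assoc] at h2
  convert! h2 using 3
  ring

variable [IsFiniteMeasure μ]

theorem measurable_residual_mul_jetKer (hb : 0 ≤ b) (hab : ∀ᵐ t ∂μ, t ∈ Set.Icc a b)
    (hw : ∀ j, 0 ≤ w j) (i : Option (Fin p)) (z : (Fin p → ℝ) × ℝ) :
    Measurable fun z' => residual μ lam Q w z' * jetKer μ w i z' z :=
  (continuous_residual hb hab).measurable.mul (measurable_jetKer_left hb hab hw i z)

theorem abs_integral_sub_integral_le [IsProbabilityMeasure P] {f g : (Fin p → ℝ) × ℝ → ℝ}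
    (hf : Integrable f P) (hg : Integrable g P) {δ : ℝ} (h : ∀ᵐ z ∂P, |f z - g z| ≤ δ) :
    |∫ z, f z ∂P - ∫ z, g z ∂P| ≤ δ := by
  rw [← integral_sub hf hg, ← Real.norm_eq_abs]
  exact (norm_integral_le_of_norm_le_const h).trans (by simp)

theorem integrable_residual_mul_jetKer [IsProbabilityMeasure P] (hb : 0 ≤ b)
    (hab : ∀ᵐ t ∂μ, t ∈ Set.Icc a b) (hP : ∀ᵐ z ∂P, z ∈ dataBox p MX MY) (hMX : 0 ≤ MX)
    (hw : ∀ j, 0 ≤ w j) (i : Option (Fin p)) {z : (Fin p → ℝ) × ℝ} (hz : z ∈ dataBox p MX MY) :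
    Integrable (fun z' => residual μ lam Q w z' * jetKer μ w i z' z) P := by
  refine (integrable_residual hb hab hP w).mul_bdd
    (c := μ.real Set.univ + b * μ.real Set.univ * (2 * MX))
    (measurable_jetKer_left hb hab hw i z).aestronglyMeasurable ?_
  filter_upwards [hP] with z' hz' using abs_jetKer_le hb hab hw hz' hz hMX i

variable [IsProbabilityMeasure Q]

/-- The deviation event for given parameters: a grid with `N` steps per coordinate is taken for the
weights and for the location. -/
theorem exists_measurableSet_of_grid (hb : 0 ≤ b) (hab : ∀ᵐ t ∂μ, t ∈ Set.Icc a b)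
    (hQ : ∀ᵐ z ∂Q, z ∈ dataBox p MX MY) (hMX : 0 ≤ MX) (hMY : 0 < MY) (hM : 0 ≤ M)
    (hμ : 0 < μ.real Set.univ) {K : ℝ} (hK : 0 ≤ K)
    (hlam : 0 < lam) (hlam1 : lam ≤ 1)
    (hlip : ∀ w w' : Fin p → ℝ, (∀ j, 0 ≤ w j ∧ w j ≤ M) → (∀ j, 0 ≤ w' j ∧ w' j ≤ M) →
      ∀ z ∈ dataBox p MX MY, ∀ z₁ ∈ dataBox p MX MY, ∀ z₂ ∈ dataBox p MX MY, ∀ i,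
        |residual μ lam Q w' z * jetKer μ w' i z z₂ - residual μ lam Q w z * jetKer μ w i z z₁|
          ≤ K * (dist1 w w' + dist1 z₁.1 z₂.1)) {n N : ℕ} (hn : 0 < n) (hN : 0 < N)
    (he : 0 ≤ e) {B : ℝ} (hB : B = (1 + √(μ.real Set.univ)) * MY
      * (μ.real Set.univ + b * μ.real Set.univ * (2 * MX))) :
    ∃ E : Set (Fin n → (Fin p → ℝ) × ℝ), MeasurableSet E ∧
      1 - ((N + 1) ^ p * ((N + 1) ^ p * (p + 1)) : ℝ)
          * (2 * Real.exp (-(n * e ^ 2 / (2 * (B / √lam) ^ 2))))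
        ≤ (Measure.pi fun _ : Fin n => Q).real E ∧
      ∀ d ∈ E, (∀ i, d i ∈ dataBox p MX MY) ∧ ∀ w : Fin p → ℝ, (∀ j, 0 ≤ w j ∧ w j ≤ M) →
        ∀ z ∈ dataBox p MX MY, ∀ i,
          |∫ z', residual μ lam Q w z' * jetKer μ w i z' z ∂empirical d
            - ∫ z', residual μ lam Q w z' * jetKer μ w i z' z ∂Q|
            ≤ e + 2 * (K * (p * (M / N) + p * (2 * MX / N))) := by
  let W : (Fin p → Fin (N + 1)) → Fin p → ℝ := gridPoint 0 M
  let X : (Fin p → Fin (N + 1)) → (Fin p → ℝ) × ℝ := fun k => (gridPoint (-MX) (2 * MX) k, 0)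
  have hW : ∀ k j, 0 ≤ W k j ∧ W k j ≤ M := fun k j =>
    ⟨(gridPoint_mem hM k j).1, by simpa using (gridPoint_mem (lo := 0) hM k j).2⟩
  have hX : ∀ k, X k ∈ dataBox p MX MY := fun k => by
    refine ⟨fun j => ?_, by simpa [X] using hMY.le⟩
    have := gridPoint_mem (lo := -MX) (show 0 ≤ 2 * MX by linarith) k j
    exact abs_le.2 ⟨this.1, by linarith [this.2]⟩
  let φ : (Fin p → Fin (N + 1)) × (Fin p → Fin (N + 1)) × Option (Fin p) →
      (Fin p → ℝ) × ℝ → ℝ := fun k z' =>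
    residual μ lam Q (W k.1) z' * jetKer μ (W k.1) k.2.2 z' (X k.2.1)
  have hs : 0 < √lam := Real.sqrt_pos.2 hlam
  have hB0 : 0 < B / √lam := by
    rw [hB]
    positivity
  have hφB : ∀ k, ∀ᵐ z ∂Q, |φ k z| ≤ B / √lam := fun k => by
    filter_upwards [hQ] with z hz
    rw [abs_mul, hB, mul_div_right_comm]
    exact mul_le_mul (abs_residual_le hb hab hQ hlam hlam1 _ hz)
      (abs_jetKer_le hb hab (fun j => (hW _ j).1) hz (hX _) hMX _) (abs_nonneg _) (by positivity)
  obtain ⟨E, hE, hprob, hdev⟩ := exists_measurableSet_deviation_le (φ := φ) (n := n)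
    (fun k => measurable_residual_mul_jetKer hb hab (fun j => (hW _ j).1) _ _) hB0 hφB
    measurableSet_dataBox hQ hn he
  refine ⟨E, hE, ?_, fun d hd => ⟨(hdev d hd).1, fun w hw z hz i => ?_⟩⟩
  · convert! hprob using 3
    simp
  · have := isProbabilityMeasure_empirical (d := d) hn
    have hP := ae_empirical_mem measurableSet_dataBox (hdev d hd).1
    obtain ⟨k, hk⟩ := exists_dist1_gridPoint_le (lo := 0) (len := M) (x := w) hN (by simpa using hw)
    obtain ⟨k', hk'⟩ := exists_dist1_gridPoint_le (lo := -MX) (len := 2 * MX) (x := z.1) hN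
      (fun j => by
        have := abs_le.1 (hz.1 j)
        exact ⟨this.1, by linarith [this.2]⟩)
    have h1 := (hdev d hd).2 (k, k', i)
    rw [← integral_empirical] at h1
    have hdiff : ∀ z' ∈ dataBox p MX MY,
        |residual μ lam Q w z' * jetKer μ w i z' z - φ (k, k', i) z'|
          ≤ K * (p * (M / N) + p * (2 * MX / N)) := fun z' hz' =>
      (hlip (W k) w (hW k) hw z' hz' (X k') (hX k') z hz i).trans
        (mul_le_mul_of_nonneg_left (add_le_add hk hk') hK)
    have h2 := abs_integral_sub_integral_le (P := empirical d)
      (integrable_residual_mul_jetKer hb hab hP hMX (fun j => (hw j).1) i hz)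
      (integrable_residual_mul_jetKer hb hab hP hMX (fun j => (hW k j).1) i (hX k'))
      (hP.mono hdiff)
    have h3 := abs_integral_sub_integral_le (P := Q)
      (integrable_residual_mul_jetKer hb hab hQ hMX (fun j => (hw j).1) i hz)
      (integrable_residual_mul_jetKer hb hab hQ hMX (fun j => (hW k j).1) i (hX k'))
      (hQ.mono hdiff)
    simp only [φ] at h1
    rw [abs_le] at h1 h2 h3 ⊢
    constructor <;> linarith [h1.1, h1.2, h2.1, h2.2, h3.1, h3.2]

/-- With probability at least `1 - exp(-c n λ⁸)`, all the empirical averages that enter the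
comparison of gradients are within `η λ³` of their expectations. -/
theorem exists_deviation_event (hb : 0 ≤ b) (hab : ∀ᵐ t ∂μ, t ∈ Set.Icc a b)
    (hQ : ∀ᵐ z ∂Q, z ∈ dataBox p MX MY) (hMX : 0 ≤ MX) (hMY : 0 < MY) (hM : 0 ≤ M)
    (hμ : 0 < μ.real Set.univ) {η : ℝ} (hη : 0 < η) :
    ∃ c l₁, 0 < c ∧ 0 < l₁ ∧ ∀ (n : ℕ) (lam : ℝ), 0 < lam → lam ≤ l₁ → lam ≤ 1 →
      1 ≤ n * lam ^ 8 →
      ∃ E : Set (Fin n → (Fin p → ℝ) × ℝ), MeasurableSet E ∧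
        1 - Real.exp (-(c * n * lam ^ 8)) ≤ (Measure.pi fun _ : Fin n => Q).real E ∧
        ∀ d ∈ E, (∀ i, d i ∈ dataBox p MX MY) ∧ ∀ w : Fin p → ℝ, (∀ j, 0 ≤ w j ∧ w j ≤ M) →
          ∀ z ∈ dataBox p MX MY, ∀ i,
            |∫ z', residual μ lam Q w z' * jetKer μ w i z' z ∂empirical d
              - ∫ z', residual μ lam Q w z' * jetKer μ w i z' z ∂Q| ≤ η * lam ^ 3 := by
  obtain ⟨K, hK, hlip⟩ := exists_abs_residual_mul_jetKer_sub_le (p := p) hb hab hQ hMX hMY.le hM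
  set B := (1 + √(μ.real Set.univ)) * MY
      * (μ.real Set.univ + b * μ.real Set.univ * (2 * MX)) with hB
  have hB0 : 0 < B := by positivity
  set c := η ^ 2 / (16 * B ^ 2) with hc
  have hc0 : 0 < c := by positivity
  -- the number of grid steps is of order `λ⁻⁵`
  set K' := 4 * (K * (p * M + p * (2 * MX))) / η with hK'
  have hK'0 : 0 ≤ K' := by positivity
  obtain ⟨l₁, hl₁, hexp⟩ := exists_forall_mul_pow_mul_exp_le_one
    ((K' + 3) ^ p * ((K' + 3) ^ p * (p + 1)) * 2) (5 * p + 5 * p) hc0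
  refine ⟨c, l₁, hc0, hl₁, fun n lam hlam hle hlam1 hnl => ?_⟩
  have hn : 0 < n := by
    rcases Nat.eq_zero_or_pos n with h | h
    · subst h
      norm_num at hnl
    · exact h
  set N := ⌈K' / lam ^ 5⌉₊ + 1 with hNdef
  have hN : 0 < N := Nat.succ_pos _
  have hN0 : (0 : ℝ) < N := by exact_mod_cast hN
  have hl5 : (1 : ℝ) ≤ 1 / lam ^ 5 := (one_le_div (by positivity)).2 (pow_le_one₀ hlam.le hlam1)
  have hNle : (N + 1 : ℝ) ≤ (K' + 3) * (1 / lam) ^ 5 := by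
    have h1 := (Nat.ceil_lt_add_one (show 0 ≤ K' / lam ^ 5 by positivity)).le
    have h2 : (N : ℝ) = ⌈K' / lam ^ 5⌉₊ + 1 := by rw [hNdef]; push_cast; ring
    have h3 : (K' + 3) * (1 / lam) ^ 5 = K' / lam ^ 5 + 3 * (1 / lam ^ 5) := by
      rw [one_div_pow]
      ring
    rw [h2, h3]
    linarith
  have hNge : K' / lam ^ 5 ≤ N := by
    have h1 := Nat.le_ceil (K' / lam ^ 5)
    have h2 : (N : ℝ) = ⌈K' / lam ^ 5⌉₊ + 1 := by rw [hNdef]; push_cast; ring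
    linarith
  obtain ⟨E, hE, hprob, hdev⟩ := exists_measurableSet_of_grid (e := η * lam ^ 3 / 2) hb hab hQ hMX
    hMY hM hμ (show 0 ≤ K / lam ^ 2 by positivity) hlam hlam1 (hlip lam hlam hlam1) hn hN
    (by positivity) hB
  refine ⟨E, hE, le_trans ?_ hprob, fun d hd => ⟨(hdev d hd).1, fun w hw z hz i =>
    ((hdev d hd).2 w hw z hz i).trans ?_⟩⟩
  · refine sub_le_sub_left ?_ 1
    have e1 : n * (η * lam ^ 3 / 2) ^ 2 / (2 * (B / √lam) ^ 2) = 2 * c * (n * lam ^ 8) / lam := by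
      rw [div_pow B, Real.sq_sqrt hlam.le, hc]
      field_simp
      ring
    have e2 : c * n * lam ^ 8 + c / lam ≤ 2 * c * (n * lam ^ 8) / lam := by
      rw [le_div_iff₀ hlam, add_mul, div_mul_cancel₀ _ hlam.ne']
      have h1 : c * (n * lam ^ 8) * lam ≤ c * (n * lam ^ 8) :=
        mul_le_of_le_one_right (by positivity) hlam1
      have h2 : c * 1 ≤ c * (n * lam ^ 8) := mul_le_mul_of_nonneg_left hnl hc0.le
      linarith
    rw [e1]
    calc ((N + 1) ^ p * ((N + 1) ^ p * (p + 1)) : ℝ)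
          * (2 * Real.exp (-(2 * c * (n * lam ^ 8) / lam)))
        ≤ (((K' + 3) * (1 / lam) ^ 5) ^ p * (((K' + 3) * (1 / lam) ^ 5) ^ p * (p + 1)))
          * (2 * Real.exp (-(c * n * lam ^ 8 + c / lam))) := by gcongr
      _ = ((K' + 3) ^ p * ((K' + 3) ^ p * (p + 1)) * 2 * (1 / lam) ^ (5 * p + 5 * p)
            * Real.exp (-(c / lam))) * Real.exp (-(c * n * lam ^ 8)) := by
          rw [neg_add, Real.exp_add, mul_pow, ← pow_mul, pow_add]
          ring
      _ ≤ _ := mul_le_of_le_one_left (Real.exp_pos _).le (hexp lam hlam hle)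
  · have h1 : 4 * (K * (p * M + p * (2 * MX))) ≤ N * (η * lam ^ 5) := by
      rw [hK', div_div, div_le_iff₀ (by positivity)] at hNge
      exact hNge
    have h2 : 2 * (K / lam ^ 2 * (p * (M / N) + p * (2 * MX / N)))
        = 4 * (K * (p * M + p * (2 * MX))) / (2 * lam ^ 2 * N) := by
      field_simp
      ring
    have h3 : 4 * (K * (p * M + p * (2 * MX))) / (2 * lam ^ 2 * N) ≤ η * lam ^ 3 / 2 := by
      rw [div_le_iff₀ (by positivity)]
      exact h1.trans_eq (by ring)
    linarith

end DeviationEvent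

/-! ### Selection by the flow of an approximating distribution -/

section Selection

variable {p : ℕ} {μ : Measure ℝ} {a b MX MY lam M e : ℝ} {P Q : Measure ((Fin p → ℝ) × ℝ)}
  {w : Fin p → ℝ} {S : Finset (Fin p)}

/-- The weights with the coordinates outside `S` set to zero. -/
def truncate (S : Finset (Fin p)) (w : Fin p → ℝ) (j : Fin p) : ℝ := if j ∈ S then w j else 0

theorem dist1_truncate (hw : ∀ j, 0 ≤ w j) : dist1 (truncate S w) w = ∑ l ∈ Sᶜ, w l := by
  rw [dist1, ← Finset.sum_compl_add_sum S]
  have h1 : ∑ j ∈ S, |w j - truncate S w j| = 0 :=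
    Finset.sum_eq_zero fun j hj => by simp [truncate, hj]
  rw [h1, add_zero]
  refine Finset.sum_congr rfl fun j hj => ?_
  rw [truncate, if_neg (Finset.mem_compl.1 hj), sub_zero, abs_of_nonneg (hw j)]

theorem truncate_mem (hM : 0 ≤ M) (hw : ∀ j, 0 ≤ w j ∧ w j ≤ M) (j : Fin p) :
    0 ≤ truncate S w j ∧ truncate S w j ≤ M := by
  rw [truncate]
  split_ifs
  · exact hw j
  · exact ⟨le_rfl, hM⟩

theorem eventually_mul_lt (X : ℝ) {Y : ℝ} (hY : 0 < Y) :
    ∀ᶠ η in nhdsWithin (0 : ℝ) (Set.Ioi 0), η * X < Y := by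
  have h : Filter.Tendsto (fun η : ℝ => η * X) (nhds 0) (nhds (0 * X)) :=
    (continuous_id.mul continuous_const).tendsto 0
  rw [zero_mul] at h
  exact (h.mono_left nhdsWithin_le_nhds).eventually_lt_const hY

variable [IsFiniteMeasure μ]

theorem krrObjective_le (hlam : 0 ≤ lam) (x : EuclideanSpace ℝ (Fin p)) :
    krrObjective μ lam P x ≤ (1 / 2) * ∫ z, z.2 ^ 2 ∂P := by
  refine (ciInf_le ⟨0, ?_⟩ (0 : KernelSpace p μ)).trans_eq (by simp)
  rintro _ ⟨f, rfl⟩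
  have : 0 ≤ ∫ z, (z.2 - f (fun j => x j * z.1 j)) ^ 2 ∂P := integral_nonneg fun _ => sq_nonneg _
  positivity

variable [IsProbabilityMeasure P] [IsProbabilityMeasure Q]

/-- If the objective for `P` at `x` is below its value at the origin by `δ`, then the population
ridge estimator at the truncated weights is not small. -/
theorem le_norm_ridge_of_objective_le (hb : 0 ≤ b) (hab : ∀ᵐ t ∂μ, t ∈ Set.Icc a b)
    (hP : ∀ᵐ z ∂P, z ∈ dataBox p MX MY) (hQ : ∀ᵐ z ∂Q, z ∈ dataBox p MX MY) (hlam : 0 < lam)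
    {x : EuclideanSpace ℝ (Fin p)} (hM : 0 ≤ M) (hx : x ∈ box p M)
    (hd : ∀ z ∈ dataBox p MX MY,
      |∫ z', residual μ lam Q (truncate S x.ofLp) z' * wker μ (truncate S x.ofLp) z' z ∂P
      - ∫ z', residual μ lam Q (truncate S x.ofLp) z' * wker μ (truncate S x.ofLp) z' z ∂Q| ≤ e)
    {δ : ℝ} (hδ : krrObjective μ lam P x ≤ krrObjective μ lam P 0 - δ) :
    2 * δ ≤ MY * (√(μ.real Set.univ) * ‖ridge μ lam Q (truncate S x.ofLp)‖ + lam⁻¹ * e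
      + lam⁻¹ * (b * μ.real Set.univ * (2 * MX) * (∑ l ∈ Sᶜ, x l) * MY)) := by
  set xS := truncate S x.ofLp with hxS
  have hxS0 : ∀ j, 0 ≤ xS j := fun j => (truncate_mem hM hx j).1
  obtain ⟨z₀, hz₀⟩ := hP.exists
  have hMY : 0 ≤ MY := (abs_nonneg _).trans hz₀.2
  have hY := integrable_snd hP
  have hr := memLp_residual (lam := lam) (P' := P) hb hab hP x.ofLp
  have hri : Integrable (residual μ lam P x.ofLp) P := hr.integrable (by norm_num)
  have hrS := integrable_residual (lam := lam) (P' := P) hb hab hP xS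
  have hqS := integrable_residual (lam := lam) (P' := Q) hb hab hP xS
  have hY2 := memLp_snd hP
  have i1 : Integrable (fun z => z.2 * residual μ lam P x.ofLp z) P := hY2.integrable_mul hr
  have i2 : Integrable (fun z : (Fin p → ℝ) × ℝ => z.2 ^ 2) P := hY2.integrable_sq
  have h1 : 2 * δ ≤ ∫ z, (z.2 - residual μ lam P x.ofLp z) * z.2 ∂P := by
    have h0 := krrObjective_le (μ := μ) (P := P) hlam.le (0 : EuclideanSpace ℝ (Fin p))
    rw [krrObjective_eq hb hab hP hlam x] at hδ
    have e1 : ∫ z, (z.2 - residual μ lam P x.ofLp z) * z.2 ∂P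
        = ∫ z, z.2 ^ 2 ∂P - ∫ z, z.2 * residual μ lam P x.ofLp z ∂P := by
      rw [← integral_sub i2 i1]
      exact integral_congr_ae (ae_of_all _ fun z => by ring)
    rw [e1]
    linarith
  have h2 : ∫ z, (z.2 - residual μ lam P x.ofLp z) * z.2 ∂P
      ≤ MY * ∫ z, |z.2 - residual μ lam P x.ofLp z| ∂P :=
    (le_abs_self _).trans (abs_integral_mul_le (hY.sub hri) (ae_abs_snd_le hP))
  have h3 : ∫ z, |z.2 - residual μ lam P x.ofLp z| ∂P
      ≤ ∫ z, |z.2 - residual μ lam Q xS z| ∂P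
        + ∫ z, |residual μ lam P xS z - residual μ lam Q xS z| ∂P
        + ∫ z, |residual μ lam P x.ofLp z - residual μ lam P xS z| ∂P := by
    have a1 : Integrable (fun z => |z.2 - residual μ lam Q xS z|) P := (hY.sub hqS).abs
    have a2 : Integrable (fun z => |residual μ lam P xS z - residual μ lam Q xS z|) P :=
      (hrS.sub hqS).abs
    have a3 : Integrable (fun z => |residual μ lam P x.ofLp z - residual μ lam P xS z|) P :=
      (hri.sub hrS).abs
    have a12 : Integrable (fun z => |z.2 - residual μ lam Q xS z|
      + |residual μ lam P xS z - residual μ lam Q xS z|) P := a1.add a2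
    rw [← integral_add a1 a2, ← integral_add a12 a3]
    refine integral_mono (hY.sub hri).abs (a12.add a3) fun z => ?_
    have t1 := abs_sub_le z.2 (residual μ lam Q xS z) (residual μ lam P x.ofLp z)
    have t2 := abs_sub_le (residual μ lam Q xS z) (residual μ lam P xS z)
      (residual μ lam P x.ofLp z)
    have t3 := abs_sub_comm (residual μ lam Q xS z) (residual μ lam P xS z)
    have t4 := abs_sub_comm (residual μ lam P xS z) (residual μ lam P x.ofLp z)
    dsimp only
    linarith
  have h4 : ∫ z, |z.2 - residual μ lam Q xS z| ∂P
      ≤ √(μ.real Set.univ) * ‖ridge μ lam Q xS‖ :=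
    (integral_mono (hY.sub hqS).abs (integrable_const _) fun z => abs_fit_le z).trans (by simp)
  have h5 := integral_abs_residual_sub_le_of_deviation hb hab hP hQ hlam hxS0 hd
  have h6 := integral_abs_residual_sub_residual_le hb hab hP hlam hxS0 fun j => (hx j).1
  rw [dist1_truncate fun j => (hx j).1] at h6
  refine h1.trans (h2.trans (mul_le_mul_of_nonneg_left ?_ hMY))
  linarith

theorem abs_krrGradient_sub_le_of_deviation_cube (hb : 0 ≤ b) (hab : ∀ᵐ t ∂μ, t ∈ Set.Icc a b)
    (hP : ∀ᵐ z ∂P, z ∈ dataBox p MX MY) (hQ : ∀ᵐ z ∂Q, z ∈ dataBox p MX MY) (hMX : 0 ≤ MX)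
    (hlam : 0 < lam) (hlam1 : lam ≤ 1) (hw : ∀ j, 0 ≤ w j) {η : ℝ} (hη : 0 ≤ η) (hη1 : η ≤ 1)
    (hd : ∀ z ∈ dataBox p MX MY, |∫ z', residual μ lam Q w z' * wker μ w z' z ∂P
      - ∫ z', residual μ lam Q w z' * wker μ w z' z ∂Q| ≤ η * lam ^ 3) {l : Fin p}
    (hdl : ∀ z ∈ dataBox p MX MY, |∫ z', residual μ lam Q w z' * gker μ w l z' z ∂P
      - ∫ z', residual μ lam Q w z' * gker μ w l z' z ∂Q| ≤ η * lam ^ 3) :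
    |krrGradient μ lam P w l - krrGradient μ lam Q w l|
      ≤ η * ((2 * MY + 1) * (b * μ.real Set.univ * (2 * MX) + 1) / 2) * lam := by
  obtain ⟨z₀, hz₀⟩ := hP.exists
  have hMY : 0 ≤ MY := (abs_nonneg _).trans hz₀.2
  refine (abs_krrGradient_sub_le_of_deviation hb hab hP hQ hlam hw hd hdl).trans ?_
  have h1 : lam⁻¹ * (η * lam ^ 3) ≤ 1 := by
    have : lam⁻¹ * (η * lam ^ 3) = η * lam ^ 2 := by field_simp
    rw [this]
    exact mul_le_one₀ hη1 (by positivity) (pow_le_one₀ hlam.le hlam1)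
  have h2 : (1 : ℝ) ≤ lam⁻¹ := (one_le_inv₀ hlam).2 hlam1
  set c := b * μ.real Set.univ * (2 * MX) with hc
  have hc0 : 0 ≤ c := by positivity
  calc (2 * lam)⁻¹ * (η * lam ^ 3 * (2 * MY + lam⁻¹ * (η * lam ^ 3)) * (lam⁻¹ * c + 1))
      ≤ (2 * lam)⁻¹ * (η * lam ^ 3 * (2 * MY + 1) * (lam⁻¹ * c + lam⁻¹)) := by gcongr
    _ = η * ((2 * MY + 1) * (c + 1) / 2) * lam := by field_simp

theorem abs_krrGradient_sub_le_div_sq (hb : 0 ≤ b) (hab : ∀ᵐ t ∂μ, t ∈ Set.Icc a b)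
    (hP : ∀ᵐ z ∂P, z ∈ dataBox p MX MY) (hlam : 0 < lam) (hlam1 : lam ≤ 1) {w' : Fin p → ℝ}
    (hw : ∀ j, 0 ≤ w j) (hw' : ∀ j, 0 ≤ w' j) (l : Fin p) :
    |krrGradient μ lam P w' l - krrGradient μ lam P w l|
      ≤ (b ^ 2 * μ.real Set.univ * (2 * MX) ^ 2 * MY ^ 2 / 2
        + (b * μ.real Set.univ * (2 * MX) * MY) ^ 2) / lam ^ 2 * dist1 w w' := by
  refine (abs_krrGradient_sub_le hb hab hP hlam hw hw' l).trans
    (mul_le_mul_of_nonneg_right ?_ (dist1_nonneg _ _))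
  set c₁ := b * μ.real Set.univ * (2 * MX) with hc₁
  set c₂ := b ^ 2 * μ.real Set.univ * (2 * MX) ^ 2 with hc₂
  have hc₂0 : 0 ≤ c₂ := by positivity
  have h1 : (2 * lam)⁻¹ * (c₂ * MY ^ 2 + 2 * lam⁻¹ * (c₁ * MY) ^ 2)
      = (c₂ * MY ^ 2 / 2 * lam + (c₁ * MY) ^ 2) / lam ^ 2 := by field_simp
  rw [h1]
  gcongr
  exact mul_le_of_le_one_right (by positivity) hlam1

/-- For a distribution `P` that is close to `Q`, with closeness of order `λ³`, every trajectory of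
the gradient flow is supported in the signal set, and nonzero, after a time that does not depend on
`λ`. -/
theorem exists_selection_constants (ha : 0 < a) (hb : 0 ≤ b) (hab : ∀ᵐ t ∂μ, t ∈ Set.Icc a b)
    (hQ : ∀ᵐ z ∂Q, z ∈ dataBox p MX MY) (hMX : 0 ≤ MX) (hMY : 0 < MY) (hM : 0 < M) (hμ : μ ≠ 0)
    (hQ0 : ∫ z, z.2 ∂Q = 0) (hvar : ∀ j, 0 < variance (fun z : (Fin p → ℝ) × ℝ => z.1 j) Q)
    (hS : IsSignalCandidate Q S) {l₀ : Fin p} (hl₀ : l₀ ∈ mainEffects Q S) :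
    ∃ η τ, 0 < η ∧ 0 < τ ∧ ∀ lam, 0 < lam → lam ≤ 1 →
      ∀ P : Measure ((Fin p → ℝ) × ℝ), IsProbabilityMeasure P → (∀ᵐ z ∂P, z ∈ dataBox p MX MY) →
      (∀ w : Fin p → ℝ, (∀ j, 0 ≤ w j ∧ w j ≤ M) → ∀ z ∈ dataBox p MX MY, ∀ i,
        |∫ z', residual μ lam Q w z' * jetKer μ w i z' z ∂P
          - ∫ z', residual μ lam Q w z' * jetKer μ w i z' z ∂Q| ≤ η * lam ^ 3) →
      ∀ β : ℝ → EuclideanSpace ℝ (Fin p), β 0 = 0 →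
        IsGradientFlow (krrObjective μ lam P) (box p M) β →
        ∀ t, τ ≤ t → (supp (β t)).Nonempty ∧ supp (β t) ⊆ S := by
  set m := μ.real Set.univ with hm
  have hm0 : 0 < m := by
    rw [hm, measureReal_def]
    exact ENNReal.toReal_pos (by simpa using hμ) (measure_ne_top _ _)
  set c₁ := b * m * (2 * MX) with hc₁
  set c₂ := b ^ 2 * m * (2 * MX) ^ 2 with hc₂
  have hc₁0 : 0 ≤ c₁ := by positivity
  have hc₂0 : 0 ≤ c₂ := by positivity
  set c₃ := (2 * MY + 1) * (c₁ + 1) / 2 with hc₃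
  have hc₃0 : 0 ≤ c₃ := by positivity
  set D₀ := c₁ * MY ^ 2 / 2 with hD₀
  have hD₀0 : 0 ≤ D₀ := by positivity
  set L₀ := c₂ * MY ^ 2 / 2 + (c₁ * MY) ^ 2 with hL₀
  have hL₀0 : 0 ≤ L₀ := by positivity
  -- the steep initial slope in direction `l₀` is `-g / λ` for the population
  set g := -(slope μ 0
    * pairing Q (fun z z' => |z.1 l₀ - z'.1 l₀|) (fun z => z.2) (fun z => z.2)) / 2 with hg
  have hg0 : 0 < g := by
    have h1 := pairing_neg_of_mem_mainEffects hQ hQ0 hl₀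
    have h2 := slope_zero_pos ha hab hμ
    have h3 := mul_neg_of_pos_of_neg h2 h1
    rw [hg]
    linarith
  -- the first phase lasts until `τ₁ λ²` and lowers the objective by `δ`
  obtain ⟨τ₁, ⟨⟨hτL, hτM⟩, hτp⟩, hτ0⟩ := (((eventually_mul_lt (L₀ * (p * D₀))
    (show 0 < g / 4 by positivity)).and (eventually_mul_lt D₀ hM)).and
    (eventually_mul_lt (p * L₀) (show (0 : ℝ) < 1 / 4 by norm_num))).and self_mem_nhdsWithin
    |>.exists
  have hτ0 : 0 < τ₁ := hτ0
  set δ := g ^ 2 * τ₁ / 16 with hδ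
  have hδ0 : 0 < δ := by positivity
  obtain ⟨v, hv0, hv⟩ : ∃ v, 0 < v ∧ ∀ l, v ≤ meanAbsDiff Q l := by
    have : Nonempty (Fin p) := ⟨l₀⟩
    obtain ⟨l, hl⟩ := Finite.exists_min (meanAbsDiff Q)
    exact ⟨_, meanAbsDiff_pos hQ (hvar l), hl⟩
  -- `R₀ λ` bounds the population derivatives outside `S` from below in the second phase
  set R₀ := a * v / 2 * ((δ / MY) ^ 2 / m) with hR₀
  have hR₀0 : 0 < R₀ := by positivity
  -- the total weight outside `S` is kept below `k λ³`
  obtain ⟨k, ⟨hkδ, hkR⟩, hk0⟩ := ((eventually_mul_lt (c₁ * MY)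
    (show 0 < δ / (2 * MY) by positivity)).and
    (eventually_mul_lt L₀ (show 0 < R₀ / 4 by positivity))).and self_mem_nhdsWithin |>.exists
  have hk0 : 0 < k := hk0
  obtain ⟨η, ⟨⟨⟨⟨hη1, hηg⟩, hηk⟩, hηδ⟩, hηR⟩, hη0⟩ := (((((eventually_mul_lt 1 one_pos).and
    (eventually_mul_lt c₃ (show 0 < g / 2 by positivity))).and
    (eventually_mul_lt (p * c₃ * τ₁) (show 0 < k / 4 by positivity))).and
    (eventually_mul_lt 1 (show 0 < δ / (2 * MY) by positivity))).and
    (eventually_mul_lt c₃ (show 0 < R₀ / 4 by positivity))).and self_mem_nhdsWithin |>.exists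
  have hη0 : 0 < η := hη0
  rw [mul_one] at hη1 hηδ
  refine ⟨η, τ₁ + 2 * k / R₀, hη0, by positivity,
    fun lam hlam hlam1 P hPp hP hdev β hβ0 hβ t ht => ?_⟩
  have hlam2 : lam ^ 2 ≤ 1 := pow_le_one₀ hlam.le hlam1
  have hgrad : ∀ x ∈ box p M, HasGradientWithinAt (krrObjective μ lam P)
      (WithLp.toLp 2 (krrGradient μ lam P x.ofLp)) (box p M) x := fun x hx =>
    hasGradientWithinAt_krrObjective hb hab hP hlam hx
  obtain ⟨γ, u, hγβ, htraj⟩ := hβ.exists_isBoxTrajectory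
    (G := fun x => krrGradient μ lam P x.ofLp) hM hgrad hβ0
  -- comparison of the gradients of `P` and `Q`
  have hcmp : ∀ w : Fin p → ℝ, (∀ j, 0 ≤ w j ∧ w j ≤ M) → ∀ l,
      |krrGradient μ lam P w l - krrGradient μ lam Q w l| ≤ η * c₃ * lam := fun w hw l => by
    rw [hc₃]
    exact abs_krrGradient_sub_le_of_deviation_cube hb hab hP hQ hMX hlam hlam1 (fun j => (hw j).1)
      hη0.le hη1.le (fun z hz => hdev w hw z hz none) (fun z hz => hdev w hw z hz (some l))
  have hcmp1 : η * c₃ * lam ≤ η * c₃ := mul_le_of_le_one_right (by positivity) hlam1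
  have hL : ∀ x ∈ box p M, ∀ y ∈ box p M, ∀ j,
      |krrGradient μ lam P y.ofLp j - krrGradient μ lam P x.ofLp j|
        ≤ L₀ / lam ^ 2 * dist1 x.ofLp y.ofLp := fun x hx y hy j => by
    rw [hL₀]
    exact abs_krrGradient_sub_le_div_sq hb hab hP hlam hlam1 (fun i => (hx i).1)
      (fun i => (hy i).1) j
  have htrunc : ∀ x ∈ box p M, WithLp.toLp 2 (truncate S x.ofLp) ∈ box p M := fun x hx j =>
    truncate_mem hM.le hx j
  -- truncation of the weights changes the partial derivatives by a multiple of `κ / λ²`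
  have hcore : ∀ x ∈ box p M, ∑ l ∈ Sᶜ, x l ≤ k * lam ^ 3 → ∀ l,
      krrGradient μ lam Q (truncate S x.ofLp) l - η * c₃ * lam - L₀ * k * lam
        ≤ krrGradient μ lam P x.ofLp l := fun x hx hsum l => by
    have h1 := hL _ (htrunc x hx) x hx l
    rw [dist1_truncate fun j => (hx j).1] at h1
    have h2 := hcmp _ (truncate_mem (S := S) hM.le hx) l
    have h3 : L₀ / lam ^ 2 * ∑ l ∈ Sᶜ, x.ofLp l ≤ L₀ * k * lam := by
      refine (mul_le_mul_of_nonneg_left hsum (by positivity)).trans_eq ?_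
      field_simp
    have h4 := abs_le.1 (h1.trans h3)
    have h5 := abs_le.1 h2
    dsimp only at h4
    linarith only [h4.1, h5.1]
  have hnoise : ∀ x ∈ box p M, ∀ l ∈ Sᶜ,
      a * v / 2 * lam * ‖ridge μ lam Q (truncate S x.ofLp)‖ ^ 2
        ≤ krrGradient μ lam Q (truncate S x.ofLp) l := fun x hx l hl => by
    refine le_trans ?_ (krrGradient_noise_ge ha.le hb hab hQ hlam
      (fun j => (truncate_mem hM.le hx j).1) hS (fun j hj => if_neg hj) (Finset.mem_compl.1 hl))
    gcongr
    exact hv l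
  have h0box : ∀ j : Fin p, (0 : ℝ) ≤ (0 : Fin p → ℝ) j ∧ (0 : Fin p → ℝ) j ≤ M := fun _ =>
    ⟨le_rfl, hM.le⟩
  have hg₀ : 0 < g / (2 * lam) := by positivity
  have hδ' : (g / (2 * lam) / 2) ^ 2 * (τ₁ * lam ^ 2) = δ := by
    rw [hδ]
    field_simp
    norm_num
  have hmain := htraj.supp_subset (S := S) (D := D₀ / lam) (K := D₀ / lam) (L := L₀ / lam ^ 2)
    (g₀ := g / (2 * lam)) (t₁ := τ₁ * lam ^ 2) (A := (η * c₃ + L₀ * k) * lam) (κ := k * lam ^ 3)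
    (ρ := R₀ / 2 * lam) (l₀ := l₀) (t := t) ((hγβ 0 le_rfl).trans hβ0) hgrad
    (fun x hx j => (abs_krrGradient_le hb hab hP hlam (fun i => (hx i).1) j).trans_eq (by
      rw [hD₀, hc₁, hm]
      field_simp))
    (fun x hx y hy => (abs_krrObjective_sub_le hb hab hP hlam hx hy).trans_eq (by
      rw [hD₀, hc₁, hm]
      field_simp))
    (by positivity) hL (by positivity) hg₀ ?_ (by positivity) ?_ ?_ (by positivity) (by positivity)
    ?_ (by positivity) ?_ ?_ ?_
  · rwa [hγβ t (le_trans (by positivity) ht)] at hmain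
  · have h1 := (abs_le.1 (hcmp 0 h0box l₀)).2
    rw [krrGradient_zero hb hab hQ hQ0 hlam] at h1
    have h2 : (2 * lam)⁻¹ * (slope μ 0
        * pairing Q (fun z z' => |z.1 l₀ - z'.1 l₀|) (fun z => z.2) (fun z => z.2))
          = -(g / lam) := by
      rw [hg]
      field_simp
    rw [h2] at h1
    have h3 : g / lam = g / (2 * lam) + g / (2 * lam) := by
      field_simp
      norm_num
    have h4 : g / 2 ≤ g / (2 * lam) := by
      rw [← div_div]
      exact le_div_self (by positivity) hlam hlam1
    show krrGradient μ lam P 0 l₀ ≤ _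
    linarith
  · have h1 : L₀ / lam ^ 2 * (p * (D₀ / lam * (τ₁ * lam ^ 2))) = τ₁ * (L₀ * (p * D₀)) / lam := by
      field_simp
    have h2 : g / (2 * lam) / 2 = g / 4 / lam := by
      field_simp
      norm_num
    rw [h1, h2]
    gcongr
  · have h1 : D₀ / lam * (τ₁ * lam ^ 2) = τ₁ * D₀ * lam := by field_simp
    rw [h1]
    exact (mul_le_of_le_one_right (by positivity) hlam1).trans_lt hτM
  · have h1 : p * ((η * c₃ + L₀ * k) * lam * (τ₁ * lam ^ 2))
        = (η * (p * c₃ * τ₁) + k * (τ₁ * (p * L₀))) * lam ^ 3 := by ring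
    rw [h1]
    have h2 := mul_lt_mul_of_pos_left hτp hk0
    exact mul_lt_mul_of_pos_right (by linarith) (by positivity)
  · intro x hx hsum l hl
    have h1 := hcore x hx hsum l
    have h2 := hnoise x hx l hl
    have h3 : 0 ≤ a * v / 2 * lam * ‖ridge μ lam Q (truncate S x.ofLp)‖ ^ 2 := by positivity
    dsimp only
    linarith
  · intro x hx hsum hF l hl
    rw [hδ'] at hF
    have h1 := hcore x hx hsum l
    have h2 := hnoise x hx l hl
    have h3 := le_norm_ridge_of_objective_le (S := S) hb hab hP hQ hlam hM.le hx
      (fun z hz => hdev _ (truncate_mem hM.le hx) z hz none) hF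
    set N := ‖ridge μ lam Q (truncate S x.ofLp)‖ with hN
    have h4 : lam⁻¹ * (η * lam ^ 3) ≤ δ / (2 * MY) := by
      have : lam⁻¹ * (η * lam ^ 3) = η * lam ^ 2 := by field_simp
      rw [this]
      exact (mul_le_of_le_one_right hη0.le hlam2).trans hηδ.le
    have h5 : lam⁻¹ * (c₁ * (∑ l ∈ Sᶜ, x l) * MY) ≤ δ / (2 * MY) := by
      calc lam⁻¹ * (c₁ * (∑ l ∈ Sᶜ, x l) * MY) ≤ lam⁻¹ * (c₁ * (k * lam ^ 3) * MY) := by gcongr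
        _ = k * (c₁ * MY) * lam ^ 2 := by field_simp
        _ ≤ _ := (mul_le_of_le_one_right (by positivity) hlam2).trans hkδ.le
    have h6 : δ / MY ≤ √m * N := by
      have e1 : MY * (δ / (2 * MY)) = δ / 2 := by field_simp
      have h7 : 2 * δ ≤ MY * (√m * N) + MY * (δ / (2 * MY)) + MY * (δ / (2 * MY)) := by
        rw [← mul_add, ← mul_add]
        refine h3.trans (mul_le_mul_of_nonneg_left ?_ hMY.le)
        linarith
      rw [div_le_iff₀ hMY]
      linarith
    have h7 : (δ / MY) ^ 2 / m ≤ N ^ 2 := by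
      rw [div_le_iff₀ hm0]
      refine (pow_le_pow_left₀ (by positivity) h6 2).trans_eq ?_
      rw [mul_pow, Real.sq_sqrt hm0.le, mul_comm]
    have h8 : R₀ * lam ≤ a * v / 2 * lam * N ^ 2 := by
      have := mul_le_mul_of_nonneg_left h7 (show 0 ≤ a * v / 2 * lam by positivity)
      refine le_trans (le_of_eq ?_) this
      rw [hR₀]
      ring
    have h9 := mul_le_mul_of_nonneg_right hηR.le hlam.le
    have h10 := mul_le_mul_of_nonneg_right hkR.le hlam.le
    dsimp only
    linarith
  · have h1 : k * lam ^ 3 / (R₀ / 2 * lam) = 2 * k / R₀ * lam ^ 2 := by field_simp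
    rw [h1]
    refine le_trans (add_le_add ?_ ?_) ht
    · exact mul_le_of_le_one_right hτ0.le hlam2
    · exact mul_le_of_le_one_right (by positivity) hlam2

end Selection

end KernelSelection

theorem mainTheorem2 {p : ℕ}
    (μ : Measure ℝ) [IsFiniteMeasure μ] (hμ_ne : μ ≠ 0)
    (hμ_supp : ∃ a b : ℝ, 0 < a ∧ μ.support ⊆ Set.Icc a b)
    (Q : Measure ((Fin p → ℝ) × ℝ)) [IsProbabilityMeasure Q]
    (hQ : KernelSelection.IsRegularDistribution Q)
    (S : Finset (Fin p)) (hS : KernelSelection.IsSignalSet Q S)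
    (hmain : (KernelSelection.mainEffects Q S).Nonempty)
    (M : ℝ) (hM : 0 < M) :
    ∃ lam₀ c C τ : ℝ, 0 < lam₀ ∧ 0 < c ∧ 0 < C ∧ 0 < τ ∧
      ∀ (n : ℕ) (lam : ℝ), 0 < lam → lam ≤ lam₀ → C ≤ n * lam ^ 8 →
        ∃ E : Set (Fin n → (Fin p → ℝ) × ℝ), MeasurableSet E ∧
          1 - Real.exp (-(c * n * lam ^ 8)) ≤ (Measure.pi fun _ : Fin n => Q).real E ∧
          ∀ d ∈ E,
            (∃ β : ℝ → EuclideanSpace ℝ (Fin p), β 0 = 0 ∧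
              KernelSelection.IsGradientFlow
                (KernelSelection.krrObjective μ lam (KernelSelection.empirical d))
                (KernelSelection.box p M) β) ∧
            ∀ β : ℝ → EuclideanSpace ℝ (Fin p), β 0 = 0 →
              KernelSelection.IsGradientFlow
                (KernelSelection.krrObjective μ lam (KernelSelection.empirical d))
                (KernelSelection.box p M) β →
              ∀ t, τ ≤ t →
                (KernelSelection.supp (β t)).Nonempty ∧ KernelSelection.supp (β t) ⊆ S := by
  obtain ⟨a, b, ha, hsupp⟩ := hμ_supp
  obtain ⟨l₀, hl₀⟩ := hmain
  have hab : ∀ᵐ t ∂μ, t ∈ Set.Icc a b :=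
    (Filter.mem_of_superset Measure.support_mem_ae hsupp :)
  have hμ0 : 0 < μ.real Set.univ := by
    rw [measureReal_def]
    exact ENNReal.toReal_pos (by simpa using hμ_ne) (measure_ne_top _ _)
  have hb : 0 ≤ b := by
    have : (ae μ).NeBot := ae_neBot.2 hμ_ne
    obtain ⟨t, ht⟩ := hab.exists
    exact ha.le.trans (ht.1.trans ht.2)
  obtain ⟨MX, hMX⟩ := hQ.bounded_X
  obtain ⟨MY, hMY⟩ := hQ.bounded_Y
  have hbox : ∀ᵐ z ∂Q, z ∈ KernelSelection.dataBox p (max MX 0) (max MY 1) := by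
    filter_upwards [hMX, hMY] with z h1 h2
    exact ⟨fun j => (h1 j).trans (le_max_left _ _), h2.trans (le_max_left _ _)⟩
  have hMX0 : 0 ≤ max MX 0 := le_max_right _ _
  have hMY0 : 0 < max MY 1 := lt_max_of_lt_right one_pos
  obtain ⟨η, τ, hη, hτ, hsel⟩ := KernelSelection.exists_selection_constants ha hb hab hbox hMX0
    hMY0 hM hμ_ne hQ.centered hQ.variance_pos hS.prop hl₀
  obtain ⟨c, l₁, hc, hl₁, hevent⟩ := KernelSelection.exists_deviation_event hb hab hbox hMX0 hMY0
    hM.le hμ0 hη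
  refine ⟨min l₁ 1, c, 1, τ, lt_min hl₁ one_pos, hc, one_pos, hτ, fun n lam hlam hle hnl => ?_⟩
  have hlam1 : lam ≤ 1 := hle.trans (min_le_right _ _)
  obtain ⟨E, hE, hprob, hdev⟩ := hevent n lam hlam (hle.trans (min_le_left _ _)) hlam1 hnl
  have hn : 0 < n := by
    rcases Nat.eq_zero_or_pos n with h | h
    · subst h
      norm_num at hnl
    · exact h
  refine ⟨E, hE, hprob, fun d hd => ?_⟩
  have hprobd := KernelSelection.isProbabilityMeasure_empirical (d := d) hn
  have haed := KernelSelection.ae_empirical_mem KernelSelection.measurableSet_dataBox (hdev d hd).1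
  exact ⟨KernelSelection.exists_isGradientFlow hb hab haed hlam hM,
    hsel lam hlam hlam1 _ hprobd haed (hdev d hd).2⟩
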